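/- Let $n\ge 2$, let $\mathbb T^n=\mathbb R^n/2\pi\mathbb Z^n$, let $u,v\in\mathbb R^n$ be linearly independent, and let $F$ be the two-dimensional linear foliation of $\mathbb T^n$ whose leaves are the images of the planes parallel to $P=\operatorname{span}(u,v)$. Call $F$ weakly Diophantine if $$\liminf_{m\in\mathbb Z^n,\ |m|\to\infty}\bigl(|\langle m,u\rangle|+|\langle m,v\rangle|\bigr)^{1/|m|}=1,\qquad |m|=\sum_{j=1}^n|m_j|$$ (this does not depend on the basis $u,v$ of $P$; if the leaves are the level planes of the functions $l_j(x)=a_1^jx_1+a_2^jx_2-x_j$, $3\le j\le n$, one takes $u=(1,0,a_1^3,\dots,a_1^n)$, $v=(0,1,a_2^3,\dots,a_2^n)$, and the expression in brackets is $|m_1+\sum_{j\ge3}a_1^jm_j|+|m_2+\sum_{j\ge3}a_2^jm_j|$). A Euclidean metric is a flat Riemannian metric. Theorem 3. If $F$ is weakly Diophantine, then for every (real) analytic Riemannian metric $g$ on $\mathbb T^n$ there exists an analytic Euclidean metric $h$ on $\mathbb T^n$ such that all the leaves of $F$ are totally geodesic for $h$ and the restriction of $h$ to each leaf is conformal to the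 restriction of $g$ (that is, equal to it up to multiplication by a positive function). Conversely, if $F$ is not weakly Diophantine, then there exists an analytic Riemannian metric $g$ on $\mathbb T^n$ for which there is no Euclidean metric $h$ of class $C^2$ on $\mathbb T^n$ with these two properties. -/

import Mathlib

open Filter
open scoped ContDiff

noncomputable section

/-- A Riemannian metric on the torus `𝕋ⁿ = ℝⁿ / 2πℤⁿ`, without a regularity requirement: its matrix
in the standard coordinates of `ℝⁿ`, which is a `2πℤⁿ`-periodic function on `ℝⁿ` with values in the
(symmetric) positive definite matrices. -/
structure TorusMetric (n : ℕ) where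
  /-- the matrix `(g_{ij}(x))` of the metric at the point `x` -/
  mat : (Fin n → ℝ) → Matrix (Fin n) (Fin n) ℝ
  periodic : ∀ (x : Fin n → ℝ) (m : Fin n → ℤ),
    mat (x + fun j => 2 * Real.pi * (m j : ℝ)) = mat x
  posDef : ∀ x, (mat x).PosDef

/-- The partial derivative `∂f/∂x_i`. -/
def partialDeriv {n : ℕ} (i : Fin n) (f : (Fin n → ℝ) → ℝ) (x : Fin n → ℝ) : ℝ :=
  fderiv ℝ f x (Pi.single i 1)

namespace TorusMetric

variable {n : ℕ}

/-- The metric is of class `C^r`. -/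
def IsOfClass (r : WithTop ℕ∞) (g : TorusMetric n) : Prop :=
  ∀ i j, ContDiff ℝ r (fun x => g.mat x i j)

/-- The metric is (real) analytic: its coefficients are of class `C^ω`. -/
def IsAnalytic (g : TorusMetric n) : Prop := g.IsOfClass ω

/-- The scalar product `g_x(X, Y)` of the tangent vectors `X`, `Y` at `x`. -/
def inner (g : TorusMetric n) (x X Y : Fin n → ℝ) : ℝ :=
  ∑ i, ∑ j, g.mat x i j * X i * Y j

/-- The Christoffel symbol `Γ^k_{ij}` of the Levi-Civita connection. -/
def christoffel (g : TorusMetric n) (k i j : Fin n) (x : Fin n → ℝ) : ℝ :=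
  (1 / 2) * ∑ l, (g.mat x)⁻¹ k l *
    (partialDeriv i (fun y => g.mat y j l) x + partialDeriv j (fun y => g.mat y i l) x
      - partialDeriv l (fun y => g.mat y i j) x)

/-- The component along `∂_l` of the curvature `R(∂_i, ∂_j) ∂_k`. -/
def curvature (g : TorusMetric n) (l i j k : Fin n) (x : Fin n → ℝ) : ℝ :=
  partialDeriv i (g.christoffel l j k) x - partialDeriv j (g.christoffel l i k) x
    + ∑ m, (g.christoffel l i m x * g.christoffel m j k x
      - g.christoffel l j m x * g.christoffel m i k x)

/-- The metric (of class at least `C²`) is Euclidean, that is, flat. -/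
def IsEuclidean (g : TorusMetric n) : Prop :=
  ∀ l i j k x, g.curvature l i j k x = 0

/-- The covariant derivative at `x`, in the direction `X`, of the constant vector field `Y`. -/
def covDerivConst (g : TorusMetric n) (x X Y : Fin n → ℝ) : Fin n → ℝ :=
  fun k => ∑ i, ∑ j, g.christoffel k i j x * X i * Y j

/-- The leaves of the foliation by the planes parallel to `P` are totally geodesic: their second
fundamental form vanishes, that is, covariant derivatives of fields tangent to the leaves along
the leaves are tangent to the leaves (it suffices to say so for constant fields, as they span the
tangent planes `P`). -/
def HasTotallyGeodesicLeaves (g : TorusMetric n) (P : Submodule ℝ (Fin n → ℝ)) : Prop :=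
  ∀ x, ∀ X ∈ P, ∀ Y ∈ P, g.covDerivConst x X Y ∈ P

/-- On each leaf of the foliation by the planes parallel to `P`, the restriction of `h` is a
positive function times the restriction of `g`. -/
def IsLeafwiseConformal (h g : TorusMetric n) (P : Submodule ℝ (Fin n → ℝ)) : Prop :=
  ∀ x, ∃ c : ℝ, 0 < c ∧ ∀ X ∈ P, ∀ Y ∈ P, h.inner x X Y = c * g.inner x X Y

/-- `h` is a Euclidean metric on the torus for which the leaves are totally geodesic, and whose
restriction to each leaf is conformal for the complex structure induced by `g` on the leaf. -/
def IsEuclideanUniformization (h g : TorusMetric n) (P : Submodule ℝ (Fin n → ℝ)) : Prop :=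
  h.IsEuclidean ∧ h.HasTotallyGeodesicLeaves P ∧ h.IsLeafwiseConformal g P

end TorusMetric

/-- The size `|m| = |m_1| + ⋯ + |m_n|` of an integer vector. -/
def l1Size {n : ℕ} (m : Fin n → ℤ) : ℤ := ∑ j, |m j|

/-- The foliation of `𝕋ⁿ` by the planes parallel to the span of `u` and `v` is weakly Diophantine:
`liminf_{|m| → ∞} (|(m, u)| + |(m, v)|) ^ (1 / |m|) = 1`. For the foliation by the level planes of
the functions `a₁ʲ x_1 + a₂ʲ x_2 - x_j`, `3 ≤ j ≤ n`, one takes `u = (1, 0, a₁³, …, a₁ⁿ)` and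
`v = (0, 1, a₂³, …, a₂ⁿ)`; then `(m, u) = m_1 + ∑ a₁ʲ m_j` and `(m, v) = m_2 + ∑ a₂ʲ m_j`. (The
condition does not depend on the choice of the basis `u, v` of the plane.) -/
def IsWeaklyDiophantine {n : ℕ} (u v : Fin n → ℝ) : Prop :=
  liminf (fun m : Fin n → ℤ =>
      (|∑ j, (m j : ℝ) * u j| + |∑ j, (m j : ℝ) * v j|) ^ (1 / (l1Size m : ℝ)))
    (comap l1Size atTop) = 1

end

/-! Existence. In the leaf coordinate z for which ∂_u, ∂_v are the real coordinate fields, the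
conformal class of g on the leaves is a Beltrami coefficient μ, analytic with |μ| ≤ k < 1. It
suffices to find a complex 1-form w, closed on the whole torus, that restricts to f (dz + μ dz̄) on
the leaves with f nowhere zero. Then |w|² plus the standard square of a linear projection with
kernel P is a metric that is locally the pullback of a Euclidean one; its Levi-Civita connection
makes w and the projection parallel, so it is flat with geodesic leaves
(`LeafCoframe.isEuclidean_metric`), and it is conformal to g on the leaves.

Leafwise closedness means f_z̄ = (μ f)_z. With f = exp φ and p = φ_z̄ this becomes p = μ S p + μ_z,
where S is the Fourier multiplier that sends ∂_z̄ to ∂_z. Its symbol has modulus at most 1, so the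
Neumann series Σ (μ S)^j μ_z converges in L². The same contraction on the complex tori x - iξ with
small ξ, where |μ| is still bounded by a constant below 1, gives exponentially decaying Fourier
coefficients (`exists_beltramiIterate_bound`). No arithmetic of the foliation enters up to here.

Recovering φ from p requires that p have mean zero and that the symbol of ∂_z̄ be divided out. The
first is an algebraic fact: each term (μ S)^j μ_z is a ∂_z̄-derivative, because the terms are the
coefficients of the logarithmic derivative of the formal solution of f_z̄ = s (μ f)_z
(`exists_beltramiIterate_eq`). The second is where the weak Diophantine condition is used: it says
that the divisors are at least c exp(-ε|m|) for every ε > 0, so division preserves exponential decay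
(`IsWeaklyDiophantine.exists_leaf_primitive`). The same division writes f (dz + μ dz̄) as a constant
form plus the leafwise differential of some β; the full differential dβ then extends it to a closed
form w.

Converse. Let g be built from a leafwise closed form (1 + a) σ + b τ + i τ, where σ, τ are dual to
u, v, and let h be a C² uniformization. A flat metric on the torus has a parallel frame J, and J is
periodic: the length of the displacement of a deck translation in the developing map has a maximum,
which forces trivial holonomy (`TorusMetric.IsDevelopment.torusPeriodic`). The images α, γ in this
frame of the g-orthonormal leaf frame are orthogonal and of equal length, and their leafwise
derivatives stay in their span because the leaves are geodesic. A null Lagrangian in these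
derivatives is nonnegative, and has mean zero as a divergence; so it vanishes, and α, γ are constant
along the leaves (`LeafCoframe.exists_leafwise_constant_frame`).

If some m ≠ 0 annihilates u and v, take a proportional to cos (m, x) and b = 0: then J u and J v are
constant on the torus, while the ratio of their lengths is 1 + a. If there is no such m, α and γ are
constant on the torus. Take for a, b the derivatives along u, v of a formal series F = ε Σ exp(i(m,
x)) over the infinitely many m with exponentially small divisors. They are analytic, but closedness
of J forces its Fourier coefficients in the other directions to be those of dF times a component of
α, and these are not square summable. -/

noncomputable section

/-! ### Periodic functions and their mean values -/

open MeasureTheory Complex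

variable {n : ℕ} {F : Type*}

/-- `f` is `2πℤⁿ`-periodic. -/
def TorusPeriodic (f : (Fin n → ℝ) → F) : Prop :=
  ∀ (x : Fin n → ℝ) (m : Fin n → ℤ), f (x + fun j => 2 * Real.pi * (m j : ℝ)) = f x

/-- The projection `ℝⁿ → ℝⁿ / 2πℤⁿ`. -/
def toTorus (x : Fin n → ℝ) : UnitAddTorus (Fin n) :=
  fun j => ((x j / (2 * Real.pi) : ℝ) : UnitAddCircle)

/-- A representative in `ℝⁿ` of a point of the torus. -/
def torusRep (t : UnitAddTorus (Fin n)) : Fin n → ℝ :=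
  fun j => 2 * Real.pi * (AddCircle.equivIco 1 0 (t j) : ℝ)

/-- The normalized Haar measure of the torus. -/
def torusMeasure (n : ℕ) : Measure (UnitAddTorus (Fin n)) :=
  Measure.pi fun _ => AddCircle.haarAddCircle

instance : IsProbabilityMeasure (torusMeasure n) := by unfold torusMeasure; infer_instance
instance : (torusMeasure n).IsAddHaarMeasure := by unfold torusMeasure; infer_instance

/-- The mean value of a periodic function. -/
def torusMean [NormedAddCommGroup F] [NormedSpace ℝ F] (f : (Fin n → ℝ) → F) : F :=
  ∫ t, f (torusRep t) ∂(torusMeasure n)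

lemma toTorus_torusRep (t : UnitAddTorus (Fin n)) : toTorus (torusRep t) = t := by
  funext j
  have h : 2 * Real.pi * (AddCircle.equivIco 1 0 (t j) : ℝ) / (2 * Real.pi)
      = (AddCircle.equivIco 1 0 (t j) : ℝ) := by
    field_simp
  simp only [toTorus, torusRep, h]
  exact AddCircle.coe_equivIco

lemma torusRep_toTorus (x : Fin n → ℝ) :
    ∃ m : Fin n → ℤ, torusRep (toTorus x) = x + fun j => 2 * Real.pi * (m j : ℝ) := by
  have h : ∀ j, ∃ m : ℤ, torusRep (toTorus x) j = x j + 2 * Real.pi * (m : ℝ) := by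
    intro j
    have h1 := congrFun (toTorus_torusRep (toTorus x)) j
    simp only [toTorus] at h1
    obtain ⟨k, hk⟩ := AddSubgroup.mem_zmultiples_iff.1 (QuotientAddGroup.eq.1 h1)
    refine ⟨-k, ?_⟩
    have h2 : x j / (2 * Real.pi) - torusRep (toTorus x) j / (2 * Real.pi) = k := by
      simp only [zsmul_eq_mul, mul_one] at hk
      linarith
    field_simp at h2
    push_cast
    linarith
  choose m hm using h
  exact ⟨m, funext hm⟩

lemma TorusPeriodic.apply_torusRep_toTorus {f : (Fin n → ℝ) → F} (hf : TorusPeriodic f)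
    (x : Fin n → ℝ) : f (torusRep (toTorus x)) = f x := by
  obtain ⟨m, hm⟩ := torusRep_toTorus x
  rw [hm, hf]

lemma toTorus_add (x y : Fin n → ℝ) : toTorus (x + y) = toTorus x + toTorus y := by
  funext j
  simp [toTorus, add_div]

lemma isOpenQuotientMap_toTorus : IsOpenQuotientMap (toTorus (n := n)) := by
  have h : (toTorus (n := n)) = Pi.map fun _ => (fun s : ℝ => ((s / (2 * Real.pi) : ℝ) : UnitAddCircle)) := rfl
  rw [h]
  refine IsOpenQuotientMap.piMap fun _ => ?_
  have h1 : IsOpenQuotientMap (fun s : ℝ => s / (2 * Real.pi)) :=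
    (Homeomorph.mulRight₀ (2 * Real.pi)⁻¹ (by positivity)).isOpenQuotientMap
  exact (QuotientAddGroup.isOpenQuotientMap_mk (N := AddSubgroup.zmultiples (1 : ℝ))).comp h1

lemma TorusPeriodic.continuous_torusRep [TopologicalSpace F] {f : (Fin n → ℝ) → F}
    (hf : TorusPeriodic f) (hc : Continuous f) : Continuous fun t => f (torusRep t) := by
  rw [← isOpenQuotientMap_toTorus.continuous_comp_iff]
  convert hc using 1
  funext x
  exact hf.apply_torusRep_toTorus x

section Mean

variable [NormedAddCommGroup F]

lemma TorusPeriodic.integrable {f : (Fin n → ℝ) → F} (hf : TorusPeriodic f) (hc : Continuous f) :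
    Integrable (fun t => f (torusRep t)) (torusMeasure n) := by
  rw [← integrableOn_univ]
  exact (hf.continuous_torusRep hc).continuousOn.integrableOn_compact isCompact_univ

lemma TorusPeriodic.exists_norm_le {f : (Fin n → ℝ) → F} (hf : TorusPeriodic f)
    (hc : Continuous f) : ∃ C, 0 < C ∧ ∀ x, ‖f x‖ ≤ C := by
  obtain ⟨C, hC⟩ := isCompact_univ.exists_bound_of_continuousOn
    (hf.continuous_torusRep hc).continuousOn
  refine ⟨max C 1, by positivity, fun x => ?_⟩
  rw [← hf.apply_torusRep_toTorus x]
  exact (hC _ (Set.mem_univ _)).trans (le_max_left _ _)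

variable [NormedSpace ℝ F]

lemma torusMean_translate {f : (Fin n → ℝ) → F} (hf : TorusPeriodic f) (c : Fin n → ℝ) :
    torusMean (fun x => f (x + c)) = torusMean f := by
  unfold torusMean
  rw [← integral_add_right_eq_self (fun t => f (torusRep t)) (toTorus c)]
  congr 1
  funext t
  change f (torusRep t + c) = _
  rw [← hf.apply_torusRep_toTorus (torusRep t + c), toTorus_add, toTorus_torusRep]

lemma torusMean_add {f g : (Fin n → ℝ) → F} (hf : TorusPeriodic f) (hfc : Continuous f)
    (hg : TorusPeriodic g) (hgc : Continuous g) :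
    torusMean (fun x => f x + g x) = torusMean f + torusMean g :=
  integral_add (hf.integrable hfc) (hg.integrable hgc)

lemma torusMean_sub {f g : (Fin n → ℝ) → F} (hf : TorusPeriodic f) (hfc : Continuous f)
    (hg : TorusPeriodic g) (hgc : Continuous g) :
    torusMean (fun x => f x - g x) = torusMean f - torusMean g :=
  integral_sub (hf.integrable hfc) (hg.integrable hgc)

lemma torusMean_const [CompleteSpace F] (c : F) : torusMean (fun _ : Fin n → ℝ => c) = c := by
  simp [torusMean]

lemma TorusPeriodic.eq_zero_of_torusMean_eq_zero {f : (Fin n → ℝ) → ℝ} (hf : TorusPeriodic f)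
    (hc : Continuous f) (h0 : ∀ x, 0 ≤ f x) (hm : torusMean f = 0) (x : Fin n → ℝ) : f x = 0 := by
  have h1 := (integral_eq_zero_iff_of_nonneg (fun t => h0 (torusRep t)) (hf.integrable hc)).1 hm
  have h2 := (Continuous.ae_eq_iff_eq (torusMeasure n) (hf.continuous_torusRep hc)
    continuous_const).1 h1
  rw [← hf.apply_torusRep_toTorus x]
  exact congrFun h2 _

lemma TorusPeriodic.fderiv {f : (Fin n → ℝ) → F} (hf : TorusPeriodic f) :
    TorusPeriodic (fderiv ℝ f) := by
  intro x m
  rw [← fderiv_comp_add_right]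
  congr 1
  funext y
  exact hf y m

lemma TorusPeriodic.fderiv_apply {f : (Fin n → ℝ) → F} (hf : TorusPeriodic f) (v : Fin n → ℝ) :
    TorusPeriodic (fun x => _root_.fderiv ℝ f x v) := fun x m => by
  simp only [hf.fderiv x m]

/-- The mean of x ↦ f (x + s v) does not depend on s; differentiate under the integral at s = 0. All
later integrations by parts reduce to this. -/
lemma torusMean_fderiv [CompleteSpace F] {f : (Fin n → ℝ) → F} (hf : TorusPeriodic f)
    (hc : ContDiff ℝ 1 f) (v : Fin n → ℝ) : torusMean (fun x => fderiv ℝ f x v) = 0 := by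
  obtain ⟨C, hC0, hC⟩ := hf.fderiv.exists_norm_le (hc.continuous_fderiv one_ne_zero)
  have hd : ∀ x (s : ℝ), HasDerivAt (fun s : ℝ => f (x + s • v)) (fderiv ℝ f (x + s • v) v) s := by
    intro x s
    have h1 : HasDerivAt (fun s : ℝ => x + s • v) v s := by
      simpa using ((hasDerivAt_id s).smul_const v).const_add x
    exact ((hc.differentiable one_ne_zero _).hasFDerivAt).comp_hasDerivAt s h1
  have hp : ∀ s : ℝ, TorusPeriodic (fun x => f (x + s • v)) := by
    intro s x m
    change f (_ + _ + _) = _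
    rw [add_right_comm]
    exact hf _ m
  have key := hasDerivAt_integral_of_dominated_loc_of_deriv_le (μ := torusMeasure n) (𝕜 := ℝ)
    (F := fun s t => f (torusRep t + s • v)) (F' := fun s t => fderiv ℝ f (torusRep t + s • v) v)
    (x₀ := 0) (s := Set.univ) (bound := fun _ => C * ‖v‖) Filter.univ_mem
    (Eventually.of_forall fun s => ((hp s).integrable
      (hc.continuous.comp (by fun_prop))).aestronglyMeasurable)
    ((hp 0).integrable (hc.continuous.comp (by fun_prop))) ?_ ?_ (integrable_const _) ?_
  · have h2 : (fun s : ℝ => ∫ t, f (torusRep t + s • v) ∂(torusMeasure n))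
        = fun _ => torusMean f := by
      funext s
      exact torusMean_translate hf (s • v)
    rw [h2] at key
    have h3 := key.2.unique (hasDerivAt_const _ _)
    simpa [torusMean] using h3
  · simp only [zero_smul, add_zero]
    exact ((hf.fderiv_apply v).integrable
      ((hc.continuous_fderiv one_ne_zero).clm_apply continuous_const)).aestronglyMeasurable
  · exact Eventually.of_forall fun t s _ =>
      ((fderiv ℝ f _).le_opNorm v).trans (by gcongr; exact hC _)
  · exact Eventually.of_forall fun t s _ => hd _ s

end Mean


/-! ### Characters, Fourier coefficients and Fourier series -/

/-- The scalar product `(m, x)` of an integer vector and a vector. -/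
def intPairing (m : Fin n → ℤ) (x : Fin n → ℝ) : ℝ := ∑ j, (m j : ℝ) * x j

/-- The character `exp (i (m, x))` of the torus. -/
def torusChar (m : Fin n → ℤ) (x : Fin n → ℝ) : ℂ := Complex.exp (intPairing m x * I)

/-- The Fourier coefficient of a periodic function. -/
def torusCoeff (f : (Fin n → ℝ) → ℂ) (m : Fin n → ℤ) : ℂ :=
  torusMean fun x => f x * torusChar (-m) x

lemma intPairing_add_left (m k : Fin n → ℤ) (x : Fin n → ℝ) :
    intPairing (m + k) x = intPairing m x + intPairing k x := by
  simp [intPairing, add_mul, Finset.sum_add_distrib]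

lemma intPairing_neg_left (m : Fin n → ℤ) (x : Fin n → ℝ) :
    intPairing (-m) x = -intPairing m x := by
  simp [intPairing]

lemma intPairing_zero_left (x : Fin n → ℝ) : intPairing 0 x = 0 := by simp [intPairing]

lemma intPairing_add_right (m : Fin n → ℤ) (x y : Fin n → ℝ) :
    intPairing m (x + y) = intPairing m x + intPairing m y := by
  simp [intPairing, mul_add, Finset.sum_add_distrib]

/-- The scalar product with an integer vector as a continuous linear form. -/
def intPairingCLM (m : Fin n → ℤ) : (Fin n → ℝ) →L[ℝ] ℝ :=
  ∑ j, (m j : ℝ) • ContinuousLinearMap.proj j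

lemma intPairingCLM_apply (m : Fin n → ℤ) (x : Fin n → ℝ) :
    intPairingCLM m x = intPairing m x := by
  simp [intPairingCLM, intPairing]

lemma abs_intPairing_le (m : Fin n → ℤ) (x : Fin n → ℝ) :
    |intPairing m x| ≤ (l1Size m : ℝ) * ‖x‖ := by
  unfold intPairing l1Size
  push_cast
  rw [Finset.sum_mul]
  refine (Finset.abs_sum_le_sum_abs _ _).trans (Finset.sum_le_sum fun j _ => ?_)
  rw [abs_mul]
  gcongr
  exact norm_le_pi_norm x j

lemma l1Size_nonneg (m : Fin n → ℤ) : 0 ≤ l1Size m := Finset.sum_nonneg fun _ _ => abs_nonneg _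

lemma l1Size_add_le (m k : Fin n → ℤ) : l1Size (m + k) ≤ l1Size m + l1Size k := by
  unfold l1Size
  rw [← Finset.sum_add_distrib]
  exact Finset.sum_le_sum fun j _ => abs_add_le _ _

lemma norm_intPairingCLM_le (m : Fin n → ℤ) : ‖intPairingCLM m‖ ≤ (l1Size m : ℝ) :=
  ContinuousLinearMap.opNorm_le_bound _ (by exact_mod_cast l1Size_nonneg m) fun x => by
    rw [intPairingCLM_apply]
    exact abs_intPairing_le m x

lemma torusChar_add_left (m k : Fin n → ℤ) (x : Fin n → ℝ) :
    torusChar (m + k) x = torusChar m x * torusChar k x := by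
  rw [torusChar, torusChar, torusChar, intPairing_add_left, ← Complex.exp_add]
  push_cast
  ring_nf

lemma torusChar_zero_left (x : Fin n → ℝ) : torusChar 0 x = 1 := by
  simp [torusChar, intPairing_zero_left]

lemma norm_torusChar (m : Fin n → ℤ) (x : Fin n → ℝ) : ‖torusChar m x‖ = 1 :=
  Complex.norm_exp_ofReal_mul_I _

lemma torusPeriodic_torusChar (m : Fin n → ℤ) : TorusPeriodic (torusChar m) := by
  intro x k
  unfold torusChar
  rw [intPairing_add_right]
  have h : intPairing m (fun j => 2 * Real.pi * (k j : ℝ)) = (∑ j, m j * k j : ℤ) * (2 * Real.pi) := by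
    unfold intPairing
    push_cast
    rw [Finset.sum_mul]
    exact Finset.sum_congr rfl fun j _ => by ring
  rw [h]
  push_cast
  rw [add_mul, Complex.exp_add]
  have h2 := Complex.exp_int_mul_two_pi_mul_I (∑ j, m j * k j)
  push_cast at h2
  rw [show (∑ j, (m j : ℂ) * (k j : ℂ)) * (2 * (Real.pi : ℂ)) * I
    = (∑ j, (m j : ℂ) * (k j : ℂ)) * (2 * (Real.pi : ℂ) * I) by ring, h2, mul_one]

lemma contDiff_torusChar (m : Fin n → ℤ) {r : WithTop ℕ∞} : ContDiff ℝ r (torusChar m) := by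
  have h : torusChar m = fun x => Complex.exp (((intPairingCLM m x : ℝ) : ℂ) * I) := by
    funext x
    rw [intPairingCLM_apply, torusChar]
  rw [h]
  have h1 : ContDiff ℝ r fun x => ((intPairingCLM m x : ℝ) : ℂ) :=
    Complex.ofRealCLM.contDiff.comp (intPairingCLM m).contDiff
  exact (h1.mul contDiff_const).cexp

lemma hasFDerivAt_torusChar (m : Fin n → ℤ) (x : Fin n → ℝ) :
    HasFDerivAt (torusChar m)
      ((torusChar m x * I) • (Complex.ofRealCLM.comp (intPairingCLM m))) x := by
  have h : torusChar m = fun x => Complex.exp (((intPairingCLM m x : ℝ) : ℂ) * I) := by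
    funext x
    rw [intPairingCLM_apply, torusChar]
  have h1 : HasFDerivAt (fun x => ((intPairingCLM m x : ℝ) : ℂ))
      (Complex.ofRealCLM.comp (intPairingCLM m)) x :=
    (Complex.ofRealCLM.comp (intPairingCLM m)).hasFDerivAt
  have h2 := (h1.mul_const I).cexp
  rw [← h] at h2
  exact h2.congr_fderiv (by rw [h, mul_smul])

lemma fderiv_torusChar (m : Fin n → ℤ) (x v : Fin n → ℝ) :
    fderiv ℝ (torusChar m) x v = I * intPairing m v * torusChar m x := by
  rw [(hasFDerivAt_torusChar m x).fderiv]
  simp [intPairingCLM_apply]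
  ring

lemma mFourier_toTorus (m : Fin n → ℤ) (x : Fin n → ℝ) :
    UnitAddTorus.mFourier m (toTorus x) = torusChar m x := by
  simp only [UnitAddTorus.mFourier, toTorus, ContinuousMap.coe_mk, torusChar, intPairing]
  push_cast
  rw [Finset.sum_mul, Complex.exp_sum]
  refine Finset.prod_congr rfl fun j _ => ?_
  rw [fourier_coe_apply]
  congr 1
  push_cast
  field_simp

lemma TorusPeriodic.mul {R : Type*} [Mul R] {f g : (Fin n → ℝ) → R} (hf : TorusPeriodic f)
    (hg : TorusPeriodic g) : TorusPeriodic fun x => f x * g x := fun x m => by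
  simp only [hf x m, hg x m]

/-- A continuous periodic function as a continuous function on the torus. -/
def TorusPeriodic.lift {f : (Fin n → ℝ) → ℂ} (hf : TorusPeriodic f) (hc : Continuous f) :
    C(UnitAddTorus (Fin n), ℂ) := ⟨fun t => f (torusRep t), hf.continuous_torusRep hc⟩

lemma TorusPeriodic.mFourierCoeff_lift {f : (Fin n → ℝ) → ℂ} (hf : TorusPeriodic f)
    (hc : Continuous f) : UnitAddTorus.mFourierCoeff (hf.lift hc) = torusCoeff f := by
  funext m
  rw [torusCoeff, torusMean]
  change ∫ t, UnitAddTorus.mFourier (-m) t • f (torusRep t) ∂(torusMeasure n) = _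
  congr 1
  funext t
  rw [smul_eq_mul, mul_comm, ← mFourier_toTorus, toTorus_torusRep]

lemma TorusPeriodic.hasSum_torusCoeff {f : (Fin n → ℝ) → ℂ} (hf : TorusPeriodic f)
    (hc : Continuous f) (hs : Summable (torusCoeff f)) (x : Fin n → ℝ) :
    HasSum (fun m => torusCoeff f m * torusChar m x) (f x) := by
  rw [← hf.mFourierCoeff_lift hc] at hs ⊢
  have h := UnitAddTorus.hasSum_mFourier_series_apply_of_summable hs (toTorus x)
  simp only [smul_eq_mul, mFourier_toTorus] at h
  convert h using 1
  exact (hf.apply_torusRep_toTorus x).symm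

lemma TorusPeriodic.hasSum_sq_torusCoeff {f : (Fin n → ℝ) → ℂ} (hf : TorusPeriodic f)
    (hc : Continuous f) :
    HasSum (fun m => ‖torusCoeff f m‖ ^ 2) (torusMean fun x => ‖f x‖ ^ 2) := by
  have h := UnitAddTorus.hasSum_sq_mFourierCoeff
    (ContinuousMap.toLp (E := ℂ) 2 (torusMeasure n) ℂ (hf.lift hc))
  have h1 : ∀ m, UnitAddTorus.mFourierCoeff
      (ContinuousMap.toLp (E := ℂ) 2 (torusMeasure n) ℂ (hf.lift hc)) m = torusCoeff f m := by
    intro m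
    rw [← hf.mFourierCoeff_lift hc]
    exact UnitAddTorus.mFourierCoeff_toLp _ _
  have h2 := h.congr_fun fun m => (congrArg (fun z : ℂ => ‖z‖ ^ 2) (h1 m)).symm
  convert h2 using 1
  refine (integral_congr_ae ?_).symm
  filter_upwards [ContinuousMap.coeFn_toLp (p := 2) (𝕜 := ℂ) (torusMeasure n) (hf.lift hc)] with t ht
  exact congrArg (fun z : ℂ => ‖z‖ ^ 2) ht

lemma torusMean_torusChar (m : Fin n → ℤ) :
    torusMean (torusChar m) = if m = 0 then 1 else 0 := by
  split_ifs with h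
  · subst h
    have : torusChar (0 : Fin n → ℤ) = fun _ => 1 := funext torusChar_zero_left
    rw [this, torusMean_const]
  · obtain ⟨j, hj⟩ := Function.ne_iff.1 h
    have h1 := torusMean_fderiv (torusPeriodic_torusChar m) (contDiff_torusChar m) (Pi.single j 1)
    simp only [fderiv_torusChar] at h1
    have h2 : intPairing m (Pi.single j 1) = m j := by
      simp [intPairing, Pi.single_apply]
    rw [h2, torusMean, integral_const_mul] at h1
    have h3 : I * ((m j : ℝ) : ℂ) ≠ 0 := by
      simpa using hj
    exact (mul_eq_zero.1 h1).resolve_left h3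

lemma hasSum_torusMean {ι : Type*} [Countable ι] {f : ι → (Fin n → ℝ) → ℂ} {g : (Fin n → ℝ) → ℂ}
    (hf : ∀ i, TorusPeriodic (f i)) (hc : ∀ i, Continuous (f i)) {c : ι → ℝ} (hs : Summable c)
    (hb : ∀ i x, ‖f i x‖ ≤ c i) (hg : ∀ x, HasSum (fun i => f i x) (g x)) :
    HasSum (fun i => torusMean (f i)) (torusMean g) := by
  have h := hasSum_integral_of_summable_integral_norm (μ := torusMeasure n)
    (F := fun i t => f i (torusRep t)) (fun i => (hf i).integrable (hc i)) ?_
  · have e : torusMean g = ∫ t, ∑' i, f i (torusRep t) ∂(torusMeasure n) := by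
      unfold torusMean
      congr 1
      funext t
      exact (hg _).tsum_eq.symm
    rw [e]
    exact h
  · refine Summable.of_nonneg_of_le (fun i => integral_nonneg fun t => norm_nonneg _)
      (fun i => ?_) hs
    calc ∫ t, ‖f i (torusRep t)‖ ∂(torusMeasure n) ≤ ∫ _, c i ∂(torusMeasure n) :=
          integral_mono ((hf i).integrable (hc i)).norm (integrable_const _) fun t => hb i _
      _ = c i := by simp

/-- The sum of the Fourier series with given coefficients. -/
def torusSeries (a : (Fin n → ℤ) → ℂ) (x : Fin n → ℝ) : ℂ := ∑' m, a m * torusChar m x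

lemma summable_torusSeries {a : (Fin n → ℤ) → ℂ} (ha : Summable a) (x : Fin n → ℝ) :
    Summable fun m => a m * torusChar m x := by
  refine Summable.of_norm ?_
  simpa [norm_torusChar] using ha.norm

lemma torusPeriodic_torusSeries (a : (Fin n → ℤ) → ℂ) : TorusPeriodic (torusSeries a) := by
  intro x m
  unfold torusSeries
  congr 1
  funext k
  rw [torusPeriodic_torusChar k x m]

lemma continuous_torusSeries {a : (Fin n → ℤ) → ℂ} (ha : Summable a) :
    Continuous (torusSeries a) :=
  continuous_tsum (fun m => continuous_const.mul (contDiff_torusChar m (r := 0)).continuous)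
    ha.norm fun m x => by simp [norm_torusChar]

lemma torusCoeff_torusSeries {a : (Fin n → ℤ) → ℂ} (ha : Summable a) :
    torusCoeff (torusSeries a) = a := by
  funext m
  have h := hasSum_torusMean (f := fun k x => a k * torusChar k x * torusChar (-m) x)
    (g := fun x => torusSeries a x * torusChar (-m) x) (c := fun k => ‖a k‖)
    (fun k => (TorusPeriodic.mul (fun _ _ => rfl) (torusPeriodic_torusChar k)).mul
      (torusPeriodic_torusChar _))
    (fun k => (continuous_const.mul (contDiff_torusChar k (r := 0)).continuous).mul
      (contDiff_torusChar _ (r := 0)).continuous) ha.norm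
    (fun k x => by simp [norm_torusChar])
    (fun x => (summable_torusSeries ha x).hasSum.mul_right _)
  have h2 : ∀ k, torusMean (fun x => a k * torusChar k x * torusChar (-m) x)
      = if k = m then a m else 0 := by
    intro k
    have : (fun x => a k * torusChar k x * torusChar (-m) x)
        = fun x => a k * torusChar (k + -m) x := by
      funext x
      rw [torusChar_add_left, mul_assoc]
    rw [this, torusMean, integral_const_mul]
    have h3 := torusMean_torusChar (k + -m)
    rw [torusMean] at h3
    rw [h3]
    by_cases hk : k = m
    · simp [hk]
    · have : k + -m ≠ 0 := by rwa [← sub_eq_add_neg, sub_ne_zero]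
      simp [hk, this]
  simp only [h2] at h
  exact h.unique (hasSum_ite_eq m (a m))

lemma TorusPeriodic.torusSeries_torusCoeff {f : (Fin n → ℝ) → ℂ} (hf : TorusPeriodic f)
    (hc : Continuous f) (hs : Summable (torusCoeff f)) : torusSeries (torusCoeff f) = f :=
  funext fun x => (hf.hasSum_torusCoeff hc hs x).tsum_eq

lemma torusCoeff_fderiv {f : (Fin n → ℝ) → ℂ} (hf : TorusPeriodic f) (hc : ContDiff ℝ 1 f)
    (v : Fin n → ℝ) (m : Fin n → ℤ) :
    torusCoeff (fun x => fderiv ℝ f x v) m = I * intPairing m v * torusCoeff f m := by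
  have h := torusMean_fderiv (hf.mul (torusPeriodic_torusChar (-m)))
    (hc.mul (contDiff_torusChar _)) v
  have h1 : ∀ x, fderiv ℝ (fun x => f x * torusChar (-m) x) x v
      = fderiv ℝ f x v * torusChar (-m) x - I * intPairing m v * (f x * torusChar (-m) x) := by
    intro x
    have := ((hc.differentiable one_ne_zero x).hasFDerivAt.mul (hasFDerivAt_torusChar (-m) x)).fderiv
    change fderiv ℝ (f * torusChar (-m)) x v = _
    rw [this]
    simp [intPairingCLM_apply, intPairing_neg_left]
    ring
  simp only [h1] at h
  rw [torusMean_sub ((hf.fderiv_apply v).mul (torusPeriodic_torusChar _))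
    (((hc.continuous_fderiv one_ne_zero).clm_apply continuous_const).mul
      (contDiff_torusChar _ (r := 0)).continuous)
    (TorusPeriodic.mul (fun _ _ => rfl) (hf.mul (torusPeriodic_torusChar _)))
    (continuous_const.mul (hc.continuous.mul (contDiff_torusChar _ (r := 0)).continuous)),
    sub_eq_zero] at h
  rw [torusCoeff, h, torusMean, integral_const_mul]
  rfl

/-- Only f is expanded in its absolutely convergent series; g is merely bounded, so its coefficients
need not be summable. -/
lemma torusCoeff_mul {f g : (Fin n → ℝ) → ℂ} (hf : TorusPeriodic f) (hfc : Continuous f)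
    (hfs : Summable (torusCoeff f)) (hg : TorusPeriodic g) (hgc : Continuous g)
    (m : Fin n → ℤ) :
    HasSum (fun k => torusCoeff f k * torusCoeff g (m - k)) (torusCoeff (fun x => f x * g x) m) := by
  obtain ⟨C, hC0, hC⟩ := hg.exists_norm_le hgc
  have h := hasSum_torusMean (f := fun k x => torusCoeff f k * torusChar k x * (g x * torusChar (-m) x))
    (g := fun x => f x * (g x * torusChar (-m) x)) (c := fun k => ‖torusCoeff f k‖ * C)
    (fun k => (TorusPeriodic.mul (fun _ _ => rfl) (torusPeriodic_torusChar k)).mul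
      (hg.mul (torusPeriodic_torusChar _)))
    (fun k => (continuous_const.mul (contDiff_torusChar k (r := 0)).continuous).mul
      (hgc.mul (contDiff_torusChar _ (r := 0)).continuous)) (hfs.norm.mul_right C)
    (fun k x => by
      simp only [norm_mul, norm_torusChar, mul_one]
      gcongr
      exact hC x)
    (fun x => (hf.hasSum_torusCoeff hfc hfs x).mul_right _)
  convert h using 1
  · funext k
    have : (fun x => torusCoeff f k * torusChar k x * (g x * torusChar (-m) x))
        = fun x => torusCoeff f k * (g x * torusChar (-(m - k)) x) := by
      funext x
      rw [neg_sub, sub_eq_add_neg, torusChar_add_left]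
      ring
    rw [this, torusMean, integral_const_mul]
    rfl
  · unfold torusCoeff
    congr 1
    funext x
    ring

end

noncomputable section

open MeasureTheory Complex

/-! ### Cauchy estimates for real analytic functions -/

section AnalyticBounds

variable {E F : Type*} [NormedAddCommGroup E] [NormedSpace ℝ E]
  [NormedAddCommGroup F] [NormedSpace ℝ F]

/-- Recentering the power series at a nearby y gives the derivatives at y. At a radius below half
the radius of convergence, a single convergent double sum dominates all orders k and all
recenterings at once, which makes the bound uniform in y. -/
lemma AnalyticAt.exists_iteratedFDeriv_bound [CompleteSpace F] {f : E → F} {x : E}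
    (hf : AnalyticAt ℝ f x) :
    ∃ r : ℝ, 0 < r ∧ ∃ S : ℝ, ∀ᶠ y in nhds x, ∀ (k : ℕ) (v : E), ‖v‖ ≤ 1 →
      ‖iteratedFDeriv ℝ k f y fun _ => v‖ * r ^ k ≤ S * k.factorial := by
  obtain ⟨p, R, hp⟩ := hf
  obtain ⟨r', hr'0, hr'⟩ := ENNReal.lt_iff_exists_nnreal_btwn.1 hp.r_pos
  set r : NNReal := r' / 2 with hr
  have hr0 : 0 < r := by
    have : 0 < r' := by exact_mod_cast hr'0
    positivity
  have hrr : ((r : ENNReal) + r) < p.radius := by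
    refine lt_of_eq_of_lt ?_ (hr'.trans_le hp.r_le)
    rw [← ENNReal.coe_add, hr, add_halves]
  have hs := p.changeOriginSeries_summable_aux₁ hrr
  set S := ∑' s : Σ k l : ℕ, { s : Finset (Fin (k + l)) // s.card = l },
    ‖p (s.1 + s.2.1)‖₊ * r ^ s.2.1 * r ^ s.1 with hS
  refine ⟨r, by exact_mod_cast hr0, S, ?_⟩
  filter_upwards [Metric.ball_mem_nhds x (show (0 : ℝ) < r by exact_mod_cast hr0)] with y hy k v hv
  have hyr : ‖y - x‖₊ < r := by
    rw [← NNReal.coe_lt_coe, coe_nnnorm, ← dist_eq_norm]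
    exact hy
  have hyR : (‖y - x‖₊ : ENNReal) < R := by
    refine lt_trans ?_ hr'
    have : r ≤ r' := half_le_self (by positivity)
    exact_mod_cast hyr.trans_le this
  have h1 := hp.changeOrigin hyR
  rw [add_sub_cancel] at h1
  have h2 := h1.factorial_smul v k
  have h3 : ‖p.changeOrigin (y - x) k‖₊ * r ^ k ≤ S := by
    have h4 := p.nnnorm_changeOrigin_le (x := y - x) k (hyR.trans_le hp.r_le)
    have h6 : Summable fun s : Σ l : ℕ, { s : Finset (Fin (k + l)) // s.card = l } =>
        ‖p (k + s.1)‖₊ * r ^ s.1 :=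
      p.changeOriginSeries_summable_aux₂ (lt_of_le_of_lt le_self_add hrr) k
    calc ‖p.changeOrigin (y - x) k‖₊ * r ^ k
        ≤ (∑' s : Σ l : ℕ, { s : Finset (Fin (k + l)) // s.card = l },
            ‖p (k + s.1)‖₊ * r ^ s.1) * r ^ k := by
          gcongr
          refine h4.trans (Summable.tsum_le_tsum (fun s => by gcongr) ?_ h6)
          exact NNReal.summable_of_le (fun s => by gcongr) h6
      _ = ∑' s : Σ l : ℕ, { s : Finset (Fin (k + l)) // s.card = l },
            ‖p (k + s.1)‖₊ * r ^ s.1 * r ^ k := by rw [NNReal.tsum_mul_right]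
      _ ≤ S := by
          exact NNReal.tsum_comp_le_tsum_of_inj hs (i := Sigma.mk k) sigma_mk_injective
  rw [← h2]
  have h7 : ‖p.changeOrigin (y - x) k fun _ => v‖ ≤ ‖p.changeOrigin (y - x) k‖ := by
    refine (ContinuousMultilinearMap.le_opNorm _ _).trans ?_
    rw [Finset.prod_const]
    exact mul_le_of_le_one_right (norm_nonneg _) (pow_le_one₀ (norm_nonneg _) hv)
  have h3' : ‖p.changeOrigin (y - x) k‖ * (r : ℝ) ^ k ≤ S := by exact_mod_cast h3
  rw [← Nat.cast_smul_eq_nsmul ℝ, norm_smul, RCLike.norm_natCast]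
  calc (k.factorial : ℝ) * ‖p.changeOrigin (y - x) k fun _ => v‖ * (r : ℝ) ^ k
      ≤ k.factorial * ‖p.changeOrigin (y - x) k‖ * (r : ℝ) ^ k := by gcongr
    _ = (‖p.changeOrigin (y - x) k‖ * (r : ℝ) ^ k) * k.factorial := by ring
    _ ≤ S * k.factorial := by gcongr

lemma IsCompact.exists_iteratedFDeriv_bound [CompleteSpace F] {f : E → F} {K : Set E} (hK : IsCompact K)
    (hf : ∀ x ∈ K, AnalyticAt ℝ f x) :
    ∃ r : ℝ, 0 < r ∧ ∃ S : ℝ, ∀ y ∈ K, ∀ (k : ℕ) (v : E), ‖v‖ ≤ 1 →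
      ‖iteratedFDeriv ℝ k f y fun _ => v‖ * r ^ k ≤ S * k.factorial := by
  refine hK.induction_on (p := fun s => ∃ r : ℝ, 0 < r ∧ ∃ S : ℝ, ∀ y ∈ s, ∀ (k : ℕ) (v : E),
    ‖v‖ ≤ 1 → ‖iteratedFDeriv ℝ k f y fun _ => v‖ * r ^ k ≤ S * k.factorial) ?_ ?_ ?_ ?_
  · exact ⟨1, one_pos, 0, by simp⟩
  · rintro s t hst ⟨r, hr, S, h⟩
    exact ⟨r, hr, S, fun y hy => h y (hst hy)⟩
  · rintro s t ⟨r, hr, S, h⟩ ⟨r', hr', S', h'⟩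
    refine ⟨min r r', lt_min hr hr', max S S', fun y hy k v hv => ?_⟩
    rcases hy with hy | hy
    · calc _ ≤ ‖iteratedFDeriv ℝ k f y fun _ => v‖ * r ^ k := by
            gcongr
            exact min_le_left _ _
        _ ≤ S * k.factorial := h y hy k v hv
        _ ≤ _ := by
            gcongr
            exact le_max_left _ _
    · calc _ ≤ ‖iteratedFDeriv ℝ k f y fun _ => v‖ * r' ^ k := by
            gcongr
            exact min_le_right _ _
        _ ≤ S' * k.factorial := h' y hy k v hv
        _ ≤ _ := by
            gcongr
            exact le_max_right _ _
  · intro x hx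
    obtain ⟨r, hr, S, h⟩ := (hf x hx).exists_iteratedFDeriv_bound
    exact ⟨_, mem_nhdsWithin_of_mem_nhds h, r, hr, S, fun y hy => hy⟩

lemma fderiv_iteratedFDeriv_apply {f : E → F} (hf : ContDiff ℝ ω f) (k : ℕ) (v x : E) :
    fderiv ℝ (fun y => iteratedFDeriv ℝ k f y fun _ => v) x v
      = iteratedFDeriv ℝ (k + 1) f x fun _ => v := by
  have h1 : DifferentiableAt ℝ (iteratedFDeriv ℝ k f) x :=
    (hf.differentiable_iteratedFDeriv (WithTop.coe_lt_top _)).differentiableAt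
  have h2 := ((ContinuousMultilinearMap.apply ℝ (fun _ : Fin k => E) F
    (fun _ => v)).hasFDerivAt.comp x h1.hasFDerivAt).fderiv
  rw [iteratedFDeriv_succ_apply_left]
  change fderiv ℝ ((ContinuousMultilinearMap.apply ℝ (fun _ : Fin k => E) F fun _ => v) ∘ iteratedFDeriv ℝ k f) x v = _
  rw [h2]
  rfl

lemma contDiff_iteratedFDeriv_apply {f : E → F} (hf : ContDiff ℝ ω f) (k : ℕ) (v : E) :
    ContDiff ℝ ω fun y => iteratedFDeriv ℝ k f y fun _ => v :=
  (ContinuousMultilinearMap.apply ℝ (fun _ : Fin k => E) F (fun _ => v)).contDiff.comp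
    (hf.iteratedFDeriv_right (m := ω) (i := k) (by simp))

end AnalyticBounds

/-! ### Analyticity as exponential decay of Fourier coefficients -/

section ExpDecay

variable {n : ℕ}

lemma summable_exp_neg_mul_l1Size {ρ : ℝ} (hρ : 0 < ρ) :
    Summable fun m : Fin n → ℤ => Real.exp (-ρ * l1Size m) := by
  have h1 : Summable fun k : ℤ => Real.exp (-ρ * |k|) := by
    have h0 : Summable fun k : ℕ => Real.exp (-ρ * k) := by
      have := Real.summable_exp_nat_mul_iff.2 (neg_lt_zero.2 hρ)
      simpa [mul_comm] using this
    refine Summable.of_nat_of_neg ?_ ?_ <;> simpa using h0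
  set C := ∑' k : ℤ, Real.exp (-ρ * |k|)
  refine summable_of_sum_le (c := C ^ n) (fun m => (Real.exp_pos _).le) fun s => ?_
  classical
  set t : Fin n → Finset ℤ := fun j => s.image fun m => m j
  calc ∑ m ∈ s, Real.exp (-ρ * l1Size m)
      ≤ ∑ m ∈ Fintype.piFinset t, Real.exp (-ρ * l1Size m) := by
        refine Finset.sum_le_sum_of_subset_of_nonneg ?_ fun _ _ _ => (Real.exp_pos _).le
        intro m hm
        rw [Fintype.mem_piFinset]
        exact fun j => Finset.mem_image_of_mem _ hm
    _ = ∏ j, ∑ k ∈ t j, Real.exp (-ρ * |k|) := by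
        rw [Finset.prod_univ_sum]
        refine Finset.sum_congr rfl fun m _ => ?_
        rw [← Real.exp_sum]
        congr 1
        unfold l1Size
        push_cast
        rw [Finset.mul_sum]
    _ ≤ ∏ _j : Fin n, C := by
        refine Finset.prod_le_prod (fun j _ => Finset.sum_nonneg fun _ _ => (Real.exp_pos _).le)
          fun j _ => ?_
        have := h1.sum_le_tsum (t j) (fun _ _ => (Real.exp_pos _).le)
        exact this
    _ = C ^ n := by simp

/-- A family of Fourier coefficients decays exponentially. -/
def HasExpDecay (a : (Fin n → ℤ) → ℂ) : Prop :=
  ∃ ρ : ℝ, 0 < ρ ∧ ∃ C : ℝ, ∀ m, ‖a m‖ ≤ C * Real.exp (-ρ * l1Size m)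

/-- `f` is a real analytic function on the torus. -/
def AnalyticPeriodic (f : (Fin n → ℝ) → ℂ) : Prop := ContDiff ℝ ω f ∧ TorusPeriodic f

lemma HasExpDecay.summable {a : (Fin n → ℤ) → ℂ} (ha : HasExpDecay a) : Summable a := by
  obtain ⟨ρ, hρ, C, h⟩ := ha
  exact Summable.of_norm_bounded ((summable_exp_neg_mul_l1Size hρ).mul_left C) h

lemma exists_mem_ball_of_torusPeriodic (x : Fin n → ℝ) :
    ∃ y ∈ Metric.closedBall (0 : Fin n → ℝ) (2 * Real.pi), ∃ m : Fin n → ℤ,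
      y = x + fun j => 2 * Real.pi * (m j : ℝ) := by
  obtain ⟨m, hm⟩ := torusRep_toTorus x
  refine ⟨_, ?_, m, hm⟩
  rw [mem_closedBall_zero_iff, pi_norm_le_iff_of_nonneg (by positivity)]
  intro j
  have h := (AddCircle.equivIco 1 0 (toTorus x j)).2
  simp only [zero_add, Set.mem_Ico] at h
  unfold torusRep
  rw [norm_mul, Real.norm_of_nonneg (by positivity : (0 : ℝ) ≤ 2 * Real.pi),
    Real.norm_of_nonneg h.1]
  exact mul_le_of_le_one_right (by positivity) h.2.le

lemma norm_torusCoeff_le {f : (Fin n → ℝ) → ℂ} {C : ℝ} (hC : ∀ x, ‖f x‖ ≤ C) (m : Fin n → ℤ) :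
    ‖torusCoeff f m‖ ≤ C := by
  have := norm_integral_le_of_norm_le_const (μ := torusMeasure n)
    (f := fun t => f (torusRep t) * torusChar (-m) (torusRep t)) (C := C)
    (Eventually.of_forall fun t => by simpa [norm_torusChar] using hC _)
  simpa [torusCoeff, torusMean] using this

/-- The k-th derivative along a coordinate multiplies the coefficient by (i m_j)^k, while the Cauchy
estimate bounds the result by S k! / r^k. Summing over k against (r/2)^k / k! produces exp(r |m_j| /
2). -/
lemma AnalyticPeriodic.hasExpDecay {f : (Fin n → ℝ) → ℂ} (hf : AnalyticPeriodic f) :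
    HasExpDecay (torusCoeff f) := by
  obtain ⟨hc, hp⟩ := hf
  obtain ⟨r, hr, S, h⟩ := (isCompact_closedBall (0 : Fin n → ℝ)
    (2 * Real.pi)).exists_iteratedFDeriv_bound (f := f)
      fun x _ => (contDiff_omega_iff_analyticOnNhd.1 hc) x (Set.mem_univ _)
  have hper : ∀ k v, TorusPeriodic fun y => iteratedFDeriv ℝ k f y fun _ => v := by
    intro k v x m
    simp only
    rw [← iteratedFDeriv_comp_add_right]
    congr 2
    funext y
    exact hp y m
  have hall : ∀ y k (v : Fin n → ℝ), ‖v‖ ≤ 1 →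
      ‖iteratedFDeriv ℝ k f y fun _ => v‖ * r ^ k ≤ S * k.factorial := by
    intro y k v hv
    obtain ⟨z, hz, m, rfl⟩ := exists_mem_ball_of_torusPeriodic y
    have := h _ hz k v hv
    have e := hper k v y m
    simp only at e
    rwa [e] at this
  have hco : ∀ (k : ℕ) v m, torusCoeff (fun y => iteratedFDeriv ℝ k f y fun _ => v) m
      = (I * intPairing m v) ^ k * torusCoeff f m := by
    intro k v m
    induction k with
    | zero => simp
    | succ k ih =>
      have h1 := torusCoeff_fderiv (hper k v) ((contDiff_iteratedFDeriv_apply hc k v).of_le le_top) v m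
      simp only [fderiv_iteratedFDeriv_apply hc k v] at h1
      rw [h1, ih]
      ring
  have hS : 0 ≤ S := by
    have := hall 0 0 0 (by simp)
    simp only [pow_zero, mul_one, Nat.factorial_zero, Nat.cast_one] at this
    exact (norm_nonneg _).trans this
  have hb : ∀ m (j : Fin n), ‖torusCoeff f m‖ * Real.exp (r / 2 * |m j|) ≤ 2 * S := by
    intro m j
    have h2 : ∀ k : ℕ, ‖torusCoeff f m‖ * ((r / 2 * |m j|) ^ k / k.factorial) ≤ S * (1 / 2) ^ k := by
      intro k
      have h3 := norm_torusCoeff_le (f := fun y => iteratedFDeriv ℝ k f y fun _ => Pi.single j 1)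
        (C := S * k.factorial / r ^ k) (fun x => by
          rw [le_div_iff₀ (by positivity)]
          exact hall x k _ (by simp [Pi.norm_single])) m
      rw [hco] at h3
      have h4 : intPairing m (Pi.single j 1) = m j := by simp [intPairing, Pi.single_apply]
      rw [h4, norm_mul, norm_pow, norm_mul, norm_I, one_mul, Complex.norm_real, Real.norm_eq_abs,
        le_div_iff₀ (by positivity)] at h3
      rw [mul_div_assoc', div_le_iff₀ (by positivity)]
      calc ‖torusCoeff f m‖ * (r / 2 * ↑|m j|) ^ k
          = (|(m j : ℝ)| ^ k * ‖torusCoeff f m‖ * r ^ k) * (1 / 2) ^ k := by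
            push_cast
            rw [mul_pow, div_pow, div_pow]
            ring
        _ ≤ (S * k.factorial) * (1 / 2) ^ k := by gcongr
        _ = _ := by ring
    have h5 := (NormedSpace.expSeries_div_hasSum_exp (r / 2 * (|m j| : ℤ) : ℝ)).mul_left ‖torusCoeff f m‖
    rw [← Real.exp_eq_exp_ℝ] at h5
    have h6 := (hasSum_geometric_two).mul_left S
    rw [mul_comm 2 S]
    exact hasSum_le h2 h5 h6
  rcases isEmpty_or_nonempty (Fin n) with hn | hn
  · obtain ⟨C, _, hC⟩ := hp.exists_norm_le hc.continuous
    refine ⟨1, one_pos, C, fun m => ?_⟩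
    simpa [l1Size] using norm_torusCoeff_le hC m
  · have hn0 : 0 < n := Fin.pos_iff_nonempty.2 hn
    -- The largest |m_j| is at least |m| / n, so decay in that coordinate alone gives decay in |m|
    -- at the rate divided by n.
    refine ⟨r / 2 / n, by positivity, 2 * S, fun m => ?_⟩
    obtain ⟨j, -, hj⟩ := Finset.exists_max_image Finset.univ (fun j => |m j|) Finset.univ_nonempty
    have h1 : l1Size m ≤ n * |m j| := by
      have := Finset.sum_le_card_nsmul Finset.univ (fun j => |m j|) _ hj
      simpa [l1Size] using this
    have h1' : (l1Size m : ℝ) ≤ n * (|m j| : ℤ) := by exact_mod_cast h1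
    have h2 := hb m j
    rw [← le_div_iff₀ (Real.exp_pos _)] at h2
    refine h2.trans ?_
    rw [div_eq_mul_inv, ← Real.exp_neg]
    gcongr
    rw [neg_mul, neg_le_neg_iff]
    calc r / 2 / n * l1Size m ≤ r / 2 / n * (n * (|m j| : ℤ)) := by gcongr
      _ = r / 2 * (|m j| : ℤ) := by field_simp


/-- Each exponential is expanded in its Taylor series and the two sums are exchanged; the weights
exp(r ‖L i‖) dominate the double series on the ball of radius r. -/
lemma analyticAt_tsum_exp {ι E : Type*} [NormedAddCommGroup E] [NormedSpace ℝ E]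
    (c : ι → ℂ) (L : ι → E →L[ℝ] ℂ) {r : ℝ} (hr : 0 < r)
    (hs : Summable fun i => ‖c i‖ * Real.exp (r * ‖L i‖)) :
    AnalyticAt ℝ (fun x => ∑' i, c i * Complex.exp (L i x)) 0 := by
  set p : FormalMultilinearSeries ℝ E ℂ := fun k => ∑' i, c i •
    ((k.factorial : ℝ)⁻¹ • (ContinuousMultilinearMap.mkPiAlgebraFin ℝ k ℂ).compContinuousLinearMap
      fun _ => L i) with hp
  have hnorm : ∀ k i, ‖c i • ((k.factorial : ℝ)⁻¹ • (ContinuousMultilinearMap.mkPiAlgebraFin ℝ k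
      ℂ).compContinuousLinearMap fun _ => L i)‖ ≤ ‖c i‖ * (‖L i‖ ^ k / k.factorial) := by
    intro k i
    rw [norm_smul, norm_smul, norm_inv, RCLike.norm_natCast, div_eq_inv_mul]
    gcongr
    refine (ContinuousMultilinearMap.norm_compContinuousLinearMap_le _ _).trans ?_
    simp
  have hterm : ∀ k i, ‖c i‖ * (‖L i‖ ^ k / k.factorial) * r ^ k ≤ ‖c i‖ * Real.exp (r * ‖L i‖) := by
    intro k i
    have := Real.pow_div_factorial_le_exp (x := r * ‖L i‖) (by positivity) k
    calc ‖c i‖ * (‖L i‖ ^ k / k.factorial) * r ^ k = ‖c i‖ * ((r * ‖L i‖) ^ k / k.factorial) := by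
          rw [mul_pow]
          ring
      _ ≤ _ := by gcongr
  have hsum : ∀ k, Summable fun i => ‖c i‖ * (‖L i‖ ^ k / k.factorial) := by
    intro k
    have h1 : Summable fun i => ‖c i‖ * (‖L i‖ ^ k / k.factorial) * r ^ k :=
      Summable.of_nonneg_of_le (fun i => by positivity) (hterm k) hs
    exact (summable_mul_right_iff (by positivity)).1 h1
  have hpk : ∀ k, HasSum (fun i => c i • ((k.factorial : ℝ)⁻¹ •
      (ContinuousMultilinearMap.mkPiAlgebraFin ℝ k ℂ).compContinuousLinearMap fun _ => L i)) (p k) :=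
    fun k => (Summable.of_norm_bounded (hsum k) (hnorm k)).hasSum
  refine ⟨p, ENNReal.ofReal r, ?_, by simpa using hr, ?_⟩
  · refine p.le_radius_of_bound (r := r.toNNReal) (∑' i, ‖c i‖ * Real.exp (r * ‖L i‖)) fun k => ?_
    rw [Real.coe_toNNReal _ hr.le]
    calc ‖p k‖ * r ^ k ≤ (∑' i, ‖c i‖ * (‖L i‖ ^ k / k.factorial)) * r ^ k := by
          gcongr
          exact tsum_of_norm_bounded (hsum k).hasSum (hnorm k)
      _ = ∑' i, ‖c i‖ * (‖L i‖ ^ k / k.factorial) * r ^ k := by rw [tsum_mul_right]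
      _ ≤ _ := Summable.tsum_le_tsum (hterm k) ((hsum k).mul_right _) hs
  · intro y hy
    have hyr : ‖y‖ < r := by
      rw [Metric.eball_ofReal, mem_ball_zero_iff] at hy
      exact hy
    rw [zero_add]
    have hL : ∀ i, ‖L i y‖ ≤ r * ‖L i‖ := fun i =>
      ((L i).le_opNorm y).trans (by rw [mul_comm]; gcongr)
    have hprod : Summable fun q : ι × ℕ => c q.1 * ((L q.1 y) ^ q.2 / q.2.factorial) := by
      refine Summable.of_norm ?_
      refine (summable_prod_of_nonneg (fun _ => norm_nonneg _)).2 ⟨fun i => ?_, ?_⟩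
      · exact ((NormedSpace.expSeries_div_hasSum_exp (L i y)).mul_left (c i)).summable.norm
      · refine Summable.of_nonneg_of_le (fun i => tsum_nonneg fun _ => norm_nonneg _)
          (fun i => ?_) hs
        have h1 := (NormedSpace.expSeries_div_hasSum_exp ‖L i y‖).mul_left ‖c i‖
        rw [← Real.exp_eq_exp_ℝ] at h1
        have h2 : ∀ k : ℕ, ‖c i * ((L i y) ^ k / k.factorial)‖ = ‖c i‖ * (‖L i y‖ ^ k / k.factorial) := by
          intro k
          simp
        simp only [h2]
        rw [h1.tsum_eq]
        gcongr
        exact hL i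
    have h1 : HasSum (fun q : ι × ℕ => c q.1 * ((L q.1 y) ^ q.2 / q.2.factorial))
        (∑' i, c i * Complex.exp (L i y)) := by
      have h2 := hprod.hasSum.prod_fiberwise fun i => by
        have := (NormedSpace.expSeries_div_hasSum_exp (L i y)).mul_left (c i)
        rw [← Complex.exp_eq_exp_ℂ] at this
        exact this
      rw [h2.tsum_eq]
      exact hprod.hasSum
    have h3 := (Equiv.prodComm ℕ ι).hasSum_iff.2 h1
    refine h3.prod_fiberwise fun k => ?_
    have h4 := ContinuousMultilinearMap.hasSum_eval (hpk k) fun _ => y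
    refine h4.congr_fun fun i => ?_
    simp [div_eq_inv_mul]

lemma analyticPeriodic_torusSeries {a : (Fin n → ℤ) → ℂ} (ha : HasExpDecay a) :
    AnalyticPeriodic (torusSeries a) := by
  refine ⟨contDiff_omega_iff_analyticOnNhd.2 fun x _ => ?_, torusPeriodic_torusSeries a⟩
  obtain ⟨ρ, hρ, C, h⟩ := ha
  set L : (Fin n → ℤ) → (Fin n → ℝ) →L[ℝ] ℂ := fun m =>
    I • Complex.ofRealCLM.comp (intPairingCLM m) with hL
  have hLn : ∀ m, ‖L m‖ ≤ l1Size m := by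
    intro m
    rw [hL]
    simp only [norm_smul, norm_I, one_mul]
    refine (ContinuousLinearMap.opNorm_comp_le _ _).trans ?_
    rw [Complex.ofRealCLM_norm, one_mul]
    exact norm_intPairingCLM_le m
  have hC : 0 ≤ C := by
    have := (norm_nonneg _).trans (h 0)
    exact nonneg_of_mul_nonneg_left this (Real.exp_pos _)
  have h1 := analyticAt_tsum_exp (fun m => a m * torusChar m x) L (r := ρ / 2) (by positivity) ?_
  · have h2 : torusSeries a = (fun y => ∑' m, a m * torusChar m x * Complex.exp (L m y))
        ∘ fun y => y - x := by
      funext y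
      unfold torusSeries
      simp only [Function.comp]
      congr 1
      funext m
      rw [mul_assoc]
      congr 1
      simp only [torusChar, hL, ← Complex.exp_add]
      congr 1
      simp only [_root_.smul_apply, ContinuousLinearMap.comp_apply, intPairingCLM_apply,
        smul_eq_mul, Complex.ofRealCLM_apply]
      have : intPairing m y = intPairing m x + intPairing m (y - x) := by
        rw [← intPairing_add_right, add_sub_cancel]
      rw [this]
      push_cast
      ring
    rw [h2]
    refine AnalyticAt.comp ?_ (by fun_prop)
    rw [sub_self]
    exact h1
  · refine Summable.of_nonneg_of_le (fun m => by positivity) (fun m => ?_)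
      ((summable_exp_neg_mul_l1Size (n := n) (show 0 < ρ / 2 by positivity)).mul_left C)
    rw [norm_mul, norm_torusChar, mul_one]
    calc ‖a m‖ * Real.exp (ρ / 2 * ‖L m‖)
        ≤ C * Real.exp (-ρ * l1Size m) * Real.exp (ρ / 2 * l1Size m) := by
          gcongr
          · exact h m
          · exact hLn m
      _ = C * Real.exp (-(ρ / 2) * l1Size m) := by
          rw [mul_assoc, ← Real.exp_add]
          ring_nf

namespace AnalyticPeriodic

variable {f g : (Fin n → ℝ) → ℂ}

lemma summable (hf : AnalyticPeriodic f) : Summable (torusCoeff f) := hf.hasExpDecay.summable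

lemma continuous (hf : AnalyticPeriodic f) : Continuous f := hf.1.continuous

lemma ext_torusCoeff (hf : AnalyticPeriodic f) (hg : AnalyticPeriodic g)
    (h : torusCoeff f = torusCoeff g) : f = g := by
  rw [← hf.2.torusSeries_torusCoeff hf.continuous hf.summable, h,
    hg.2.torusSeries_torusCoeff hg.continuous hg.summable]

lemma fderiv_apply (hf : AnalyticPeriodic f) (v : Fin n → ℝ) :
    AnalyticPeriodic fun x => fderiv ℝ f x v :=
  ⟨(hf.1.fderiv_right (m := ω) (by simp)).clm_apply contDiff_const, hf.2.fderiv_apply v⟩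

lemma torusCoeff_fderiv (hf : AnalyticPeriodic f) (v : Fin n → ℝ) (m : Fin n → ℤ) :
    torusCoeff (fun x => fderiv ℝ f x v) m = I * intPairing m v * torusCoeff f m :=
  _root_.torusCoeff_fderiv hf.2 (hf.1.of_le le_top) v m

lemma add (hf : AnalyticPeriodic f) (hg : AnalyticPeriodic g) :
    AnalyticPeriodic fun x => f x + g x :=
  ⟨hf.1.add hg.1, fun x m => by simp only [hf.2 x m, hg.2 x m]⟩

lemma sub (hf : AnalyticPeriodic f) (hg : AnalyticPeriodic g) :
    AnalyticPeriodic fun x => f x - g x :=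
  ⟨hf.1.sub hg.1, fun x m => by simp only [hf.2 x m, hg.2 x m]⟩

lemma mul (hf : AnalyticPeriodic f) (hg : AnalyticPeriodic g) :
    AnalyticPeriodic fun x => f x * g x :=
  ⟨hf.1.mul hg.1, hf.2.mul hg.2⟩

lemma const (c : ℂ) : AnalyticPeriodic fun _ : Fin n → ℝ => c :=
  ⟨contDiff_const, fun _ _ => rfl⟩

end AnalyticPeriodic

end ExpDecay

end

noncomputable section

open MeasureTheory Complex

/-! ### Logarithmic derivatives of formal power series -/

section LogarithmicDerivative

open PowerSeries

variable {A : Type*} [CommRing A] [Algebra ℂ A]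

/-- The coefficientwise action of a linear map on formal power series. -/
def PowerSeries.mapLinear (D : A →ₗ[ℂ] A) (g : A⟦X⟧) : A⟦X⟧ := PowerSeries.mk fun k => D (coeff k g)

/-- The Euler operator `X d/dX` on formal power series. -/
def PowerSeries.euler (g : A⟦X⟧) : A⟦X⟧ := PowerSeries.mk fun k => (k : ℂ) • coeff k g

lemma PowerSeries.mapLinear_mul (D : Derivation ℂ A A) (g h : A⟦X⟧) :
    mapLinear (D : A →ₗ[ℂ] A) (g * h)
      = mapLinear (D : A →ₗ[ℂ] A) g * h + g * mapLinear (D : A →ₗ[ℂ] A) h := by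
  ext k
  simp only [mapLinear, coeff_mk, coeff_mul, map_add, map_sum, Derivation.coeFn_coe,
    Derivation.leibniz, smul_eq_mul]
  rw [← Finset.sum_add_distrib]
  exact Finset.sum_congr rfl fun i _ => by ring

lemma PowerSeries.euler_mul (g h : A⟦X⟧) : euler (g * h) = euler g * h + g * euler h := by
  ext k
  simp only [euler, coeff_mk, coeff_mul, map_add]
  rw [← Finset.sum_add_distrib, Finset.smul_sum]
  refine Finset.sum_congr rfl fun i hi => ?_
  rw [← Finset.HasAntidiagonal.mem_antidiagonal.1 hi]
  push_cast
  rw [add_smul, smul_mul_assoc, mul_smul_comm]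

lemma PowerSeries.mapLinear_euler (D : A →ₗ[ℂ] A) (g : A⟦X⟧) :
    mapLinear D (euler g) = euler (mapLinear D g) := by
  ext k
  simp [mapLinear, euler]

/-- The iterates `(μ T)ʲ D μ`. -/
def beltramiIterate (μ d : A) (T : A → A) : ℕ → A
  | 0 => d
  | j + 1 => μ * T (beltramiIterate μ d T j)

/-- If `T ∘ D' = D' ∘ T = D` for two derivations `D`, `D'`, then the iterates `(μ T)ʲ D μ` are in the
image of `D'`: they are the coefficients of the logarithmic derivative along `D'` of the solution
of `D' f = s D (μ f)`. -/
theorem exists_beltramiIterate_eq (D D' : Derivation ℂ A A) (T : A → A)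
    (hT : ∀ a, T (D' a) = D a) (hT' : ∀ a, D' (T a) = D a) (μ : A) (j : ℕ) :
    ∃ ψ, beltramiIterate μ (D μ) T j = D' ψ := by
  -- Solving D' f = X D(μ f) degree by degree from f_0 = 1: the coefficient T (μ f_k) works because
  -- D' ∘ T = D.
  let f : A⟦X⟧ := PowerSeries.mk fun k => Nat.rec 1 (fun _ a => T (μ * a)) k
  have hf0 : coeff 0 f = 1 := by simp [f]
  have hfs : ∀ k, coeff (k + 1) f = T (μ * coeff k f) := by
    intro k
    simp [f]
  set E := mapLinear (D : A →ₗ[ℂ] A) with hE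
  set E' := mapLinear (D' : A →ₗ[ℂ] A) with hE'
  have hEf : E' f = X * (C (D μ) * f + C μ * E f) := by
    ext k
    cases k with
    | zero => simp [hE', mapLinear, hf0, coeff_zero_X_mul, -coeff_zero_eq_constantCoeff]
    | succ k =>
      rw [coeff_succ_X_mul, map_add, coeff_C_mul, coeff_C_mul]
      simp only [hE', hE, mapLinear, coeff_mk, hfs, Derivation.coeFn_coe, hT', Derivation.leibniz,
        smul_eq_mul]
      ring
  set fi : A⟦X⟧ := invOfUnit f 1 with hfi
  have hfi1 : f * fi = 1 := mul_invOfUnit f 1 (by rw [← coeff_zero_eq_constantCoeff_apply, hf0]; rfl)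
  -- This stands for the commutation of X d/dX with B on log f; writing B f / f and (X f') / f
  -- avoids the logarithm itself.
  have hlog : ∀ B : Derivation ℂ A A,
      euler (mapLinear (B : A →ₗ[ℂ] A) f * fi) = mapLinear (B : A →ₗ[ℂ] A) (euler f * fi) := by
    intro B
    have h1 := mapLinear_mul B f fi
    have h2 := euler_mul f fi
    have e1 : mapLinear (B : A →ₗ[ℂ] A) (1 : A⟦X⟧) = 0 := by
      ext k
      simp only [mapLinear, coeff_mk, coeff_one]
      split_ifs <;> simp
    have e2 : euler (1 : A⟦X⟧) = 0 := by
      ext k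
      simp only [euler, coeff_mk, coeff_one]
      split_ifs with h <;> simp [h]
    rw [hfi1, e1] at h1
    rw [hfi1, e2] at h2
    rw [euler_mul, mapLinear_mul, mapLinear_euler]
    linear_combination (mapLinear (B : A →ₗ[ℂ] A) f * euler fi - euler f * mapLinear (B : A →ₗ[ℂ] A) fi) * (-hfi1)
      + (euler f * fi) * h1 * 1 - mapLinear (B : A →ₗ[ℂ] A) f * fi * h2
  have hP : E' f * fi = X * (C (D μ) + C μ * (E f * fi)) := by
    rw [hEf]
    linear_combination X * C (D μ) * hfi1
  -- The coefficients of log f. The junk value at k = 0 plays no role, since only positive degrees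
  -- occur below.
  set Ψ : ℕ → A := fun k => ((k : ℂ)⁻¹) • coeff k (euler f * fi) with hΨ
  have hcoef : ∀ (B : Derivation ℂ A A) (k : ℕ),
      coeff (k + 1) (mapLinear (B : A →ₗ[ℂ] A) f * fi) = B (Ψ (k + 1)) := by
    intro B k
    have h := congrArg (coeff (k + 1)) (hlog B)
    rw [euler, coeff_mk] at h
    rw [hΨ]
    simp only
    rw [Derivation.map_smul, ← Derivation.coeFn_coe]
    have h3 : coeff (k + 1) (mapLinear (B : A →ₗ[ℂ] A) (euler f * fi))
        = (B : A →ₗ[ℂ] A) (coeff (k + 1) (euler f * fi)) := by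
      rw [mapLinear, coeff_mk]
    rw [← h3, ← h, smul_smul, inv_mul_cancel₀ (by exact_mod_cast Nat.succ_ne_zero k), one_smul]
  have hR0 : coeff 0 (E f * fi) = 0 := by
    have h1 : coeff 0 (E f) = 0 := by
      rw [hE, mapLinear, coeff_mk, hf0]
      simp
    rw [coeff_zero_eq_constantCoeff_apply] at h1 ⊢
    rw [map_mul, h1, zero_mul]
  -- Dividing the equation for f by f gives D' Ψ_1 = D μ and D' Ψ_(k+2) = μ D Ψ_(k+1) = μ T (D'
  -- Ψ_(k+1)), the recursion of the iterates.
  have key : ∀ k, beltramiIterate μ (D μ) T k = D' (Ψ (k + 1)) := by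
    intro k
    induction k with
    | zero =>
      rw [← hcoef D' 0]
      change _ = coeff (0 + 1) (E' f * fi)
      rw [hP, coeff_succ_X_mul, map_add, coeff_C_mul, hR0, coeff_zero_C]
      simp [beltramiIterate]
    | succ k ih =>
      rw [beltramiIterate, ih, hT, ← hcoef D k, ← hcoef D' (k + 1)]
      change _ = coeff (k + 1 + 1) (E' f * fi)
      rw [hP, coeff_succ_X_mul, map_add, coeff_C_mul, coeff_C]
      simp [hE]
  exact ⟨_, key j⟩

end LogarithmicDerivative


/-! ### Leafwise ∂, ∂̄ and the Beurling transform -/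

section Beltrami

variable {n : ℕ}

/-- The algebra of complex valued real analytic functions on the torus. -/
def torusAlgebra (n : ℕ) : Subalgebra ℂ ((Fin n → ℝ) → ℂ) where
  carrier := {f | AnalyticPeriodic f}
  mul_mem' hf hg := hf.mul hg
  add_mem' hf hg := hf.add hg
  algebraMap_mem' c := AnalyticPeriodic.const c

/-- The derivative of analytic functions on the torus along a constant vector field. -/
def torusDerivation (v : Fin n → ℝ) : Derivation ℂ (torusAlgebra n) (torusAlgebra n) :=
  Derivation.mk'
    { toFun := fun f => ⟨fun x => fderiv ℝ f.1 x v, f.2.fderiv_apply v⟩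
      map_add' := fun f g => by
        ext x
        have hf := (f.2.1.differentiable (by simp)) x
        have hg := (g.2.1.differentiable (by simp)) x
        change fderiv ℝ (f.1 + g.1) x v = fderiv ℝ f.1 x v + fderiv ℝ g.1 x v
        rw [fderiv_add hf hg]
        rfl
      map_smul' := fun c f => by
        ext x
        have hf := (f.2.1.differentiable (by simp)) x
        change fderiv ℝ (c • f.1) x v = c • fderiv ℝ f.1 x v
        rw [fderiv_const_smul hf]
        rfl }
    fun f g => by
      ext x
      have hf := (f.2.1.differentiable (by simp)) x
      have hg := (g.2.1.differentiable (by simp)) x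
      change fderiv ℝ (f.1 * g.1) x v = f.1 x * fderiv ℝ g.1 x v + g.1 x * fderiv ℝ f.1 x v
      rw [fderiv_mul hf hg]
      simp

variable (u v : Fin n → ℝ)

/-- The operator `∂/∂z = (∂_u - i ∂_v) / 2`. -/
def leafDz (f : (Fin n → ℝ) → ℂ) (x : Fin n → ℝ) : ℂ := (fderiv ℝ f x u - I * fderiv ℝ f x v) / 2

/-- The operator `∂/∂z̄ = (∂_u + i ∂_v) / 2`. -/
def leafDzbar (f : (Fin n → ℝ) → ℂ) (x : Fin n → ℝ) : ℂ := (fderiv ℝ f x u + I * fderiv ℝ f x v) / 2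

/-- The symbol of `∂/∂z`. -/
def symbolDz (m : Fin n → ℤ) : ℂ := I * (intPairing m u - I * intPairing m v) / 2

/-- The symbol of `∂/∂z̄`. -/
def symbolDzbar (m : Fin n → ℤ) : ℂ := I * (intPairing m u + I * intPairing m v) / 2

/-- The leafwise Beurling transform, the Fourier multiplier that takes `∂f/∂z̄` to `∂f/∂z`. -/
def leafBeurling (f : (Fin n → ℝ) → ℂ) : (Fin n → ℝ) → ℂ :=
  torusSeries fun m => symbolDz u v m / symbolDzbar u v m * torusCoeff f m

variable {u v}

lemma norm_symbolDz (m : Fin n → ℤ) : ‖symbolDz u v m‖ = ‖symbolDzbar u v m‖ := by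
  have h : (intPairing m u - I * intPairing m v : ℂ)
      = (starRingEnd ℂ) (intPairing m u + I * intPairing m v) := by
    simp [sub_eq_add_neg]
  rw [symbolDz, symbolDzbar, norm_div, norm_div, norm_mul, norm_mul, h, RCLike.norm_conj]

/-- The symbols have equal modulus because (m, u) and (m, v) are real. Where both vanish, the
quotient is 0 by the convention on division by zero, so no case is excluded. -/
lemma norm_symbol_div_le (m : Fin n → ℤ) : ‖symbolDz u v m / symbolDzbar u v m‖ ≤ 1 := by
  rw [norm_div, norm_symbolDz]
  exact div_self_le_one _

/-- The two symbols vanish together, so the identity survives at resonances. Hence the Beurling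
transform intertwines ∂̄ and ∂ for every foliation, Diophantine or not. -/
lemma symbolDz_div_mul (m : Fin n → ℤ) :
    symbolDz u v m / symbolDzbar u v m * symbolDzbar u v m = symbolDz u v m := by
  by_cases h : symbolDzbar u v m = 0
  · have : symbolDz u v m = 0 := by
      rw [← norm_eq_zero, norm_symbolDz, h, norm_zero]
    rw [this, h]
    simp
  · exact div_mul_cancel₀ _ h

lemma symbolDzbar_zero : symbolDzbar u v 0 = 0 := by simp [symbolDzbar, intPairing_zero_left]

namespace AnalyticPeriodic

variable {f g : (Fin n → ℝ) → ℂ}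

lemma leafDz (hf : AnalyticPeriodic f) : AnalyticPeriodic (leafDz u v f) := by
  have := ((hf.fderiv_apply u).sub ((const I).mul (hf.fderiv_apply v))).mul (const 2⁻¹)
  simp only [← div_eq_mul_inv] at this
  exact this

lemma leafDzbar (hf : AnalyticPeriodic f) : AnalyticPeriodic (leafDzbar u v f) := by
  have := ((hf.fderiv_apply u).add ((const I).mul (hf.fderiv_apply v))).mul (const 2⁻¹)
  simp only [← div_eq_mul_inv] at this
  exact this

lemma torusCoeff_add (hf : AnalyticPeriodic f) (hg : AnalyticPeriodic g) (m : Fin n → ℤ) :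
    torusCoeff (fun x => f x + g x) m = torusCoeff f m + torusCoeff g m := by
  have hm : AnalyticPeriodic (torusChar (-m)) := ⟨contDiff_torusChar _, torusPeriodic_torusChar _⟩
  have h := torusMean_add (hf.mul hm).2 (hf.mul hm).continuous (hg.mul hm).2 (hg.mul hm).continuous
  simpa only [torusCoeff, add_mul] using h

lemma torusCoeff_const_mul (c : ℂ) (m : Fin n → ℤ) :
    torusCoeff (fun x => c * f x) m = c * torusCoeff f m := by
  simp only [torusCoeff, mul_assoc, torusMean]
  exact integral_const_mul _ _

lemma torusCoeff_leafDz (hf : AnalyticPeriodic f) (m : Fin n → ℤ) :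
    torusCoeff (_root_.leafDz u v f) m = symbolDz u v m * torusCoeff f m := by
  have h : _root_.leafDz u v f = fun x => 2⁻¹ * (fderiv ℝ f x u + -I * fderiv ℝ f x v) := by
    funext x
    rw [_root_.leafDz]
    ring
  rw [h, torusCoeff_const_mul, torusCoeff_add (hf.fderiv_apply u)
    ((const _).mul (hf.fderiv_apply v)), torusCoeff_const_mul, hf.torusCoeff_fderiv,
    hf.torusCoeff_fderiv, symbolDz]
  ring

lemma torusCoeff_leafDzbar (hf : AnalyticPeriodic f) (m : Fin n → ℤ) :
    torusCoeff (_root_.leafDzbar u v f) m = symbolDzbar u v m * torusCoeff f m := by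
  have h : _root_.leafDzbar u v f = fun x => 2⁻¹ * (fderiv ℝ f x u + I * fderiv ℝ f x v) := by
    funext x
    rw [_root_.leafDzbar]
    ring
  rw [h, torusCoeff_const_mul, torusCoeff_add (hf.fderiv_apply u)
    ((const _).mul (hf.fderiv_apply v)), torusCoeff_const_mul, hf.torusCoeff_fderiv,
    hf.torusCoeff_fderiv, symbolDzbar]
  ring

lemma hasExpDecay_beurling (hf : AnalyticPeriodic f) :
    HasExpDecay fun m => symbolDz u v m / symbolDzbar u v m * torusCoeff f m := by
  obtain ⟨ρ, hρ, C, h⟩ := hf.hasExpDecay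
  refine ⟨ρ, hρ, C, fun m => ?_⟩
  rw [norm_mul]
  exact (mul_le_of_le_one_left (norm_nonneg _) (norm_symbol_div_le m)).trans (h m)

lemma leafBeurling (hf : AnalyticPeriodic f) : AnalyticPeriodic (leafBeurling u v f) :=
  analyticPeriodic_torusSeries hf.hasExpDecay_beurling

lemma torusCoeff_leafBeurling (hf : AnalyticPeriodic f) (m : Fin n → ℤ) :
    torusCoeff (_root_.leafBeurling u v f) m
      = symbolDz u v m / symbolDzbar u v m * torusCoeff f m := by
  rw [_root_.leafBeurling, torusCoeff_torusSeries hf.hasExpDecay_beurling.summable]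

lemma leafBeurling_leafDzbar (hf : AnalyticPeriodic f) :
    _root_.leafBeurling u v (_root_.leafDzbar u v f) = _root_.leafDz u v f := by
  refine hf.leafDzbar.leafBeurling.ext_torusCoeff hf.leafDz (funext fun m => ?_)
  rw [hf.leafDzbar.torusCoeff_leafBeurling, hf.torusCoeff_leafDzbar, hf.torusCoeff_leafDz,
    ← mul_assoc, symbolDz_div_mul]

lemma leafDzbar_leafBeurling (hf : AnalyticPeriodic f) :
    _root_.leafDzbar u v (_root_.leafBeurling u v f) = _root_.leafDz u v f := by
  refine hf.leafBeurling.leafDzbar.ext_torusCoeff hf.leafDz (funext fun m => ?_)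
  rw [hf.leafBeurling.torusCoeff_leafDzbar, hf.torusCoeff_leafBeurling, hf.torusCoeff_leafDz,
    ← mul_assoc, mul_comm (symbolDzbar u v m), symbolDz_div_mul]

lemma beltramiIterate (hf : AnalyticPeriodic f) (hg : AnalyticPeriodic g) (j : ℕ) :
    AnalyticPeriodic (beltramiIterate f g (_root_.leafBeurling u v) j) := by
  induction j with
  | zero => exact hg
  | succ j ih => exact hf.mul ih.leafBeurling

/-- The terms of the Neumann series for `∂φ/∂z̄ = μ ∂φ/∂z + ∂μ/∂z` have mean value zero. -/
lemma torusCoeff_beltramiIterate_zero (hf : AnalyticPeriodic f) (j : ℕ) :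
    torusCoeff (_root_.beltramiIterate f (_root_.leafDz u v f) (_root_.leafBeurling u v) j) 0 = 0 := by
  let D : Derivation ℂ (torusAlgebra n) (torusAlgebra n) :=
    (2⁻¹ : ℂ) • (torusDerivation u + (-I) • torusDerivation v)
  let D' : Derivation ℂ (torusAlgebra n) (torusAlgebra n) :=
    (2⁻¹ : ℂ) • (torusDerivation u + I • torusDerivation v)
  let T : torusAlgebra n → torusAlgebra n := fun g => ⟨_root_.leafBeurling u v g.1, g.2.leafBeurling⟩
  have hD : ∀ g : torusAlgebra n, (D g).1 = _root_.leafDz u v g.1 := by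
    intro g
    funext x
    change (2⁻¹ : ℂ) * (fderiv ℝ g.1 x u + (-I) * fderiv ℝ g.1 x v) = _
    rw [_root_.leafDz]
    ring
  have hD' : ∀ g : torusAlgebra n, (D' g).1 = _root_.leafDzbar u v g.1 := by
    intro g
    funext x
    change (2⁻¹ : ℂ) * (fderiv ℝ g.1 x u + I * fderiv ℝ g.1 x v) = _
    rw [_root_.leafDzbar]
    ring
  obtain ⟨ψ, hψ⟩ := exists_beltramiIterate_eq D D' T
    (fun a => Subtype.ext (by rw [hD, ← a.2.leafBeurling_leafDzbar, ← hD']))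
    (fun a => Subtype.ext (by rw [hD, hD', ← a.2.leafDzbar_leafBeurling])) ⟨f, hf⟩ j
  have h : ∀ j, (_root_.beltramiIterate (⟨f, hf⟩ : torusAlgebra n) (D ⟨f, hf⟩) T j).1
      = _root_.beltramiIterate f (_root_.leafDz u v f) (_root_.leafBeurling u v) j := by
    intro j
    induction j with
    | zero => exact hD _
    | succ j ih =>
      rw [_root_.beltramiIterate, _root_.beltramiIterate, ← ih]
      rfl
  -- Each iterate is ∂ψ/∂z̄ for a periodic ψ, and the symbol of ∂/∂z̄ vanishes at m = 0.
  rw [← h, hψ, hD', ψ.2.torusCoeff_leafDzbar, symbolDzbar_zero, zero_mul]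

end AnalyticPeriodic

end Beltrami

end

noncomputable section

open MeasureTheory Complex

/-! ### Weighted coefficients: functions on complex translates of the torus -/

section WeightedNorms

variable {n : ℕ}

/-- The weighted absolute summability of Fourier coefficients. -/
def WeightedSummable (ρ : ℝ) (a : (Fin n → ℤ) → ℂ) : Prop :=
  Summable fun m => ‖a m‖ * Real.exp (ρ * l1Size m)

lemma HasExpDecay.exists_weightedSummable {a b : (Fin n → ℤ) → ℂ} (ha : HasExpDecay a)
    (hb : HasExpDecay b) : ∃ ρ > 0, WeightedSummable ρ a ∧ WeightedSummable ρ b := by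
  have aux : ∀ {a : (Fin n → ℤ) → ℂ} {ρ r C : ℝ}, 0 < r → r ≤ ρ →
      (∀ m, ‖a m‖ ≤ C * Real.exp (-ρ * l1Size m)) → WeightedSummable (r / 2) a := by
    intro a ρ r C hr hrρ h
    have hC : 0 ≤ C := nonneg_of_mul_nonneg_left ((norm_nonneg _).trans (h 0)) (Real.exp_pos _)
    refine Summable.of_nonneg_of_le (fun m => by positivity) (fun m => ?_)
      ((summable_exp_neg_mul_l1Size (n := n) (half_pos hr)).mul_left C)
    have hl : (0 : ℝ) ≤ l1Size m := by exact_mod_cast l1Size_nonneg m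
    calc ‖a m‖ * Real.exp (r / 2 * l1Size m)
        ≤ C * Real.exp (-ρ * l1Size m) * Real.exp (r / 2 * l1Size m) := by
          gcongr
          exact h m
      _ ≤ C * Real.exp (-(r / 2) * l1Size m) := by
          rw [mul_assoc, ← Real.exp_add]
          gcongr
          nlinarith
  obtain ⟨ρ, hρ, C, h⟩ := ha
  obtain ⟨ρ', hρ', C', h'⟩ := hb
  exact ⟨min ρ ρ' / 2, by positivity, aux (lt_min hρ hρ') (min_le_left _ _) h,
    aux (lt_min hρ hρ') (min_le_right _ _) h'⟩

lemma WeightedSummable.mono {ρ ρ' : ℝ} (h : ρ' ≤ ρ) {a : (Fin n → ℤ) → ℂ}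
    (ha : WeightedSummable ρ a) : WeightedSummable ρ' a := by
  refine Summable.of_nonneg_of_le (fun m => by positivity) (fun m => ?_) ha
  have hl : (0 : ℝ) ≤ l1Size m := by exact_mod_cast l1Size_nonneg m
  gcongr

/-- The weight exp(ρ|m|) is submultiplicative, since |m| ≤ |k| + |m - k|; so the weighted ℓ¹ space
is closed under convolution. -/
lemma WeightedSummable.torusCoeff_mul {ρ : ℝ} (hρ : 0 ≤ ρ) {f g : (Fin n → ℝ) → ℂ}
    (hf : AnalyticPeriodic f) (hg : AnalyticPeriodic g)
    (hfs : WeightedSummable ρ (torusCoeff f)) (hgs : WeightedSummable ρ (torusCoeff g)) :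
    WeightedSummable ρ (torusCoeff fun x => f x * g x) := by
  have h1 := Summable.mul_of_nonneg hfs hgs (fun _ => by positivity) (fun _ => by positivity)
  let e : (Fin n → ℤ) × (Fin n → ℤ) ≃ (Fin n → ℤ) × (Fin n → ℤ) :=
    { toFun := fun q => (q.2, q.1 - q.2)
      invFun := fun q => (q.1 + q.2, q.1)
      left_inv := fun q => by simp
      right_inv := fun q => by simp }
  have h2 := (e.summable_iff.2 h1)
  have h3 := (summable_prod_of_nonneg (fun _ => by
    simp only [Function.comp]; positivity)).1 h2
  refine Summable.of_nonneg_of_le (fun m => by positivity) (fun m => ?_) h3.2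
  have h4 := _root_.torusCoeff_mul hf.2 hf.continuous hf.summable hg.2 hg.continuous m
  rw [← h4.tsum_eq]
  have h5 := h3.1 m
  calc ‖∑' k, torusCoeff f k * torusCoeff g (m - k)‖ * Real.exp (ρ * l1Size m)
      ≤ (∑' k, ‖torusCoeff f k * torusCoeff g (m - k)‖) * Real.exp (ρ * l1Size m) := by
        gcongr
        refine norm_tsum_le_tsum_norm ?_
        refine Summable.of_nonneg_of_le (fun k => norm_nonneg _) (fun k => ?_) h5
        simp only [Function.comp, e, Equiv.coe_fn_mk, norm_mul]
        have hl1 : (0 : ℝ) ≤ l1Size k := by exact_mod_cast l1Size_nonneg k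
        have hl2 : (0 : ℝ) ≤ l1Size (m - k) := by exact_mod_cast l1Size_nonneg (m - k)
        exact mul_le_mul (le_mul_of_one_le_right (norm_nonneg _) (Real.one_le_exp (by positivity)))
          (le_mul_of_one_le_right (norm_nonneg _) (Real.one_le_exp (by positivity)))
          (norm_nonneg _) (by positivity)
    _ = ∑' k, ‖torusCoeff f k * torusCoeff g (m - k)‖ * Real.exp (ρ * l1Size m) := by
        rw [tsum_mul_right]
    _ ≤ _ := by
        have hle : ∀ k, ‖torusCoeff f k * torusCoeff g (m - k)‖ * Real.exp (ρ * l1Size m)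
            ≤ ‖torusCoeff f k‖ * Real.exp (ρ * l1Size k)
              * (‖torusCoeff g (m - k)‖ * Real.exp (ρ * l1Size (m - k))) := by
          intro k
          have hl : (l1Size m : ℝ) ≤ l1Size k + l1Size (m - k) := by
            have := l1Size_add_le k (m - k)
            rw [add_sub_cancel] at this
            exact_mod_cast this
          calc _ ≤ ‖torusCoeff f k * torusCoeff g (m - k)‖
                * Real.exp (ρ * (l1Size k + l1Size (m - k))) := by gcongr
            _ = _ := by
                rw [norm_mul, mul_add, Real.exp_add]
                ring
        exact Summable.tsum_le_tsum hle
          (Summable.of_nonneg_of_le (fun k => by positivity) hle h5) h5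

/-- The weighted coefficients `a_m exp (m, ξ)`. -/
def twist (ξ : Fin n → ℝ) (a : (Fin n → ℤ) → ℂ) (m : Fin n → ℤ) : ℂ :=
  a m * (Real.exp (intPairing m ξ) : ℝ)

lemma norm_twist (ξ : Fin n → ℝ) (a : (Fin n → ℤ) → ℂ) (m : Fin n → ℤ) :
    ‖twist ξ a m‖ = ‖a m‖ * Real.exp (intPairing m ξ) := by
  rw [twist, norm_mul, Complex.norm_real, Real.norm_of_nonneg (Real.exp_pos _).le]

lemma intPairing_le_of_norm_le {ρ : ℝ} {ξ : Fin n → ℝ} (hξ : ‖ξ‖ ≤ ρ) (m : Fin n → ℤ) :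
    |intPairing m ξ| ≤ ρ * l1Size m := by
  have hl : (0 : ℝ) ≤ l1Size m := by exact_mod_cast l1Size_nonneg m
  refine (abs_intPairing_le m ξ).trans ?_
  rw [mul_comm]
  gcongr

lemma norm_twist_le {ρ : ℝ} {ξ : Fin n → ℝ} (hξ : ‖ξ‖ ≤ ρ) (a : (Fin n → ℤ) → ℂ)
    (m : Fin n → ℤ) : ‖twist ξ a m‖ ≤ ‖a m‖ * Real.exp (ρ * l1Size m) := by
  rw [norm_twist]
  gcongr
  exact (le_abs_self _).trans (intPairing_le_of_norm_le hξ m)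

lemma WeightedSummable.summable_twist {ρ : ℝ} {ξ : Fin n → ℝ} (hξ : ‖ξ‖ ≤ ρ)
    {a : (Fin n → ℤ) → ℂ} (ha : WeightedSummable ρ a) : Summable (twist ξ a) :=
  Summable.of_norm_bounded ha (norm_twist_le hξ a)

/-- Twisting by ξ is the passage from f(x) to its analytic continuation f(x - iξ), so it respects
products. On coefficients this is the additivity of the pairing in m. -/
lemma torusCoeff_mul_twist {ρ : ℝ} {ξ : Fin n → ℝ} (hξ : ‖ξ‖ ≤ ρ) {f g : (Fin n → ℝ) → ℂ}
    (hf : AnalyticPeriodic f) (hg : AnalyticPeriodic g)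
    (hfs : WeightedSummable ρ (torusCoeff f)) (hgs : WeightedSummable ρ (torusCoeff g)) :
    torusCoeff (fun x => torusSeries (twist ξ (torusCoeff f)) x
      * torusSeries (twist ξ (torusCoeff g)) x) = twist ξ (torusCoeff fun x => f x * g x) := by
  funext m
  have h1 := torusCoeff_mul hf.2 hf.continuous hf.summable hg.2 hg.continuous m
  have sf := hfs.summable_twist hξ
  have sg := hgs.summable_twist hξ
  have h2 := torusCoeff_mul (torusPeriodic_torusSeries _) (continuous_torusSeries sf)
    (by rwa [torusCoeff_torusSeries sf]) (torusPeriodic_torusSeries _) (continuous_torusSeries sg) m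
  rw [torusCoeff_torusSeries sf, torusCoeff_torusSeries sg] at h2
  refine h2.unique ((h1.mul_right ((Real.exp (intPairing m ξ) : ℝ) : ℂ)).congr_fun fun k => ?_)
  have : intPairing m ξ = intPairing k ξ + intPairing (m - k) ξ := by
    rw [← intPairing_add_left, add_sub_cancel]
  rw [twist, twist, this, Real.exp_add]
  push_cast
  ring

/-- The continuation to x - iξ is close to f uniformly in x when ξ is small, so a sup bound below 1
survives with a slightly larger constant, here (1 + k) / 2. -/
lemma exists_norm_torusSeries_twist_le {f : (Fin n → ℝ) → ℂ} (hf : AnalyticPeriodic f) {k ρ : ℝ}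
    (hk : k < 1) (hfk : ∀ x, ‖f x‖ ≤ k) (hρ : 0 < ρ) (hs : WeightedSummable ρ (torusCoeff f)) :
    ∃ r, 0 < r ∧ r ≤ ρ ∧ ∃ k' < 1, 0 ≤ k' ∧ ∀ ξ : Fin n → ℝ, ‖ξ‖ ≤ r → ∀ x,
      ‖torusSeries (twist ξ (torusCoeff f)) x‖ ≤ k' := by
  set S := ∑' m, ‖torusCoeff f m‖ * Real.exp (ρ * l1Size m)
  have hS : 0 ≤ S := tsum_nonneg fun m => by positivity
  -- The continuation differs from f by at most t S, which this choice keeps below half the gap 1 -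
  -- k; the summand 1 avoids dividing by zero.
  set t := min 1 ((1 - k) / 2 / (S + 1)) with ht
  have ht0 : 0 < t := lt_min one_pos (div_pos (half_pos (sub_pos.2 hk)) (by positivity))
  have ht1 : t ≤ 1 := min_le_left _ _
  have htS : t * S ≤ (1 - k) / 2 := by
    calc t * S ≤ (1 - k) / 2 / (S + 1) * (S + 1) := by
          gcongr
          · exact min_le_right _ _
          · linarith
      _ = _ := by field_simp
  have hk0 : 0 ≤ k := (norm_nonneg _).trans (hfk 0)
  refine ⟨t * ρ, by positivity, mul_le_of_le_one_left hρ.le ht1, (1 + k) / 2, by linarith,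
    by linarith, fun ξ hξ x => ?_⟩
  have hξ' : ‖ξ‖ ≤ ρ := hξ.trans (mul_le_of_le_one_left hρ.le ht1)
  have h1 := (summable_torusSeries (hs.summable_twist hξ') x).hasSum
  have h2 := hf.2.hasSum_torusCoeff hf.continuous hf.summable x
  have h3 := h1.sub h2
  -- Convexity of exp on [0, z] gives exp(t z) - 1 ≤ t (exp z - 1).
  have hexp : ∀ y z : ℝ, |y| ≤ t * z → |Real.exp y - 1| ≤ t * Real.exp z := by
    intro y z hyz
    have hz : 0 ≤ z := nonneg_of_mul_nonneg_right ((abs_nonneg y).trans hyz) ht0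
    have h4 : |Real.exp y - 1| ≤ Real.exp |y| - 1 := by
      rcases le_total 0 y with hy | hy
      · rw [abs_of_nonneg hy, abs_of_nonneg (by linarith [Real.one_le_exp hy])]
      · rw [abs_of_nonpos hy, abs_of_nonpos (by linarith [Real.exp_le_one_iff.2 hy])]
        have h5 := Real.add_one_le_exp y
        have h6 := Real.add_one_le_exp (-y)
        nlinarith [Real.exp_pos y, Real.exp_pos (-y), sq_nonneg (Real.exp y - 1),
          (by rw [← Real.exp_add]; simp : Real.exp y * Real.exp (-y) = 1)]
    have h5 := convexOn_exp.2 (Set.mem_univ (0 : ℝ)) (Set.mem_univ z) (sub_nonneg.2 ht1) ht0.le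
      (by ring)
    simp only [smul_eq_mul, mul_zero, zero_add, Real.exp_zero, mul_one] at h5
    have h6 := Real.exp_le_exp.2 hyz
    linarith
  have h4 : ‖torusSeries (twist ξ (torusCoeff f)) x - f x‖ ≤ t * S := by
    have hb : ∀ m, ‖twist ξ (torusCoeff f) m * torusChar m x - torusCoeff f m * torusChar m x‖
        ≤ t * (‖torusCoeff f m‖ * Real.exp (ρ * l1Size m)) := by
      intro m
      rw [← sub_mul, norm_mul, norm_torusChar, mul_one, twist]
      have e : torusCoeff f m * ((Real.exp (intPairing m ξ) : ℝ) : ℂ) - torusCoeff f m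
          = torusCoeff f m * ((Real.exp (intPairing m ξ) - 1 : ℝ) : ℂ) := by
        push_cast
        ring
      rw [e, norm_mul, Complex.norm_real, Real.norm_eq_abs, mul_left_comm]
      gcongr
      refine hexp _ _ ?_
      rw [← mul_assoc]
      exact intPairing_le_of_norm_le hξ m
    have h5 := tsum_of_norm_bounded (hs.hasSum.mul_left t) hb
    rwa [h3.tsum_eq] at h5
  calc ‖torusSeries (twist ξ (torusCoeff f)) x‖
      ≤ ‖torusSeries (twist ξ (torusCoeff f)) x - f x‖ + ‖f x‖ := by
        simpa using norm_add_le (torusSeries (twist ξ (torusCoeff f)) x - f x) (f x)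
    _ ≤ (1 - k) / 2 + k := add_le_add (h4.trans htS) (hfk x)
    _ = _ := by ring

lemma summable_sq_norm_of_summable {ι : Type*} {a : ι → ℂ} (ha : Summable a) :
    Summable fun i => ‖a i‖ ^ 2 := by
  refine Summable.of_norm_bounded_eventually ha.norm ?_
  filter_upwards [ha.norm.tendsto_cofinite_zero.eventually (gt_mem_nhds one_pos)] with i hi
  rw [Real.norm_of_nonneg (by positivity), sq]
  exact mul_le_of_le_one_left (norm_nonneg _) hi.le

/-- By Parseval on the translated torus, multiplication by f costs only its sup norm there. A
weighted ℓ¹ estimate would cost the sum of the coefficients, which need not be below 1. -/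
lemma tsum_sq_twist_mul_le {ρ k : ℝ} {ξ : Fin n → ℝ} (hξ : ‖ξ‖ ≤ ρ) {f g : (Fin n → ℝ) → ℂ}
    (hf : AnalyticPeriodic f) (hg : AnalyticPeriodic g)
    (hfs : WeightedSummable ρ (torusCoeff f)) (hgs : WeightedSummable ρ (torusCoeff g))
    (hk : ∀ x, ‖torusSeries (twist ξ (torusCoeff f)) x‖ ≤ k) :
    ∑' m, ‖twist ξ (torusCoeff fun x => f x * g x) m‖ ^ 2
      ≤ k ^ 2 * ∑' m, ‖twist ξ (torusCoeff g) m‖ ^ 2 := by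
  have sf := hfs.summable_twist hξ
  have sg := hgs.summable_twist hξ
  have pf := torusPeriodic_torusSeries (twist ξ (torusCoeff f))
  have pg := torusPeriodic_torusSeries (twist ξ (torusCoeff g))
  have cf := continuous_torusSeries sf
  have cg := continuous_torusSeries sg
  have h1 := (pf.mul pg).hasSum_sq_torusCoeff (cf.mul cg)
  rw [torusCoeff_mul_twist hξ hf hg hfs hgs] at h1
  have h2 := pg.hasSum_sq_torusCoeff cg
  rw [torusCoeff_torusSeries sg] at h2
  rw [h1.tsum_eq, h2.tsum_eq, torusMean, torusMean, ← integral_const_mul]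
  have pn : TorusPeriodic fun x => ‖torusSeries (twist ξ (torusCoeff g)) x‖ ^ 2 :=
    fun x m => by simp only [pg x m]
  have pn' : TorusPeriodic fun x => ‖torusSeries (twist ξ (torusCoeff f)) x
      * torusSeries (twist ξ (torusCoeff g)) x‖ ^ 2 :=
    fun x m => by simp only [pg x m, pf x m]
  refine integral_mono (pn'.integrable ((cf.mul cg).norm.pow 2))
    ((pn.integrable (cg.norm.pow 2)).const_mul _) fun t => ?_
  simp only [norm_mul, mul_pow]
  gcongr
  exact hk _

end WeightedNorms

/-! ### Convergence of the Neumann series for the Beltrami equation -/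

section BeltramiSolution

variable {n : ℕ} {u v : Fin n → ℝ}

lemma weightedSummable_beurling {ρ : ℝ} {f : (Fin n → ℝ) → ℂ} (hf : AnalyticPeriodic f)
    (hs : WeightedSummable ρ (torusCoeff f)) :
    WeightedSummable ρ (torusCoeff (leafBeurling u v f)) := by
  refine Summable.of_nonneg_of_le (fun m => by positivity) (fun m => ?_) hs
  rw [hf.torusCoeff_leafBeurling, norm_mul]
  gcongr
  exact mul_le_of_le_one_left (norm_nonneg _) (norm_symbol_div_le m)

lemma norm_twist_leafBeurling_le {f : (Fin n → ℝ) → ℂ} (hf : AnalyticPeriodic f) (ξ : Fin n → ℝ)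
    (m : Fin n → ℤ) : ‖twist ξ (torusCoeff (leafBeurling u v f)) m‖ ≤ ‖twist ξ (torusCoeff f) m‖ := by
  rw [norm_twist, norm_twist, hf.torusCoeff_leafBeurling, norm_mul]
  gcongr
  exact mul_le_of_le_one_left (norm_nonneg _) (norm_symbol_div_le m)

/-- In L² of each translated torus the Beurling multiplier does not increase norms and
multiplication by f contracts by k'. The weighted ℓ¹ norms serve only to justify the series, not to
bound them. -/
lemma exists_beltramiIterate_bound {f g : (Fin n → ℝ) → ℂ} (hf : AnalyticPeriodic f)
    (hg : AnalyticPeriodic g) {k : ℝ} (hk : k < 1) (hfk : ∀ x, ‖f x‖ ≤ k) :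
    ∃ r > 0, ∃ k' < 1, 0 ≤ k' ∧ ∃ C, ∀ j m,
      ‖torusCoeff (beltramiIterate f g (leafBeurling u v) j) m‖
        ≤ C * k' ^ j * Real.exp (-r * l1Size m) := by
  obtain ⟨ρ, hρ, wf, wg⟩ := hf.hasExpDecay.exists_weightedSummable hg.hasExpDecay
  obtain ⟨r, hr, hrρ, k', hk', hk'0, hb⟩ := exists_norm_torusSeries_twist_le hf hk hfk hρ wf
  replace wf := wf.mono hrρ
  replace wg := wg.mono hrρ
  set p := beltramiIterate f g (leafBeurling u v) with hp
  have hpa : ∀ j, AnalyticPeriodic (p j) := hf.beltramiIterate hg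
  have hpw : ∀ j, WeightedSummable r (torusCoeff (p j)) := by
    intro j
    induction j with
    | zero => exact wg
    | succ j ih =>
      exact WeightedSummable.torusCoeff_mul hr.le hf (hpa j).leafBeurling wf
        (weightedSummable_beurling (hpa j) ih)
  have hsq : ∀ ξ : Fin n → ℝ, ‖ξ‖ ≤ r → ∀ j, ∑' m, ‖twist ξ (torusCoeff (p j)) m‖ ^ 2
      ≤ (k' ^ j) ^ 2 * ∑' m, (‖torusCoeff g m‖ * Real.exp (r * l1Size m)) ^ 2 := by
    intro ξ hξ j
    have hgs2 : Summable fun m => (‖torusCoeff g m‖ * Real.exp (r * l1Size m)) ^ 2 := by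
      have := summable_sq_norm_of_summable
        (a := fun m => ((‖torusCoeff g m‖ * Real.exp (r * l1Size m) : ℝ) : ℂ))
        (Complex.ofRealCLM.summable wg)
      simpa only [Complex.norm_real, Real.norm_eq_abs, sq_abs] using this
    induction j with
    | zero =>
      rw [pow_zero, one_pow, one_mul]
      refine Summable.tsum_le_tsum (fun m => ?_)
        (summable_sq_norm_of_summable (wg.summable_twist hξ)) hgs2
      exact pow_le_pow_left₀ (norm_nonneg _) (norm_twist_le hξ _ m) 2
    | succ j ih =>
      have wB := weightedSummable_beurling (u := u) (v := v) (hpa j) (hpw j)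
      calc ∑' m, ‖twist ξ (torusCoeff (p (j + 1))) m‖ ^ 2
          ≤ k' ^ 2 * ∑' m, ‖twist ξ (torusCoeff (leafBeurling u v (p j))) m‖ ^ 2 :=
            tsum_sq_twist_mul_le hξ hf (hpa j).leafBeurling wf wB (hb ξ hξ)
        _ ≤ k' ^ 2 * ∑' m, ‖twist ξ (torusCoeff (p j)) m‖ ^ 2 := by
            refine mul_le_mul_of_nonneg_left (Summable.tsum_le_tsum (fun m => ?_)
              (summable_sq_norm_of_summable (wB.summable_twist hξ))
              (summable_sq_norm_of_summable ((hpw j).summable_twist hξ))) (sq_nonneg _)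
            exact pow_le_pow_left₀ (norm_nonneg _) (norm_twist_leafBeurling_le (hpa j) ξ m) 2
        _ ≤ k' ^ 2 * ((k' ^ j) ^ 2 * ∑' m, (‖torusCoeff g m‖ * Real.exp (r * l1Size m)) ^ 2) := by
            gcongr
        _ = _ := by ring
  set N := ∑' m, (‖torusCoeff g m‖ * Real.exp (r * l1Size m)) ^ 2
  refine ⟨r, hr, k', hk', hk'0, √N, fun j m => ?_⟩
  -- The translation is chosen for the given m so that (m, ξ) = r|m|; the ℓ² bound is uniform over
  -- ‖ξ‖ ≤ r, so this single term yields the full decay exp(-r|m|).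
  set ξ : Fin n → ℝ := fun i => r * SignType.sign ((m i : ℝ)) with hξdef
  have hξ : ‖ξ‖ ≤ r := by
    rw [pi_norm_le_iff_of_nonneg hr.le]
    intro i
    rw [hξdef]
    simp only [norm_mul, Real.norm_of_nonneg hr.le]
    refine mul_le_of_le_one_right hr.le ?_
    rcases lt_trichotomy (m i : ℝ) 0 with h | h | h
    · simp [sign_neg h]
    · simp [h]
    · simp [sign_pos h]
  have hpair : intPairing m ξ = r * l1Size m := by
    unfold intPairing l1Size
    push_cast
    rw [Finset.mul_sum]
    refine Finset.sum_congr rfl fun i _ => ?_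
    rw [hξdef, mul_left_comm]
    simp only [mul_comm (m i : ℝ), sign_mul_self]
  have h1 := (summable_sq_norm_of_summable ((hpw j).summable_twist hξ)).le_tsum m
    (fun _ _ => sq_nonneg _)
  have h2 := h1.trans (hsq ξ hξ j)
  have h3 : ‖twist ξ (torusCoeff (p j)) m‖ ≤ √N * k' ^ j := by
    have h4 := (le_abs_self _).trans (Real.abs_le_sqrt h2)
    rw [Real.sqrt_mul (by positivity), Real.sqrt_sq (by positivity)] at h4
    linarith
  rw [norm_twist, hpair, ← le_div_iff₀ (Real.exp_pos _)] at h3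
  rwa [neg_mul, Real.exp_neg, ← div_eq_mul_inv]

lemma hasSum_torusSeries_of_bound {a : ℕ → (Fin n → ℤ) → ℂ} {C k r : ℝ} (hr : 0 < r) (hk0 : 0 ≤ k)
    (hk : k < 1) (h : ∀ j m, ‖a j m‖ ≤ C * k ^ j * Real.exp (-r * l1Size m)) (x : Fin n → ℝ) :
    HasSum (fun j => torusSeries (a j) x) (torusSeries (fun m => ∑' j, a j m) x) := by
  have hs : Summable fun q : ℕ × (Fin n → ℤ) => a q.1 q.2 * torusChar q.2 x := by
    have h1 := Summable.mul_of_nonneg ((summable_geometric_of_lt_one hk0 hk).mul_left |C|)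
      (summable_exp_neg_mul_l1Size (n := n) hr) (fun _ => by positivity)
      (fun _ => (Real.exp_pos _).le)
    refine Summable.of_norm_bounded h1 fun q => ?_
    rw [norm_mul, norm_torusChar, mul_one]
    refine (h q.1 q.2).trans ?_
    gcongr
    exact le_abs_self C
  have h2 : ∀ j, HasSum (fun m => a j m * torusChar m x) (torusSeries (a j) x) := fun j =>
    (hs.prod_factor j).hasSum
  have h3 := hs.hasSum.prod_fiberwise h2
  have h4 : ∀ m, HasSum (fun j => a j m * torusChar m x) ((∑' j, a j m) * torusChar m x) := by
    intro m
    refine HasSum.mul_right _ (Summable.hasSum (Summable.of_norm_bounded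
      (((summable_geometric_of_lt_one hk0 hk).mul_left C).mul_right
        (Real.exp (-r * l1Size m))) fun j => h j m))
  have h5 := ((Equiv.prodComm (Fin n → ℤ) ℕ).hasSum_iff.2 hs.hasSum).prod_fiberwise h4
  rwa [torusSeries, h5.tsum_eq]

/-- If `|μ| ≤ k < 1`, the equation `p = μ S p + ∂μ/∂z`, where `S` is the Beurling transform, has an
analytic solution with mean value zero. -/
theorem exists_beltrami_log {μ : (Fin n → ℝ) → ℂ} (hμ : AnalyticPeriodic μ) {k : ℝ} (hk : k < 1)
    (hμk : ∀ x, ‖μ x‖ ≤ k) (u v : Fin n → ℝ) :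
    ∃ p, AnalyticPeriodic p ∧ torusCoeff p 0 = 0 ∧
      ∀ x, p x = μ x * leafBeurling u v p x + leafDz u v μ x := by
  have hd : AnalyticPeriodic (leafDz u v μ) := hμ.leafDz
  obtain ⟨r, hr, k', hk', hk'0, C, hC⟩ :=
    exists_beltramiIterate_bound (u := u) (v := v) hμ hd hk hμk
  set p := beltramiIterate μ (leafDz u v μ) (leafBeurling u v) with hp
  have hpa : ∀ j, AnalyticPeriodic (p j) := hμ.beltramiIterate hd
  set P : (Fin n → ℤ) → ℂ := fun m => ∑' j, torusCoeff (p j) m with hP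
  have hgeo : ∀ m : Fin n → ℤ, HasSum (fun j => C * k' ^ j * Real.exp (-r * l1Size m))
      (C * (1 - k')⁻¹ * Real.exp (-r * l1Size m)) := fun m =>
    ((hasSum_geometric_of_lt_one hk'0 hk').mul_left C).mul_right _
  have hPd : HasExpDecay P := ⟨r, hr, C * (1 - k')⁻¹, fun m =>
    tsum_of_norm_bounded (hgeo m) fun j => hC j m⟩
  have h0 : P 0 = 0 := by
    rw [hP]
    simp only [hp, hμ.torusCoeff_beltramiIterate_zero, tsum_zero]
  have hPa := analyticPeriodic_torusSeries hPd
  refine ⟨torusSeries P, hPa, by rw [torusCoeff_torusSeries hPd.summable, h0], fun x => ?_⟩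
  have h1 : HasSum (fun j => p j x) (torusSeries P x) := by
    have := hasSum_torusSeries_of_bound hr hk'0 hk' hC x
    refine this.congr_fun fun j => ?_
    rw [(hpa j).2.torusSeries_torusCoeff (hpa j).continuous (hpa j).summable]
  have h2 : HasSum (fun j => leafBeurling u v (p j) x) (leafBeurling u v (torusSeries P) x) := by
    have := hasSum_torusSeries_of_bound
      (a := fun j m => symbolDz u v m / symbolDzbar u v m * torusCoeff (p j) m) hr hk'0 hk'
      (fun j m => by
        rw [norm_mul]
        exact (mul_le_of_le_one_left (norm_nonneg _) (norm_symbol_div_le m)).trans (hC j m)) x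
    simp only [tsum_mul_left] at this
    rw [leafBeurling, torusCoeff_torusSeries hPd.summable]
    exact this
  -- Without its first term ∂μ/∂z, the Neumann series is μ S applied to the whole series.
  have h3 := (hasSum_nat_add_iff' 1).2 h1
  simp only [Finset.range_one, Finset.sum_singleton] at h3
  have h4 := h3.unique ((h2.mul_left (μ x)).congr_fun fun j => rfl)
  rw [← h4]
  simp [hp, beltramiIterate]

end BeltramiSolution

end

noncomputable section

open MeasureTheory Complex

/-! ### The weak Diophantine condition and small divisors -/

section Diophantine

variable {n : ℕ} {u v : Fin n → ℝ}

lemma finite_l1Size_le (N : ℤ) : {m : Fin n → ℤ | l1Size m ≤ N}.Finite := by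
  refine (Set.finite_Icc (fun _ => -N : Fin n → ℤ) (fun _ => N)).subset fun m hm => ?_
  have h : ∀ j, |m j| ≤ N := fun j =>
    (Finset.single_le_sum (f := fun j => |m j|) (fun _ _ => abs_nonneg _) (Finset.mem_univ j)).trans hm
  exact ⟨fun j => (abs_le.1 (h j)).1, fun j => (abs_le.1 (h j)).2⟩

lemma one_le_l1Size {m : Fin n → ℤ} (hm : m ≠ 0) : 1 ≤ l1Size m := by
  obtain ⟨j, hj⟩ := Function.ne_iff.1 hm
  have h1 : 1 ≤ |m j| := Int.one_le_abs hj
  exact h1.trans (Finset.single_le_sum (f := fun j => |m j|) (fun _ _ => abs_nonneg _)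
    (Finset.mem_univ j))

lemma l1Size_nsmul (k : ℕ) (m : Fin n → ℤ) : l1Size (k • m) = k * l1Size m := by
  simp [l1Size, abs_mul, Finset.mul_sum]

lemma intPairing_nsmul (k : ℕ) (m : Fin n → ℤ) (x : Fin n → ℝ) :
    intPairing (k • m) x = k * intPairing m x := by
  simp [intPairing, Finset.mul_sum, mul_assoc]

/-- The quantity whose lower limit appears in the weak Diophantine condition. -/
def diophantineRate (u v : Fin n → ℝ) (m : Fin n → ℤ) : ℝ :=
  (|intPairing m u| + |intPairing m v|) ^ (1 / (l1Size m : ℝ))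

lemma diophantineRate_nonneg (m : Fin n → ℤ) : 0 ≤ diophantineRate u v m :=
  Real.rpow_nonneg (by positivity) _

lemma isWeaklyDiophantine_iff :
    IsWeaklyDiophantine u v ↔ liminf (diophantineRate u v) (comap l1Size atTop) = 1 := Iff.rfl

lemma diophantineRate_rpow {m : Fin n → ℤ} (hm : m ≠ 0) :
    diophantineRate u v m ^ (l1Size m : ℝ) = |intPairing m u| + |intPairing m v| := by
  have h : (l1Size m : ℝ) ≠ 0 := by
    have := one_le_l1Size hm
    exact_mod_cast (by lia : l1Size m ≠ 0)
  rw [diophantineRate, ← Real.rpow_mul (by positivity), one_div_mul_cancel h, Real.rpow_one]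

lemma isBoundedUnder_diophantineRate :
    (comap (l1Size (n := n)) atTop).IsBoundedUnder (· ≥ ·) (diophantineRate u v) :=
  isBoundedUnder_of ⟨0, diophantineRate_nonneg⟩

/-- Along the multiples k e of a unit vector the divisors grow only linearly, and a^k ≤ k B fails
for large k if a > 1. So the lower limit never exceeds 1, and the condition is only a bound from
below. -/
lemma le_one_of_eventually_le_diophantineRate (hn : 0 < n) {a : ℝ}
    (h : ∀ᶠ m in comap l1Size atTop, a ≤ diophantineRate u v m) : a ≤ 1 := by
  by_contra! ha
  rw [eventually_comap, eventually_atTop] at h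
  obtain ⟨N, hN⟩ := h
  set e : Fin n → ℤ := Pi.single ⟨0, hn⟩ 1 with he
  have hl : l1Size e = 1 := by
    unfold l1Size
    rw [Finset.sum_eq_single ⟨0, hn⟩]
    · simp [he]
    · intro j _ hj
      simp [he, hj]
    · simp
  have hb : ∀ k : ℕ, N ≤ k → 0 < k → a ^ k ≤ k * (|intPairing e u| + |intPairing e v|) := by
    intro k hk hk0
    have h1 := hN k (by exact_mod_cast hk) (k • e) (by rw [l1Size_nsmul, hl, mul_one])
    have hne : k • e ≠ 0 := by
      intro h0
      have := congrArg l1Size h0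
      rw [l1Size_nsmul, hl] at this
      simp [l1Size] at this
      lia
    have h2 := Real.rpow_le_rpow (by linarith) h1 (show (0 : ℝ) ≤ (l1Size (k • e) : ℝ) by
      exact_mod_cast l1Size_nonneg _)
    rw [diophantineRate_rpow hne, l1Size_nsmul, hl, intPairing_nsmul, intPairing_nsmul, abs_mul,
      abs_mul] at h2
    simp only [mul_one, Int.cast_natCast, Real.rpow_natCast, Nat.abs_cast] at h2
    linarith
  set B := |intPairing e u| + |intPairing e v|
  have h3 := (tendsto_pow_const_div_const_pow_of_one_lt 1 ha).const_mul (B + 1)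
  rw [mul_zero] at h3
  obtain ⟨K, hK⟩ := eventually_atTop.1 (h3.eventually (gt_mem_nhds one_pos))
  set k := max K (max N.toNat 1)
  have h4 := hK k (le_max_left _ _)
  have hkN : N ≤ k := by
    have : N.toNat ≤ k := (le_max_left _ _).trans (le_max_right _ _)
    lia
  have hk1 : 0 < k := lt_of_lt_of_le one_pos ((le_max_right _ _).trans (le_max_right _ _))
  have h5 := hb k hkN hk1
  have hap : 0 < a ^ k := by positivity
  rw [pow_one, mul_div_assoc', div_lt_one hap] at h4
  have hk' : (0 : ℝ) < k := by exact_mod_cast hk1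
  nlinarith

lemma IsWeaklyDiophantine.eventually_lt (h : IsWeaklyDiophantine u v) {a : ℝ} (ha : a < 1) :
    ∀ᶠ m in comap l1Size atTop, a < diophantineRate u v m :=
  eventually_lt_of_lt_liminf (by rwa [isWeaklyDiophantine_iff.1 h]) isBoundedUnder_diophantineRate

/-- A resonance m would make the rate 0 at all its multiples, hence at arbitrarily large integer
vectors. -/
lemma IsWeaklyDiophantine.pos (h : IsWeaklyDiophantine u v) {m : Fin n → ℤ} (hm : m ≠ 0) :
    0 < |intPairing m u| + |intPairing m v| := by
  have h1 := h.eventually_lt one_half_lt_one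
  rw [eventually_comap, eventually_atTop] at h1
  obtain ⟨N, hN⟩ := h1
  set k := N.toNat + 1 with hk
  have hl := one_le_l1Size hm
  have h2 := hN (k * l1Size m) (by
    have : N ≤ k := by lia
    nlinarith) (k • m) (l1Size_nsmul k m)
  by_contra! h0
  have h3 : |intPairing m u| + |intPairing m v| = 0 := le_antisymm h0 (by positivity)
  have hkm : l1Size (k • m) ≠ 0 := by
    rw [l1Size_nsmul]
    have : (k : ℤ) ≠ 0 := by lia
    exact mul_ne_zero this (by lia)
  rw [diophantineRate, intPairing_nsmul, intPairing_nsmul, abs_mul, abs_mul, ← mul_add, h3,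
    mul_zero, Real.zero_rpow (by simpa using hkm)] at h2
  linarith

/-- The weak Diophantine condition bounds the small divisors from below. -/
theorem IsWeaklyDiophantine.exists_lower_bound (h : IsWeaklyDiophantine u v) {ε : ℝ} (hε : 0 < ε) :
    ∃ c > 0, ∀ m : Fin n → ℤ, m ≠ 0 →
      c * Real.exp (-ε * l1Size m) ≤ |intPairing m u| + |intPairing m v| := by
  have h1 := h.eventually_lt (show Real.exp (-ε) < 1 by simpa using hε)
  rw [eventually_comap, eventually_atTop] at h1
  obtain ⟨N, hN⟩ := h1
  -- The lower limit controls only large m; the finitely many others have positive divisors, whose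
  -- minimum is absorbed in c.
  have hfin : {m : Fin n → ℤ | l1Size m ≤ N ∧ m ≠ 0}.Finite :=
    (finite_l1Size_le N).subset fun m hm => hm.1
  obtain ⟨c, hc, hcm⟩ : ∃ c > 0, ∀ m ∈ {m : Fin n → ℤ | l1Size m ≤ N ∧ m ≠ 0},
      c ≤ |intPairing m u| + |intPairing m v| := by
    rcases Set.eq_empty_or_nonempty {m : Fin n → ℤ | l1Size m ≤ N ∧ m ≠ 0} with he | hne
    · exact ⟨1, one_pos, by simp [he]⟩
    · obtain ⟨m₀, hm₀, hmin⟩ := Set.exists_min_image _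
        (fun m => |intPairing m u| + |intPairing m v|) hfin hne
      exact ⟨_, h.pos hm₀.2, hmin⟩
  refine ⟨min c 1, lt_min hc one_pos, fun m hm => ?_⟩
  have hl : (0 : ℝ) ≤ l1Size m := by exact_mod_cast l1Size_nonneg m
  rcases le_total (l1Size m) N with hle | hle
  · calc min c 1 * Real.exp (-ε * l1Size m) ≤ c * 1 := by
          gcongr
          · exact min_le_left _ _
          · exact Real.exp_le_one_iff.2 (by nlinarith)
      _ ≤ _ := by
          rw [mul_one]
          exact hcm m ⟨hle, hm⟩
  · have h2 := Real.rpow_le_rpow (Real.exp_pos _).le (hN _ hle m rfl).le hl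
    rw [diophantineRate_rpow hm, ← Real.exp_mul] at h2
    refine le_trans ?_ h2
    exact mul_le_of_le_one_left (Real.exp_pos _).le (min_le_right _ _)

/-- If the foliation is not weakly Diophantine, there are infinitely many exponentially small
divisors. -/
theorem exists_infinite_of_not_isWeaklyDiophantine (hn : 0 < n) (h : ¬ IsWeaklyDiophantine u v) :
    ∃ ρ > 0, {m : Fin n → ℤ | m ≠ 0 ∧
      |intPairing m u| + |intPairing m v| ≤ Real.exp (-ρ * l1Size m)}.Infinite := by
  by_contra! hfin
  refine h (isWeaklyDiophantine_iff.2 (le_antisymm ?_ ?_))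
  · exact liminf_le_of_le isBoundedUnder_diophantineRate
      fun b hb => le_one_of_eventually_le_diophantineRate hn hb
  refine le_of_forall_lt fun a ha => ?_
  set b := max ((a + 1) / 2) (1 / 2) with hb
  have hab : a < b := lt_of_lt_of_le (by linarith) (le_max_left _ _)
  have hb1 : b < 1 := max_lt (by linarith) (by norm_num)
  have hb0 : 0 < b := lt_of_lt_of_le (by norm_num) (le_max_right _ _)
  -- A real `liminf` is meaningful only if the eventual lower bounds are themselves bounded above;
  -- the bound 1 comes from the multiples of a unit vector.
  refine lt_of_lt_of_le hab (le_liminf_of_le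
    ⟨1, fun a ha => le_one_of_eventually_le_diophantineRate hn ha⟩ ?_)
  -- With this rate, exp(-ρ|m|) is b^|m|.
  have h1 := hfin (-Real.log b) (neg_pos.2 (Real.log_neg hb0 hb1))
  obtain ⟨M, hM⟩ := (h1.image l1Size).bddAbove
  rw [eventually_comap, eventually_atTop]
  refine ⟨max (M + 1) 1, fun k hk m hmk => ?_⟩
  have hmM : M < l1Size m := by
    rw [hmk]
    exact lt_of_lt_of_le (lt_add_one M) ((le_max_left _ _).trans hk)
  have hm0 : m ≠ 0 := by
    rintro rfl
    have : (1 : ℤ) ≤ k := (le_max_right _ _).trans hk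
    simp [l1Size] at hmk
    lia
  have hm : m ∉ {m : Fin n → ℤ | m ≠ 0 ∧
      |intPairing m u| + |intPairing m v| ≤ Real.exp (- -Real.log b * l1Size m)} := fun hm =>
    absurd (hM (Set.mem_image_of_mem _ hm)) (not_le.2 hmM)
  simp only [Set.mem_ofPred_eq, not_and, not_le, neg_neg] at hm
  have h2 := hm hm0
  rw [Real.exp_mul, Real.exp_log hb0, ← diophantineRate_rpow hm0] at h2
  have hl : (0 : ℝ) < l1Size m := by
    have := one_le_l1Size hm0
    exact_mod_cast (by lia : 0 < l1Size m)
  exact ((Real.rpow_lt_rpow_iff hb0.le (diophantineRate_nonneg m) hl).1 h2).le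

end Diophantine

/-! ### Leafwise primitives and the Beltrami equation on all leaves -/

section Primitive

variable {n : ℕ} {u v : Fin n → ℝ}

lemma le_norm_symbolDzbar (m : Fin n → ℤ) :
    (|intPairing m u| + |intPairing m v|) / 4 ≤ ‖symbolDzbar u v m‖ := by
  have h1 := Complex.abs_re_le_norm (intPairing m u + I * intPairing m v : ℂ)
  have h2 := Complex.abs_im_le_norm (intPairing m u + I * intPairing m v : ℂ)
  simp only [add_re, ofReal_re, mul_re, I_re, I_im, ofReal_im, zero_mul, one_mul, mul_zero,
    sub_zero, add_zero, add_im, mul_im, zero_add] at h1 h2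
  rw [symbolDzbar, norm_div, norm_mul, norm_I, one_mul]
  simp only [Complex.norm_ofNat]
  linarith

/-- Leafwise closed analytic forms are cohomologous to constant ones. -/
theorem IsWeaklyDiophantine.exists_leaf_primitive (h : IsWeaklyDiophantine u v)
    {q r : (Fin n → ℝ) → ℂ} (hq : AnalyticPeriodic q) (hr : AnalyticPeriodic r)
    (hqr : ∀ x, leafDz u v q x = leafDzbar u v r x) :
    ∃ β, AnalyticPeriodic β ∧ (∀ x, leafDzbar u v β x = q x - torusCoeff q 0) ∧
      ∀ x, leafDz u v β x = r x - torusCoeff r 0 := by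
  -- Half of the decay rate of q is spent on the divisors. At m = 0 the quotient is 0 by convention,
  -- which normalizes the primitive to mean zero.
  have hdec : HasExpDecay fun m => torusCoeff q m / symbolDzbar u v m := by
    obtain ⟨ρ, hρ, C, hC⟩ := hq.hasExpDecay
    obtain ⟨c, hc, hcm⟩ := h.exists_lower_bound (half_pos hρ)
    have hC0 : 0 ≤ C := nonneg_of_mul_nonneg_left ((norm_nonneg _).trans (hC 0)) (Real.exp_pos _)
    refine ⟨ρ / 2, half_pos hρ, C * (4 / c), fun m => ?_⟩
    by_cases hm : m = 0
    · subst hm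
      simp only [symbolDzbar_zero, div_zero, norm_zero]
      positivity
    · simp only
      have h1 : c / 4 * Real.exp (-(ρ / 2) * l1Size m) ≤ ‖symbolDzbar u v m‖ := by
        refine le_trans ?_ (le_norm_symbolDzbar m)
        have := hcm m hm
        linarith
      rw [norm_div, div_le_iff₀ (lt_of_lt_of_le (by positivity) h1)]
      calc ‖torusCoeff q m‖ ≤ C * Real.exp (-ρ * l1Size m) := hC m
        _ = C * (4 / c) * Real.exp (-(ρ / 2) * l1Size m)
            * (c / 4 * Real.exp (-(ρ / 2) * l1Size m)) := by
            rw [show -ρ * (l1Size m : ℝ) = -(ρ / 2) * l1Size m + -(ρ / 2) * l1Size m by ring,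
              Real.exp_add]
            field_simp
        _ ≤ _ := by gcongr
  have hβ := analyticPeriodic_torusSeries hdec
  have hs : ∀ m : Fin n → ℤ, m ≠ 0 → symbolDzbar u v m ≠ 0 := by
    intro m hm h0
    have := le_norm_symbolDzbar (u := u) (v := v) m
    rw [h0, norm_zero] at this
    linarith [h.pos hm]
  have hconst : ∀ (c : ℂ) (m : Fin n → ℤ), torusCoeff (fun _ : Fin n → ℝ => c) m
      = if m = 0 then c else 0 := by
    intro c m
    have h1 := torusMean_torusChar (-m)
    have h2 : torusCoeff (fun _ : Fin n → ℝ => c) m = c * torusMean (torusChar (-m)) := by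
      simp only [torusCoeff, torusMean]
      exact integral_const_mul _ _
    rw [h2, h1]
    simp
  have hsubc : ∀ {g : (Fin n → ℝ) → ℂ}, AnalyticPeriodic g → ∀ m,
      torusCoeff (fun x => g x - torusCoeff g 0) m = if m = 0 then 0 else torusCoeff g m := by
    intro g hg m
    have := hg.torusCoeff_add (AnalyticPeriodic.const (-torusCoeff g 0)) m
    simp only [← sub_eq_add_neg] at this
    rw [this, hconst]
    by_cases hm : m = 0 <;> simp [hm]
  refine ⟨_, hβ, fun x => ?_, fun x => ?_⟩
  · refine congrFun (hβ.leafDzbar.ext_torusCoeff (hq.sub (AnalyticPeriodic.const _))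
      (funext fun m => ?_)) x
    rw [hβ.torusCoeff_leafDzbar, torusCoeff_torusSeries hdec.summable, hsubc hq]
    by_cases hm : m = 0
    · simp [hm, symbolDzbar_zero]
    · rw [if_neg hm, mul_div_cancel₀ _ (hs m hm)]
  · refine congrFun (hβ.leafDz.ext_torusCoeff (hr.sub (AnalyticPeriodic.const _))
      (funext fun m => ?_)) x
    rw [hβ.torusCoeff_leafDz, torusCoeff_torusSeries hdec.summable, hsubc hr]
    by_cases hm : m = 0
    · simp [hm, symbolDzbar_zero]
    -- Leafwise closedness on coefficients: the β obtained by dividing q by its symbol also solves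
    -- the equation for r.
    · have h1 : symbolDz u v m * torusCoeff q m = symbolDzbar u v m * torusCoeff r m := by
        rw [← hq.torusCoeff_leafDz, ← hr.torusCoeff_leafDzbar]
        congr 1
        exact funext hqr
      rw [if_neg hm, mul_div_assoc', h1, mul_div_cancel_left₀ _ (hs m hm)]

lemma fderiv_mul_apply {E : Type*} [NormedAddCommGroup E] [NormedSpace ℝ E] {f g : E → ℂ} {x : E}
    (hf : DifferentiableAt ℝ f x) (hg : DifferentiableAt ℝ g x) (w : E) :
    fderiv ℝ (fun x => f x * g x) x w = f x * fderiv ℝ g x w + fderiv ℝ f x w * g x := by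
  rw [fderiv_fun_mul hf hg]
  simp [mul_comm]

lemma fderiv_cexp_apply {E : Type*} [NormedAddCommGroup E] [NormedSpace ℝ E] {f : E → ℂ} {x : E}
    (hf : DifferentiableAt ℝ f x) (w : E) :
    fderiv ℝ (fun x => Complex.exp (f x)) x w = Complex.exp (f x) * fderiv ℝ f x w := by
  rw [hf.hasFDerivAt.cexp.fderiv]
  simp

/-- The analytic uniformization of the leaves: for an analytic Beltrami coefficient `μ`, there is
a nowhere vanishing analytic `f` such that `f (dz + μ dz̄)` is leafwise closed and cohomologous to
a constant form. -/
theorem IsWeaklyDiophantine.exists_beltrami_solution (h : IsWeaklyDiophantine u v)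
    {μ : (Fin n → ℝ) → ℂ} (hμ : AnalyticPeriodic μ) {k : ℝ} (hk : k < 1) (hμk : ∀ x, ‖μ x‖ ≤ k) :
    ∃ f β, AnalyticPeriodic f ∧ AnalyticPeriodic β ∧ (∀ x, f x ≠ 0) ∧ ∃ a b : ℂ,
      (∀ x, leafDz u v β x = f x - a) ∧ ∀ x, leafDzbar u v β x = μ x * f x - b := by
  obtain ⟨p, hp, hp0, hpe⟩ := exists_beltrami_log hμ hk hμk u v
  -- Here φ_z̄ = p and φ_z = S p, with no constants left over because p and S p have mean zero. The
  -- equation for p then reads φ_z̄ = μ φ_z + μ_z, that is, f_z̄ = (μ f)_z for f = exp φ.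
  obtain ⟨φ, hφ, hφ1, hφ2⟩ := h.exists_leaf_primitive hp (hp.leafBeurling (u := u) (v := v))
    fun x => by rw [hp.leafDzbar_leafBeurling]
  rw [hp.torusCoeff_leafBeurling, hp0] at hφ2
  rw [hp0] at hφ1
  simp only [mul_zero, sub_zero] at hφ1 hφ2
  have hf : AnalyticPeriodic fun x => Complex.exp (φ x) :=
    ⟨hφ.1.cexp, fun x m => by simp only [hφ.2 x m]⟩
  obtain ⟨β, hβ, hβ1, hβ2⟩ := h.exists_leaf_primitive (hμ.mul hf) hf fun x => by
    have dφ : DifferentiableAt ℝ φ x := hφ.1.differentiable (by simp) x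
    have dμ : DifferentiableAt ℝ μ x := hμ.1.differentiable (by simp) x
    have h1 := hφ1 x
    rw [hpe x, ← hφ2 x] at h1
    rw [leafDz, leafDzbar, fderiv_mul_apply dμ dφ.cexp, fderiv_mul_apply dμ dφ.cexp,
      fderiv_cexp_apply dφ, fderiv_cexp_apply dφ]
    simp only [leafDz, leafDzbar] at h1
    linear_combination -Complex.exp (φ x) * h1
  exact ⟨_, β, hf, hβ, fun x => Complex.exp_ne_zero _, _, _, hβ2, hβ1⟩

end Primitive

end

noncomputable section

/-! ### Smoothness of inverse matrices and derivatives of bilinear fields -/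

section InverseMatrix

variable {n : ℕ} {E : Type*} [NormedAddCommGroup E] [NormedSpace ℝ E] {r : WithTop ℕ∞}

lemma contDiff_det {M : E → Matrix (Fin n) (Fin n) ℝ} (h : ∀ i j, ContDiff ℝ r fun x => M x i j) :
    ContDiff ℝ r fun x => (M x).det := by
  simp only [Matrix.det_apply]
  exact ContDiff.sum fun σ _ => (contDiff_prod fun i _ => h _ _).const_smul _

lemma contDiff_matrix_inv {M : E → Matrix (Fin n) (Fin n) ℝ}
    (h : ∀ i j, ContDiff ℝ r fun x => M x i j) (hM : ∀ x, (M x).det ≠ 0) (i j : Fin n) :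
    ContDiff ℝ r fun x => (M x)⁻¹ i j := by
  have h1 : (fun x => (M x)⁻¹ i j) = fun x => ((M x).det)⁻¹ * (M x).adjugate i j := by
    funext x
    rw [Matrix.inv_def, Matrix.smul_apply, Ring.inverse_eq_inv', smul_eq_mul]
  rw [h1]
  refine ((contDiff_det h).inv hM).mul ?_
  simp only [Matrix.adjugate_apply]
  refine contDiff_det fun k l => ?_
  by_cases hk : k = j
  · subst hk
    simp only [Matrix.updateRow_self]
    exact contDiff_const
  · simp only [Matrix.updateRow_ne hk]
    exact h k l

end InverseMatrix

section BilinearFields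

variable {E F G H : Type*} [NormedAddCommGroup E] [NormedSpace ℝ E] [NormedAddCommGroup F]
  [NormedSpace ℝ F] [NormedAddCommGroup G] [NormedSpace ℝ G] [NormedAddCommGroup H]
  [NormedSpace ℝ H] {r : WithTop ℕ∞}

lemma fderiv_clm_apply_const {A : E → F →L[ℝ] G} {x : E} (hA : DifferentiableAt ℝ A x) (X : F)
    (a : E) : fderiv ℝ (fun y => A y X) x a = fderiv ℝ A x a X := by
  have h := hA.hasFDerivAt.clm_apply (hasFDerivAt_const X x)
  rw [h.fderiv]
  simp

lemma fderiv_apply_pi {n : ℕ} {f : E → Fin n → ℝ} {x : E} (hf : DifferentiableAt ℝ f x) (a : E)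
    (l : Fin n) : fderiv ℝ (fun y => f y l) x a = fderiv ℝ f x a l := by
  rw [(hasFDerivAt_pi'.1 hf.hasFDerivAt l).fderiv]
  rfl

lemma fderiv_clm_apply₂_const {A : E → F →L[ℝ] G →L[ℝ] H} {x : E} (hA : DifferentiableAt ℝ A x)
    (X : F) (Y : G) (a : E) : fderiv ℝ (fun y => A y X Y) x a = fderiv ℝ A x a X Y := by
  rw [fderiv_clm_apply_const (hA.clm_apply (differentiableAt_const X)), fderiv_clm_apply_const hA]

lemma contDiff_clm_apply₂_iff [FiniteDimensional ℝ F] [FiniteDimensional ℝ G]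
    {A : E → F →L[ℝ] G →L[ℝ] H} :
    ContDiff ℝ r A ↔ ∀ X Y, ContDiff ℝ r fun x => A x X Y := by
  rw [contDiff_clm_apply_iff]
  exact forall_congr' fun X => contDiff_clm_apply_iff

end BilinearFields

/-! ### Coordinate-free form of the Christoffel symbols and the curvature -/

namespace TorusMetric

variable {n : ℕ}

lemma fderiv_eq_sum_partialDeriv (f : (Fin n → ℝ) → ℝ) (x X : Fin n → ℝ) :
    fderiv ℝ f x X = ∑ i, X i * partialDeriv i f x := by
  have h := LinearMap.pi_apply_eq_sum_univ (fderiv ℝ f x : (Fin n → ℝ) →ₗ[ℝ] ℝ) X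
  simp only [ContinuousLinearMap.coe_coe, smul_eq_mul] at h
  rw [h]
  refine Finset.sum_congr rfl fun i _ => ?_
  rw [partialDeriv]
  congr 2
  funext j
  simp [Pi.single_apply, eq_comm]

lemma mat_symm (g : TorusMetric n) (x : Fin n → ℝ) (i j : Fin n) : g.mat x i j = g.mat x j i := by
  have := (g.posDef x).1.apply j i
  simpa using this

lemma det_ne_zero (g : TorusMetric n) (x : Fin n → ℝ) : (g.mat x).det ≠ 0 := (g.posDef x).det_pos.ne'

lemma inner_comm (g : TorusMetric n) (x X Y : Fin n → ℝ) : g.inner x X Y = g.inner x Y X := by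
  unfold inner
  rw [Finset.sum_comm]
  refine Finset.sum_congr rfl fun i _ => Finset.sum_congr rfl fun j _ => ?_
  rw [g.mat_symm x j i]
  ring

lemma inner_self_pos (g : TorusMetric n) (x : Fin n → ℝ) {X : Fin n → ℝ} (hX : X ≠ 0) :
    0 < g.inner x X X := by
  have h := (g.posDef x).dotProduct_mulVec_pos hX
  simp only [star_trivial, dotProduct, Matrix.mulVec, Finset.mul_sum] at h
  unfold inner
  refine h.trans_eq (Finset.sum_congr rfl fun i _ => Finset.sum_congr rfl fun j _ => ?_)
  ring

/-- The scalar product as a continuous bilinear form. -/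
def innerCLM (g : TorusMetric n) (x : Fin n → ℝ) : (Fin n → ℝ) →L[ℝ] (Fin n → ℝ) →L[ℝ] ℝ :=
  ∑ i, ∑ j, g.mat x i j • (ContinuousLinearMap.proj (R := ℝ) (φ := fun _ : Fin n => ℝ) i).smulRight
    (ContinuousLinearMap.proj (R := ℝ) (φ := fun _ : Fin n => ℝ) j)

@[simp] lemma innerCLM_apply (g : TorusMetric n) (x X Y : Fin n → ℝ) :
    g.innerCLM x X Y = g.inner x X Y := by
  simp [innerCLM, inner, _root_.sum_apply, mul_assoc]

lemma partialDeriv_contDiff {r s : WithTop ℕ∞} {f : (Fin n → ℝ) → ℝ} (hf : ContDiff ℝ r f)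
    (hs : s + 1 ≤ r) (i : Fin n) : ContDiff ℝ s (partialDeriv i f) :=
  (hf.fderiv_right hs).clm_apply contDiff_const

lemma contDiff_christoffel {g : TorusMetric n} (hg : g.IsOfClass 2) (k i j : Fin n) :
    ContDiff ℝ 1 (g.christoffel k i j) := by
  have h1 : ∀ i j, ContDiff ℝ 1 fun x => g.mat x i j := fun i j => (hg i j).of_le one_le_two
  have h2 : ∀ i j l, ContDiff ℝ 1 (partialDeriv l fun x => g.mat x i j) := fun i j l =>
    partialDeriv_contDiff (hg i j) (by norm_num) l
  unfold christoffel
  exact contDiff_const.mul (ContDiff.sum fun l _ => (contDiff_matrix_inv h1 g.det_ne_zero k l).mul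
    (((h2 _ _ _).add (h2 _ _ _)).sub (h2 _ _ _)))

lemma sum_mat_mul_christoffel (g : TorusMetric n) (l i j : Fin n) (x : Fin n → ℝ) :
    ∑ k, g.mat x l k * g.christoffel k i j x
      = (1 / 2) * (partialDeriv i (fun y => g.mat y j l) x + partialDeriv j (fun y => g.mat y i l) x
        - partialDeriv l (fun y => g.mat y i j) x) := by
  set w : Fin n → ℝ := fun l => (1 / 2) * (partialDeriv i (fun y => g.mat y j l) x
    + partialDeriv j (fun y => g.mat y i l) x - partialDeriv l (fun y => g.mat y i j) x) with hw
  have h1 : (fun k => g.christoffel k i j x) = (g.mat x)⁻¹.mulVec w := by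
    funext k
    simp only [christoffel, Matrix.mulVec, dotProduct, hw, Finset.mul_sum]
    exact Finset.sum_congr rfl fun l _ => by ring
  have h2 : (g.mat x).mulVec (fun k => g.christoffel k i j x) = w := by
    rw [h1, Matrix.mulVec_mulVec, Matrix.mul_nonsing_inv _ (g.det_ne_zero x).isUnit,
      Matrix.one_mulVec]
  exact congrFun h2 l

lemma christoffel_symm (g : TorusMetric n) (k i j : Fin n) (x : Fin n → ℝ) :
    g.christoffel k i j x = g.christoffel k j i x := by
  unfold christoffel
  congr 1
  refine Finset.sum_congr rfl fun l _ => ?_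
  have : (fun y => g.mat y i j) = fun y => g.mat y j i := funext fun y => g.mat_symm y i j
  rw [this]
  ring

/-- The Christoffel symbols as a field of continuous bilinear maps. -/
def christoffelCLM (g : TorusMetric n) (x : Fin n → ℝ) :
    (Fin n → ℝ) →L[ℝ] (Fin n → ℝ) →L[ℝ] (Fin n → ℝ) :=
  ∑ k, ∑ i, ∑ j, g.christoffel k i j x •
    (ContinuousLinearMap.proj (R := ℝ) (φ := fun _ : Fin n => ℝ) i).smulRight
      ((ContinuousLinearMap.proj (R := ℝ) (φ := fun _ : Fin n => ℝ) j).smulRight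
        (Pi.single k 1 : Fin n → ℝ))

lemma sum_bilin_apply (c : Fin n → Fin n → Fin n → ℝ) (X Y : Fin n → ℝ) (l : Fin n) :
    (∑ k, ∑ i, ∑ j, c k i j •
      (ContinuousLinearMap.proj (R := ℝ) (φ := fun _ : Fin n => ℝ) i).smulRight
      ((ContinuousLinearMap.proj (R := ℝ) (φ := fun _ : Fin n => ℝ) j).smulRight
        (Pi.single k 1 : Fin n → ℝ))) X Y l = ∑ i, ∑ j, c l i j * X i * Y j := by
  simp only [_root_.sum_apply, Finset.sum_apply, _root_.smul_apply,
    ContinuousLinearMap.smulRight_apply, ContinuousLinearMap.proj_apply, Pi.smul_apply, smul_eq_mul]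
  rw [Finset.sum_eq_single l]
  · refine Finset.sum_congr rfl fun i _ => Finset.sum_congr rfl fun j _ => ?_
    simp
    ring
  · intro k _ hk
    simp [hk.symm]
  · simp

lemma christoffelCLM_apply (g : TorusMetric n) (x X Y : Fin n → ℝ) :
    g.christoffelCLM x X Y = g.covDerivConst x X Y := by
  funext l
  exact sum_bilin_apply (fun k i j => g.christoffel k i j x) X Y l

lemma christoffelCLM_comm (g : TorusMetric n) (x X Y : Fin n → ℝ) :
    g.christoffelCLM x X Y = g.christoffelCLM x Y X := by
  rw [christoffelCLM_apply, christoffelCLM_apply]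
  funext k
  unfold covDerivConst
  rw [Finset.sum_comm]
  refine Finset.sum_congr rfl fun i _ => Finset.sum_congr rfl fun j _ => ?_
  rw [g.christoffel_symm k j i]
  ring

lemma contDiff_christoffelCLM {g : TorusMetric n} (hg : g.IsOfClass 2) :
    ContDiff ℝ 1 g.christoffelCLM := by
  refine contDiff_clm_apply₂_iff.2 fun X Y => contDiff_pi.2 fun k => ?_
  simp only [christoffelCLM_apply, covDerivConst]
  exact ContDiff.sum fun i _ => ContDiff.sum fun j _ =>
    ((contDiff_christoffel hg k i j).mul contDiff_const).mul contDiff_const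

lemma fderiv_christoffelCLM_apply {g : TorusMetric n} (hg : g.IsOfClass 2) (x a X Y : Fin n → ℝ)
    (l : Fin n) : fderiv ℝ g.christoffelCLM x a X Y l
      = ∑ i, ∑ j, fderiv ℝ (g.christoffel l i j) x a * X i * Y j := by
  have h1 : Differentiable ℝ g.christoffelCLM := (contDiff_christoffelCLM hg).differentiable one_ne_zero
  have h2 : DifferentiableAt ℝ (fun y => g.christoffelCLM y X Y) x :=
    ((h1 x).clm_apply (differentiableAt_const X)).clm_apply (differentiableAt_const Y)
  rw [← fderiv_clm_apply₂_const (h1 x), ← fderiv_apply_pi h2]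
  have h3 : HasFDerivAt (fun y => g.christoffelCLM y X Y l)
      (∑ i, ∑ j, (X i * Y j) • fderiv ℝ (g.christoffel l i j) x) x := by
    simp only [christoffelCLM_apply, covDerivConst]
    refine HasFDerivAt.fun_sum fun i _ => HasFDerivAt.fun_sum fun j _ => ?_
    have := (((contDiff_christoffel hg l i j).differentiable one_ne_zero x).hasFDerivAt).const_mul
      (X i * Y j)
    refine this.congr_of_eventuallyEq (Eventually.of_forall fun y => ?_)
    simp only
    ring
  rw [h3.fderiv]
  simp only [_root_.sum_apply, _root_.smul_apply, smul_eq_mul]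
  exact Finset.sum_congr rfl fun i _ => Finset.sum_congr rfl fun j _ => by ring

/-- The curvature operator `R(a, b)` in terms of the Christoffel field. -/
def curvatureCLM (g : TorusMetric n) (x a b Y : Fin n → ℝ) : Fin n → ℝ :=
  fderiv ℝ g.christoffelCLM x a b Y - fderiv ℝ g.christoffelCLM x b a Y
    + (g.christoffelCLM x a (g.christoffelCLM x b Y) - g.christoffelCLM x b (g.christoffelCLM x a Y))

lemma christoffelCLM_single (g : TorusMetric n) (x : Fin n → ℝ) (i : Fin n) (Y : Fin n → ℝ)
    (l : Fin n) : g.christoffelCLM x (Pi.single i 1) Y l = ∑ m, g.christoffel l i m x * Y m := by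
  rw [christoffelCLM_apply, covDerivConst, Finset.sum_eq_single i]
  · simp
  · intro k _ hk
    simp [hk]
  · simp

lemma curvatureCLM_single {g : TorusMetric n} (hg : g.IsOfClass 2) (x : Fin n → ℝ)
    (l i j k : Fin n) : g.curvatureCLM x (Pi.single i 1) (Pi.single j 1) (Pi.single k 1) l
      = g.curvature l i j k x := by
  have h1 : ∀ i j k l, fderiv ℝ g.christoffelCLM x (Pi.single i 1) (Pi.single j 1) (Pi.single k 1) l
      = partialDeriv i (g.christoffel l j k) x := by
    intro i j k l
    rw [fderiv_christoffelCLM_apply hg, Finset.sum_eq_single j, Finset.sum_eq_single k]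
    · simp [partialDeriv]
    · intro b _ hb
      simp [hb]
    · simp
    · intro b _ hb
      simp [hb]
    · simp
  have h2 : ∀ i j l, g.christoffelCLM x (Pi.single i 1) (Pi.single j 1) l = g.christoffel l i j x := by
    intro i j l
    rw [christoffelCLM_single, Finset.sum_eq_single j]
    · simp
    · intro b _ hb
      simp [hb]
    · simp
  simp only [curvatureCLM, curvature, Pi.add_apply, Pi.sub_apply, h1]
  rw [christoffelCLM_single, christoffelCLM_single, Finset.sum_sub_distrib]
  simp only [h2]

lemma eq_sum_single (X : Fin n → ℝ) : X = ∑ i, X i • (Pi.single i 1 : Fin n → ℝ) := by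
  funext j
  simp [Finset.sum_apply, Pi.single_apply]

/-- The curvature operator is linear in each of its three vector arguments, so it is determined by
the basis vectors. -/
lemma isEuclidean_iff {g : TorusMetric n} (hg : g.IsOfClass 2) :
    g.IsEuclidean ↔ ∀ x a b Y, g.curvatureCLM x a b Y = 0 := by
  constructor
  · intro h x a b Y
    have h0 : ∀ i j k, g.curvatureCLM x (Pi.single i 1) (Pi.single j 1) (Pi.single k 1) = 0 := by
      intro i j k
      funext l
      rw [curvatureCLM_single hg, h]
      rfl
    have hY : ∀ i j, g.curvatureCLM x (Pi.single i 1) (Pi.single j 1) Y = 0 := by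
      intro i j
      have e : g.curvatureCLM x (Pi.single i 1) (Pi.single j 1) Y
          = ∑ k, Y k • g.curvatureCLM x (Pi.single i 1) (Pi.single j 1) (Pi.single k 1) := by
        conv_lhs => rw [eq_sum_single Y]
        simp only [curvatureCLM, map_sum, map_smul, smul_add, smul_sub, Finset.sum_add_distrib,
          Finset.sum_sub_distrib]
      rw [e]
      simp [h0]
    have hb : ∀ i, g.curvatureCLM x (Pi.single i 1) b Y = 0 := by
      intro i
      have e : g.curvatureCLM x (Pi.single i 1) b Y
          = ∑ k, b k • g.curvatureCLM x (Pi.single i 1) (Pi.single k 1) Y := by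
        conv_lhs => rw [eq_sum_single b]
        simp only [curvatureCLM, map_sum, map_smul, smul_add, smul_sub, Finset.sum_add_distrib,
          Finset.sum_sub_distrib, _root_.sum_apply, _root_.smul_apply]
      rw [e]
      simp [hY]
    have e : g.curvatureCLM x a b Y = ∑ k, a k • g.curvatureCLM x (Pi.single k 1) b Y := by
      conv_lhs => rw [eq_sum_single a]
      simp only [curvatureCLM, map_sum, map_smul, smul_add, smul_sub, Finset.sum_add_distrib,
        Finset.sum_sub_distrib, _root_.sum_apply, _root_.smul_apply]
    rw [e]
    simp [hb]
  · intro h l i j k x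
    rw [← curvatureCLM_single hg, h]
    rfl

/-- The derivative along `X` of the scalar product of the constant fields `Y` and `Z`. -/
lemma fderiv_inner_apply {g : TorusMetric n} (hg : g.IsOfClass 1) (x X Y Z : Fin n → ℝ) :
    fderiv ℝ (fun y => g.inner y Y Z) x X
      = ∑ i, ∑ j, ∑ l, partialDeriv i (fun y => g.mat y j l) x * (X i * Y j * Z l) := by
  have h1 : HasFDerivAt (fun y => g.inner y Y Z)
      (∑ j, ∑ l, (Y j * Z l) • fderiv ℝ (fun y => g.mat y j l) x) x := by
    unfold inner
    refine HasFDerivAt.fun_sum fun j _ => HasFDerivAt.fun_sum fun l _ => ?_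
    have := (((hg j l).differentiable one_ne_zero x).hasFDerivAt).const_mul (Y j * Z l)
    refine this.congr_of_eventuallyEq (Eventually.of_forall fun y => ?_)
    simp only
    ring
  rw [h1.fderiv]
  simp only [_root_.sum_apply, _root_.smul_apply, smul_eq_mul,
    fderiv_eq_sum_partialDeriv, Finset.mul_sum]
  have h2 : ∀ a : Fin n → Fin n → Fin n → ℝ,
      ∑ j, ∑ l, ∑ i, a i j l = ∑ i, ∑ j, ∑ l, a i j l := by
    intro a
    rw [Finset.sum_comm (f := fun i j => ∑ l, a i j l)]
    exact Finset.sum_congr rfl fun j _ => Finset.sum_comm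
  refine Eq.trans ?_ (h2 fun i j l => partialDeriv i (fun y => g.mat y j l) x * (X i * Y j * Z l))
  exact Finset.sum_congr rfl fun j _ => Finset.sum_congr rfl fun l _ =>
    Finset.sum_congr rfl fun i _ => by ring

/-- The Koszul formula for constant vector fields. -/
lemma inner_christoffelCLM {g : TorusMetric n} (hg : g.IsOfClass 1) (x X Y Z : Fin n → ℝ) :
    g.inner x Z (g.christoffelCLM x X Y)
      = (1 / 2) * (fderiv ℝ (fun y => g.inner y Y Z) x X + fderiv ℝ (fun y => g.inner y X Z) x Y
        - fderiv ℝ (fun y => g.inner y X Y) x Z) := by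
  rw [fderiv_inner_apply hg, fderiv_inner_apply hg, fderiv_inner_apply hg]
  have h1 : g.inner x Z (g.christoffelCLM x X Y)
      = ∑ i, ∑ j, ∑ l, (∑ k, g.mat x l k * g.christoffel k i j x) * (X i * Y j * Z l) := by
    have h2 : g.inner x Z (g.christoffelCLM x X Y)
        = ∑ l, ∑ i, ∑ j, (∑ k, g.mat x l k * g.christoffel k i j x) * (X i * Y j * Z l) := by
      unfold inner
      refine Finset.sum_congr rfl fun l _ => ?_
      simp only [christoffelCLM_apply, covDerivConst, Finset.mul_sum, Finset.sum_mul]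
      rw [Finset.sum_comm]
      refine Finset.sum_congr rfl fun i _ => ?_
      rw [Finset.sum_comm]
      exact Finset.sum_congr rfl fun j _ => Finset.sum_congr rfl fun k _ => by ring
    rw [h2, Finset.sum_comm]
    exact Finset.sum_congr rfl fun i _ => Finset.sum_comm
  have h3 : ∑ i, ∑ j, ∑ l, partialDeriv i (fun y => g.mat y j l) x * (Y i * X j * Z l)
      = ∑ i, ∑ j, ∑ l, partialDeriv j (fun y => g.mat y i l) x * (X i * Y j * Z l) := by
    rw [Finset.sum_comm]
    exact Finset.sum_congr rfl fun i _ => Finset.sum_congr rfl fun j _ =>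
      Finset.sum_congr rfl fun k _ => by ring
  have h4 : ∑ i, ∑ j, ∑ l, partialDeriv i (fun y => g.mat y j l) x * (Z i * X j * Y l)
      = ∑ i, ∑ j, ∑ l, partialDeriv l (fun y => g.mat y i j) x * (X i * Y j * Z l) := by
    rw [Finset.sum_comm]
    refine Finset.sum_congr rfl fun i _ => ?_
    rw [Finset.sum_comm]
    exact Finset.sum_congr rfl fun j _ => Finset.sum_congr rfl fun k _ => by ring
  rw [h1, h3, h4]
  simp only [sum_mat_mul_christoffel, Finset.mul_sum, ← Finset.sum_add_distrib,
    ← Finset.sum_sub_distrib]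
  exact Finset.sum_congr rfl fun i _ => Finset.sum_congr rfl fun j _ =>
    Finset.sum_congr rfl fun k _ => by ring

end TorusMetric

end

/-! ### Flat metrics defined by closed forms along the leaves -/

noncomputable section

/-- Linear functionals dual to `u`, `v`: the coordinates along the leaves of a linear foliation. -/
structure LeafCoframe {n : ℕ} (u v : Fin n → ℝ) where
  /-- the coordinate along `u` -/
  fst : (Fin n → ℝ) →L[ℝ] ℝ
  /-- the coordinate along `v` -/
  snd : (Fin n → ℝ) →L[ℝ] ℝ
  fst_u : fst u = 1
  fst_v : fst v = 0
  snd_u : snd u = 0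
  snd_v : snd v = 1

namespace LeafCoframe

variable {n : ℕ} {u v : Fin n → ℝ}

theorem nonempty_of_linearIndependent (huv : LinearIndependent ℝ ![u, v]) :
    Nonempty (LeafCoframe u v) := by
  obtain ⟨p, hp⟩ : ∃ p : (Fin n → ℝ) →ₗ[ℝ] ℝ, p ∘ₗ (Submodule.subtype _)
      = (Module.Basis.span huv).coord 0 := LinearMap.exists_extend _
  obtain ⟨q, hq⟩ : ∃ p : (Fin n → ℝ) →ₗ[ℝ] ℝ, p ∘ₗ (Submodule.subtype _)
      = (Module.Basis.span huv).coord 1 := LinearMap.exists_extend _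
  have h : ∀ i : Fin 2, ((Module.Basis.span huv i : Submodule.span ℝ (Set.range ![u, v])) :
      Fin n → ℝ) = ![u, v] i := fun i => congrArg Subtype.val (Module.Basis.span_apply huv i)
  have hp' : ∀ i, p (![u, v] i) = Finsupp.single i (1 : ℝ) 0 := by
    intro i
    have := LinearMap.congr_fun hp (Module.Basis.span huv i)
    rw [LinearMap.comp_apply, Submodule.subtype_apply, h] at this
    simpa using this
  have hq' : ∀ i, q (![u, v] i) = Finsupp.single i (1 : ℝ) 1 := by
    intro i
    have := LinearMap.congr_fun hq (Module.Basis.span huv i)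
    rw [LinearMap.comp_apply, Submodule.subtype_apply, h] at this
    simpa using this
  refine ⟨⟨p.toContinuousLinearMap, q.toContinuousLinearMap, ?_, ?_, ?_, ?_⟩⟩
  · simpa using hp' 0
  · simpa using hp' 1
  · simpa using hq' 0
  · simpa using hq' 1

variable (c : LeafCoframe u v)

/-- The projection along the leaves. -/
def proj : (Fin n → ℝ) →L[ℝ] (Fin n → ℝ) :=
  ContinuousLinearMap.id ℝ _ - c.fst.smulRight u - c.snd.smulRight v

lemma proj_apply (X : Fin n → ℝ) : c.proj X = X - c.fst X • u - c.snd X • v := rfl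

lemma proj_u : c.proj u = 0 := by simp [proj_apply, c.fst_u, c.snd_u]

lemma proj_v : c.proj v = 0 := by simp [proj_apply, c.fst_v, c.snd_v]

lemma fst_proj (X : Fin n → ℝ) : c.fst (c.proj X) = 0 := by
  simp [proj_apply, c.fst_u, c.fst_v]

lemma snd_proj (X : Fin n → ℝ) : c.snd (c.proj X) = 0 := by
  simp [proj_apply, c.snd_u, c.snd_v]

lemma proj_proj (X : Fin n → ℝ) : c.proj (c.proj X) = c.proj X := by
  rw [c.proj_apply (c.proj X), c.fst_proj, c.snd_proj]
  simp

lemma mem_span_iff {X : Fin n → ℝ} : X ∈ Submodule.span ℝ {u, v} ↔ c.proj X = 0 := by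
  rw [Submodule.mem_span_pair]
  constructor
  · rintro ⟨a, b, rfl⟩
    simp [c.proj_u, c.proj_v]
  · intro h
    refine ⟨c.fst X, c.snd X, ?_⟩
    rw [proj_apply, sub_sub, sub_eq_zero] at h
    exact h.symm

lemma eq_of_proj_eq_zero {X : Fin n → ℝ} (h : c.proj X = 0) : X = c.fst X • u + c.snd X • v := by
  rwa [proj_apply, sub_sub, sub_eq_zero] at h

/-- The scalar product given by a complex valued form along the leaves and the standard scalar
product of the projections. -/
def leafInner (w : (Fin n → ℝ) →L[ℝ] ℂ) (X Y : Fin n → ℝ) : ℝ :=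
  (w X).re * (w Y).re + (w X).im * (w Y).im + c.proj X ⬝ᵥ c.proj Y

/-- `w` is injective on the leaves. -/
def Nondegenerate (_ : LeafCoframe u v) (w : (Fin n → ℝ) →L[ℝ] ℂ) : Prop :=
  ∀ s t : ℝ, s • w u + t • w v = 0 → s = 0 ∧ t = 0

variable {c} in
lemma Nondegenerate.eq_zero {w : (Fin n → ℝ) →L[ℝ] ℂ} (hw : c.Nondegenerate w) {X : Fin n → ℝ}
    (h1 : c.proj X = 0) (h2 : w X = 0) : X = 0 := by
  have h := c.eq_of_proj_eq_zero h1
  rw [h, map_add, map_smul, map_smul] at h2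
  obtain ⟨h3, h4⟩ := hw _ _ h2
  rw [h, h3, h4]
  simp

variable {c} in
lemma Nondegenerate.leafInner_self_pos {w : (Fin n → ℝ) →L[ℝ] ℂ} (hw : c.Nondegenerate w)
    {X : Fin n → ℝ} (hX : X ≠ 0) : 0 < c.leafInner w X X := by
  have h1 : 0 ≤ c.proj X ⬝ᵥ c.proj X := Finset.sum_nonneg fun i _ => mul_self_nonneg _
  have h2 : 0 ≤ (w X).re * (w X).re + (w X).im * (w X).im :=
    add_nonneg (mul_self_nonneg _) (mul_self_nonneg _)
  rcases eq_or_ne (c.proj X) 0 with h | h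
  · have h3 : w X ≠ 0 := fun h3 => hX (hw.eq_zero h h3)
    have : 0 < Complex.normSq (w X) := Complex.normSq_pos.2 h3
    rw [Complex.normSq_apply] at this
    unfold leafInner
    linarith
  · have : c.proj X ⬝ᵥ c.proj X ≠ 0 := fun h0 => h (dotProduct_self_eq_zero.1 h0)
    have := lt_of_le_of_ne h1 this.symm
    unfold leafInner
    linarith

-- The form w and the projection together are coordinates on ℝⁿ. To get surjectivity from
-- injectivity, they are assembled into an endomorphism with w written in the basis u, v.
variable {c} in
lemma Nondegenerate.exists_eq {w : (Fin n → ℝ) →L[ℝ] ℂ} (hw : c.Nondegenerate w)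
    (z : ℂ) (Y : Fin n → ℝ) : ∃ X, w X = z ∧ c.proj X = c.proj Y := by
  let J : (Fin n → ℝ) →L[ℝ] (Fin n → ℝ) := c.proj + (Complex.reCLM.comp w).smulRight u
    + (Complex.imCLM.comp w).smulRight v
  have hJ : ∀ X, J X = c.proj X + (w X).re • u + (w X).im • v := fun X => rfl
  have h1 : ∀ X, c.proj (J X) = c.proj X := by
    intro X
    simp [hJ, c.proj_u, c.proj_v, c.proj_proj]
  have h2 : ∀ X, c.fst (J X) = (w X).re := by
    intro X
    simp [hJ, c.fst_u, c.fst_v, c.fst_proj]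
  have h3 : ∀ X, c.snd (J X) = (w X).im := by
    intro X
    simp [hJ, c.snd_u, c.snd_v, c.snd_proj]
  have hinj : Function.Injective (J : (Fin n → ℝ) →ₗ[ℝ] (Fin n → ℝ)) := by
    rw [injective_iff_map_eq_zero]
    intro X hX
    have hX' : J X = 0 := hX
    refine hw.eq_zero ?_ (Complex.ext ?_ ?_)
    · rw [← h1, hX', map_zero]
    · rw [← h2, hX', map_zero]
      rfl
    · rw [← h3, hX', map_zero]
      rfl
  obtain ⟨X, hX⟩ := (LinearMap.injective_iff_surjective.1 hinj) (c.proj Y + z.re • u + z.im • v)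
  have hX' : J X = c.proj Y + z.re • u + z.im • v := hX
  refine ⟨X, Complex.ext ?_ ?_, ?_⟩
  · rw [← h2, hX']
    simp [c.fst_u, c.fst_v, c.fst_proj]
  · rw [← h3, hX']
    simp [c.snd_u, c.snd_v, c.snd_proj]
  · rw [← h1, hX']
    simp [c.proj_u, c.proj_v, c.proj_proj]

lemma sum_single_apply (p q : (Fin n → ℝ) →L[ℝ] ℝ) (X Y : Fin n → ℝ) :
    ∑ i, ∑ j, p (Pi.single i 1) * q (Pi.single j 1) * X i * Y j = p X * q Y := by
  conv_rhs => rw [TorusMetric.eq_sum_single X, TorusMetric.eq_sum_single Y]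
  rw [map_sum, map_sum, Finset.sum_mul_sum]
  refine Finset.sum_congr rfl fun i _ => Finset.sum_congr rfl fun j _ => ?_
  rw [map_smul, map_smul, smul_eq_mul, smul_eq_mul]
  ring

lemma sum_leafInner_single (w : (Fin n → ℝ) →L[ℝ] ℂ) (X Y : Fin n → ℝ) :
    ∑ i, ∑ j, c.leafInner w (Pi.single i 1) (Pi.single j 1) * X i * Y j = c.leafInner w X Y := by
  have h1 := sum_single_apply (Complex.reCLM.comp w) (Complex.reCLM.comp w) X Y
  have h2 := sum_single_apply (Complex.imCLM.comp w) (Complex.imCLM.comp w) X Y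
  have h3 := fun k => sum_single_apply ((ContinuousLinearMap.proj k).comp c.proj)
    ((ContinuousLinearMap.proj k).comp c.proj) X Y
  simp only [ContinuousLinearMap.comp_apply, Complex.reCLM_apply, Complex.imCLM_apply,
    ContinuousLinearMap.proj_apply] at h1 h2 h3
  simp only [leafInner, dotProduct, add_mul, Finset.sum_add_distrib, h1, h2]
  congr 1
  simp only [← h3, Finset.sum_mul]
  exact (Finset.sum_congr rfl fun i _ => Finset.sum_comm).trans Finset.sum_comm

/-- The metric on the torus defined by a field of nondegenerate complex forms along the leaves. -/
def metric (w : (Fin n → ℝ) → (Fin n → ℝ) →L[ℝ] ℂ) (hp : TorusPeriodic w)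
    (hw : ∀ x, c.Nondegenerate (w x)) : TorusMetric n where
  mat x := Matrix.of fun i j => c.leafInner (w x) (Pi.single i 1) (Pi.single j 1)
  periodic x m := by rw [hp]
  posDef x := by
    refine Matrix.PosDef.of_dotProduct_mulVec_pos ?_ fun X hX => ?_
    · ext i j
      simp only [Matrix.conjTranspose_apply, Matrix.of_apply, star_trivial, leafInner]
      rw [dotProduct_comm]
      ring
    · have h := (hw x).leafInner_self_pos hX
      rw [← c.sum_leafInner_single] at h
      simp only [star_trivial, dotProduct, Matrix.mulVec, Finset.mul_sum, Matrix.of_apply]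
      refine h.trans_eq (Finset.sum_congr rfl fun i _ => Finset.sum_congr rfl fun j _ => ?_)
      ring

section Metric

variable {w : (Fin n → ℝ) → (Fin n → ℝ) →L[ℝ] ℂ} {hp : TorusPeriodic w}
    {hw : ∀ x, c.Nondegenerate (w x)}

lemma inner_metric (x X Y : Fin n → ℝ) : (c.metric w hp hw).inner x X Y = c.leafInner (w x) X Y :=
  c.sum_leafInner_single _ _ _

lemma contDiff_leafInner {r : WithTop ℕ∞} (h : ContDiff ℝ r w) (X Y : Fin n → ℝ) :
    ContDiff ℝ r fun x => c.leafInner (w x) X Y := by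
  have h1 : ∀ X, ContDiff ℝ r fun x => (w x X).re := fun X =>
    Complex.reCLM.contDiff.comp (h.clm_apply contDiff_const)
  have h2 : ∀ X, ContDiff ℝ r fun x => (w x X).im := fun X =>
    Complex.imCLM.contDiff.comp (h.clm_apply contDiff_const)
  exact (((h1 X).mul (h1 Y)).add ((h2 X).mul (h2 Y))).add contDiff_const

lemma isOfClass_metric {r : WithTop ℕ∞} (h : ContDiff ℝ r w) :
    (c.metric w hp hw).IsOfClass r :=
  fun _ _ => c.contDiff_leafInner h _ _

lemma fderiv_leafInner {x : Fin n → ℝ} (h : DifferentiableAt ℝ w x) (X Y Z : Fin n → ℝ) :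
    fderiv ℝ (fun y => c.leafInner (w y) Y Z) x X
      = (fderiv ℝ w x X Y).re * (w x Z).re + (w x Y).re * (fderiv ℝ w x X Z).re
        + ((fderiv ℝ w x X Y).im * (w x Z).im + (w x Y).im * (fderiv ℝ w x X Z).im) := by
  have h1 : ∀ Y, HasFDerivAt (fun y => w y Y) ((fderiv ℝ w x).flip Y) x := by
    intro Y
    have := h.hasFDerivAt.clm_apply (hasFDerivAt_const Y x)
    simpa using this
  have hre : ∀ Y, HasFDerivAt (fun y => (w y Y).re) (Complex.reCLM.comp ((fderiv ℝ w x).flip Y)) x :=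
    fun Y => (Complex.reCLM.hasFDerivAt (x := w x Y)).comp x (h1 Y)
  have him : ∀ Y, HasFDerivAt (fun y => (w y Y).im) (Complex.imCLM.comp ((fderiv ℝ w x).flip Y)) x :=
    fun Y => (Complex.imCLM.hasFDerivAt (x := w x Y)).comp x (h1 Y)
  have h2 := (((hre Y).mul (hre Z)).add ((him Y).mul (him Z))).add_const (c.proj Y ⬝ᵥ c.proj Z)
  have h3 : fderiv ℝ (fun y => c.leafInner (w y) Y Z) x = _ := h2.fderiv
  rw [h3]
  simp only [_root_.add_apply, _root_.smul_apply, smul_eq_mul, ContinuousLinearMap.comp_apply,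
    ContinuousLinearMap.flip_apply, Complex.reCLM_apply, Complex.imCLM_apply]
  ring

/-- For a closed form, the Levi-Civita connection of the metric is the one for which the form and
the projection along the leaves are parallel. -/
lemma apply_christoffelCLM_metric (h : ContDiff ℝ 1 w)
    (hsymm : ∀ x X Y, fderiv ℝ w x X Y = fderiv ℝ w x Y X) (x X Y : Fin n → ℝ) :
    w x ((c.metric w hp hw).christoffelCLM x X Y) = fderiv ℝ w x X Y
      ∧ c.proj ((c.metric w hp hw).christoffelCLM x X Y) = 0 := by
  set C := (c.metric w hp hw).christoffelCLM x X Y with hC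
  have hd : DifferentiableAt ℝ w x := h.differentiable one_ne_zero x
  -- In the Koszul formula for |w|², symmetry of the derivative of w cancels every term except Re
  -- (w(Z) conj(Dw(X) Y)).
  have key : ∀ Z, (w x Z).re * ((w x C).re - (fderiv ℝ w x X Y).re)
      + (w x Z).im * ((w x C).im - (fderiv ℝ w x X Y).im) + c.proj Z ⬝ᵥ c.proj C = 0 := by
    intro Z
    have h1 := TorusMetric.inner_christoffelCLM (c.isOfClass_metric (hp := hp) (hw := hw) h) x X Y Z
    simp only [inner_metric] at h1
    rw [c.fderiv_leafInner hd, c.fderiv_leafInner hd, c.fderiv_leafInner hd, hsymm x Z X,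
      hsymm x Z Y, hsymm x Y X, ← hC] at h1
    unfold leafInner at h1
    linarith
  -- Tested on this Z, the identity becomes a sum of squares equal to zero.
  obtain ⟨Z, hZ1, hZ2⟩ := (hw x).exists_eq (w x C - fderiv ℝ w x X Y) C
  have h2 := key Z
  rw [hZ1, hZ2, Complex.sub_re, Complex.sub_im] at h2
  have h3 : 0 ≤ c.proj C ⬝ᵥ c.proj C := Finset.sum_nonneg fun i _ => mul_self_nonneg _
  refine ⟨sub_eq_zero.1 (Complex.ext ?_ ?_), ?_⟩
  · rw [Complex.sub_re, Complex.zero_re]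
    nlinarith [mul_self_nonneg ((w x C).re - (fderiv ℝ w x X Y).re),
      mul_self_nonneg ((w x C).im - (fderiv ℝ w x X Y).im)]
  · rw [Complex.sub_im, Complex.zero_im]
    nlinarith [mul_self_nonneg ((w x C).re - (fderiv ℝ w x X Y).re),
      mul_self_nonneg ((w x C).im - (fderiv ℝ w x X Y).im)]
  · refine dotProduct_self_eq_zero.1 (le_antisymm ?_ h3)
    nlinarith [mul_self_nonneg ((w x C).re - (fderiv ℝ w x X Y).re),
      mul_self_nonneg ((w x C).im - (fderiv ℝ w x X Y).im)]

lemma hasTotallyGeodesicLeaves_metric (h : ContDiff ℝ 1 w)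
    (hsymm : ∀ x X Y, fderiv ℝ w x X Y = fderiv ℝ w x Y X) :
    (c.metric w hp hw).HasTotallyGeodesicLeaves (Submodule.span ℝ {u, v}) := by
  intro x X _ Y _
  rw [c.mem_span_iff, ← TorusMetric.christoffelCLM_apply]
  exact (c.apply_christoffelCLM_metric h hsymm x X Y).2

/-- Differentiating w(Γ(b, Y)) = Dw(b) Y gives w(R(a, b) Y) = D²w(a, b) Y - D²w(b, a) Y, which is 0
by symmetry of second derivatives. The projection of the curvature vanishes because Γ takes values
in the leaf plane. -/
lemma isEuclidean_metric (h : ContDiff ℝ 2 w)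
    (hsymm : ∀ x X Y, fderiv ℝ w x X Y = fderiv ℝ w x Y X) :
    (c.metric w hp hw).IsEuclidean := by
  have h1 : ContDiff ℝ 1 w := h.of_le one_le_two
  have hcl := c.isOfClass_metric (hp := hp) (hw := hw) h
  set g := c.metric w hp hw with hg
  have hG : ContDiff ℝ 1 g.christoffelCLM := TorusMetric.contDiff_christoffelCLM hcl
  have hw1 : ContDiff ℝ 1 (fderiv ℝ w) := h.fderiv_right (by norm_num)
  rw [TorusMetric.isEuclidean_iff hcl]
  intro x a b Y
  have hc := c.apply_christoffelCLM_metric (hp := hp) (hw := hw) h1 hsymm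
  rw [← hg] at hc
  have hΓ : ∀ b Y, HasFDerivAt (fun y => g.christoffelCLM y b Y)
      (((fderiv ℝ g.christoffelCLM x).flip b).flip Y) x := by
    intro b Y
    have := ((hG.differentiable one_ne_zero x).hasFDerivAt.clm_apply
      (hasFDerivAt_const b x)).clm_apply (hasFDerivAt_const Y x)
    simpa using this
  have hderiv : ∀ a b, w x (fderiv ℝ g.christoffelCLM x a b Y)
      + w x (g.christoffelCLM x a (g.christoffelCLM x b Y)) = fderiv ℝ (fderiv ℝ w) x a b Y := by
    intro a b
    have e1 := (h1.differentiable one_ne_zero x).hasFDerivAt.clm_apply (hΓ b Y)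
    have e2 : (fun y => w y (g.christoffelCLM y b Y)) = fun y => fderiv ℝ w y b Y :=
      funext fun y => (hc y b Y).1
    rw [e2] at e1
    have e3 := fderiv_clm_apply₂_const (hw1.differentiable one_ne_zero x) b Y a
    rw [e1.fderiv] at e3
    simp only [_root_.add_apply, ContinuousLinearMap.comp_apply,
      ContinuousLinearMap.flip_apply] at e3
    rw [← e3, (hc x a _).1]
  have hproj : ∀ a b, c.proj (fderiv ℝ g.christoffelCLM x a b Y) = 0 := by
    intro a b
    have e1 := (c.proj.hasFDerivAt).comp x (hΓ b Y)
    have e2 : (c.proj ∘ fun y => g.christoffelCLM y b Y) = fun _ => 0 :=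
      funext fun y => (hc y b Y).2
    rw [e2] at e1
    have e3 := congrArg (fun A => A a) (e1.unique (hasFDerivAt_const 0 x))
    simpa using e3
  have hs : fderiv ℝ (fderiv ℝ w) x a b = fderiv ℝ (fderiv ℝ w) x b a :=
    (h.contDiffAt (x := x)).isSymmSndFDerivAt (by simp) a b
  refine (hw x).eq_zero ?_ ?_
  · simp only [TorusMetric.curvatureCLM, map_add, map_sub, hproj, (hc x _ _).2, sub_zero, add_zero]
  · have e1 := hderiv a b
    have e2 := hderiv b a
    rw [hs] at e1
    simp only [TorusMetric.curvatureCLM, map_add, map_sub]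
    linear_combination e1 - e2

end Metric

end LeafCoframe

end

noncomputable section

/-! ### Beltrami coefficient of a metric and the Euclidean uniformization -/

section BeltramiCoefficient

/-- The Beltrami coefficient of the metric `E dx² + 2 F dx dy + G dy²`. -/
def beltramiCoeff (E F G : ℝ) : ℂ :=
  ⟨(E - G) / (E + G + 2 * √(E * G - F ^ 2)), 2 * F / (E + G + 2 * √(E * G - F ^ 2))⟩

variable {E F G : ℝ}

lemma add_add_sqrt_pos (hE : 0 < E) (hG : 0 < G) : 0 < E + G + 2 * √(E * G - F ^ 2) := by
  positivity

/-- |dz + μ dz̄|² on the first coordinate vector. The factor in front of E is the same as the one in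
front of G for 1 - μ, which is the point of the formula for μ. -/
lemma normSq_one_add_beltramiCoeff (hE : 0 < E) (hG : 0 < G) (hD : 0 < E * G - F ^ 2) :
    Complex.normSq (1 + beltramiCoeff E F G) = 4 * E / (E + G + 2 * √(E * G - F ^ 2)) := by
  have hS := add_add_sqrt_pos (F := F) hE hG
  have hs := Real.sq_sqrt hD.le
  set S := √(E * G - F ^ 2)
  simp only [Complex.normSq_apply, beltramiCoeff, Complex.add_re, Complex.add_im, Complex.one_re,
    Complex.one_im]
  field_simp
  linear_combination 4 * (E + G + 2 * S) * hs

lemma normSq_one_sub_beltramiCoeff (hE : 0 < E) (hG : 0 < G) (hD : 0 < E * G - F ^ 2) :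
    Complex.normSq (1 - beltramiCoeff E F G) = 4 * G / (E + G + 2 * √(E * G - F ^ 2)) := by
  have hS := add_add_sqrt_pos (F := F) hE hG
  have hs := Real.sq_sqrt hD.le
  set S := √(E * G - F ^ 2)
  simp only [Complex.normSq_apply, beltramiCoeff, Complex.sub_re, Complex.sub_im, Complex.one_re,
    Complex.one_im]
  field_simp
  linear_combination 4 * (E + G + 2 * S) * hs

lemma norm_beltramiCoeff_lt_one (hE : 0 < E) (hG : 0 < G) (hD : 0 < E * G - F ^ 2) :
    ‖beltramiCoeff E F G‖ < 1 := by
  have hS := add_add_sqrt_pos (F := F) hE hG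
  have hs := Real.sq_sqrt hD.le
  have hs0 : 0 < √(E * G - F ^ 2) := Real.sqrt_pos.2 hD
  have h : ‖beltramiCoeff E F G‖ ^ 2 < 1 := by
    rw [← Complex.normSq_eq_norm_sq, Complex.normSq_apply]
    simp only [beltramiCoeff]
    rw [div_mul_div_comm, div_mul_div_comm, ← add_div, div_lt_one (by positivity)]
    nlinarith
  have := norm_nonneg (beltramiCoeff E F G)
  nlinarith

end BeltramiCoefficient

variable {n : ℕ} {u v : Fin n → ℝ}

namespace TorusMetric

lemma contDiff_inner {r : WithTop ℕ∞} {g : TorusMetric n} (hg : g.IsOfClass r) (X Y : Fin n → ℝ) :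
    ContDiff ℝ r fun x => g.inner x X Y :=
  ContDiff.sum fun i _ => ContDiff.sum fun j _ =>
    ((hg i j).mul contDiff_const).mul contDiff_const

lemma inner_smul_add_smul (g : TorusMetric n) (x X Y : Fin n → ℝ) (s t s' t' : ℝ) :
    g.inner x (s • X + t • Y) (s' • X + t' • Y) = s * s' * g.inner x X X
      + (s * t' + t * s') * g.inner x X Y + t * t' * g.inner x Y Y := by
  have h := g.inner_comm x Y X
  simp only [← innerCLM_apply] at h ⊢
  simp only [map_add, map_smul, _root_.add_apply, _root_.smul_apply, smul_eq_mul, h]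
  ring

lemma inner_mul_inner_sub_sq_pos (g : TorusMetric n) (huv : LinearIndependent ℝ ![u, v])
    (x : Fin n → ℝ) : 0 < g.inner x u u * g.inner x v v - g.inner x u v ^ 2 := by
  have hu : u ≠ 0 := huv.ne_zero 0
  have hE := g.inner_self_pos x hu
  -- A multiple of the component of v orthogonal to u; its square length is the Gram determinant
  -- times g(u, u).
  have hw : (-g.inner x u v) • u + g.inner x u u • v ≠ 0 := by
    intro h0
    exact hE.ne' (LinearIndependent.pair_iff.1 huv _ _ h0).2
  have h := g.inner_self_pos x hw
  rw [inner_smul_add_smul] at h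
  have : 0 < g.inner x u u * (g.inner x u u * g.inner x v v - g.inner x u v ^ 2) := by
    linarith
  exact pos_of_mul_pos_right this hE.le

/-- The Beltrami coefficient of the restriction of the metric to the leaves, in the coordinates
defined by `u` and `v`. -/
def leafBeltrami (g : TorusMetric n) (u v x : Fin n → ℝ) : ℂ :=
  beltramiCoeff (g.inner x u u) (g.inner x u v) (g.inner x v v)

lemma analyticPeriodic_leafBeltrami {g : TorusMetric n} (hg : g.IsAnalytic)
    (huv : LinearIndependent ℝ ![u, v]) : AnalyticPeriodic (g.leafBeltrami u v) := by
  have hu : u ≠ 0 := huv.ne_zero 0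
  have hv : v ≠ 0 := huv.ne_zero 1
  constructor
  · have h1 := contDiff_inner hg u u
    have h2 := contDiff_inner hg u v
    have h3 := contDiff_inner hg v v
    have h4 : ContDiff ℝ ω fun x => g.inner x u u + g.inner x v v
        + 2 * √(g.inner x u u * g.inner x v v - g.inner x u v ^ 2) :=
      (h1.add h3).add (contDiff_const.mul (((h1.mul h3).sub (h2.pow 2)).sqrt fun x =>
        (g.inner_mul_inner_sub_sq_pos huv x).ne'))
    have h5 : ∀ x, g.inner x u u + g.inner x v v
        + 2 * √(g.inner x u u * g.inner x v v - g.inner x u v ^ 2) ≠ 0 := fun x =>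
      (add_add_sqrt_pos (g.inner_self_pos x hu) (g.inner_self_pos x hv)).ne'
    have h6 : ContDiff ℝ ω fun x => ((g.inner x u u - g.inner x v v) / (g.inner x u u
        + g.inner x v v + 2 * √(g.inner x u u * g.inner x v v - g.inner x u v ^ 2)),
        2 * g.inner x u v / (g.inner x u u + g.inner x v v
          + 2 * √(g.inner x u u * g.inner x v v - g.inner x u v ^ 2))) :=
      ((h1.sub h3).div h4 h5).prodMk ((contDiff_const.mul h2).div h4 h5)
    exact Complex.equivRealProdCLM.symm.contDiff.comp h6
  · intro x m
    simp only [leafBeltrami, TorusMetric.inner, g.periodic]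

end TorusMetric

lemma AnalyticPeriodic.exists_norm_le_of_forall_norm_lt {f : (Fin n → ℝ) → ℂ}
    (hf : AnalyticPeriodic f) (h : ∀ x, ‖f x‖ < 1) : ∃ k < 1, ∀ x, ‖f x‖ ≤ k := by
  obtain ⟨y, -, hy⟩ := (isCompact_closedBall (0 : Fin n → ℝ) (2 * Real.pi)).exists_isMaxOn
    (Metric.nonempty_closedBall.2 (by positivity)) hf.continuous.norm.continuousOn
  refine ⟨‖f y‖, h y, fun x => ?_⟩
  obtain ⟨z, hz, m, rfl⟩ := exists_mem_ball_of_torusPeriodic x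
  have := hy hz
  simpa only [Set.mem_ofPred_eq, hf.2 x m] using this

/-- The form w = w₀ + dβ is closed in all directions, not just along the leaves, because dβ is the
full differential. On the leaves it is f (dz + μ dz̄), so |w|² is there a positive multiple of g. -/
theorem IsWeaklyDiophantine.exists_isEuclideanUniformization (h : IsWeaklyDiophantine u v)
    (huv : LinearIndependent ℝ ![u, v]) {g : TorusMetric n} (hg : g.IsAnalytic) :
    ∃ h : TorusMetric n, h.IsAnalytic ∧
      h.IsEuclideanUniformization g (Submodule.span ℝ {u, v}) := by
  obtain ⟨c⟩ := LeafCoframe.nonempty_of_linearIndependent huv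
  have hu : u ≠ 0 := huv.ne_zero 0
  have hv : v ≠ 0 := huv.ne_zero 1
  have hE := fun x => g.inner_self_pos x hu
  have hG := fun x => g.inner_self_pos x hv
  have hD := g.inner_mul_inner_sub_sq_pos huv
  have hμ := TorusMetric.analyticPeriodic_leafBeltrami hg huv
  obtain ⟨k, hk, hμk⟩ := hμ.exists_norm_le_of_forall_norm_lt fun x =>
    norm_beltramiCoeff_lt_one (hE x) (hG x) (hD x)
  obtain ⟨f, β, hf, hβ, hf0, a, b, h1, h2⟩ := h.exists_beltrami_solution hμ hk hμk
  -- The constant form a dz + b dz̄, with dz(u) = 1 and dz(v) = i: it restores the means subtracted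
  -- in the construction of β.
  set w₀ : (Fin n → ℝ) →L[ℝ] ℂ := c.fst.smulRight (a + b) + c.snd.smulRight (Complex.I * (a - b))
    with hw₀
  set w : (Fin n → ℝ) → (Fin n → ℝ) →L[ℝ] ℂ := fun x => w₀ + fderiv ℝ β x with hw
  have hwu : ∀ x, w x u = f x * (1 + g.leafBeltrami u v x) := by
    intro x
    have e1 := h1 x
    have e2 := h2 x
    simp only [leafDz, leafDzbar] at e1 e2
    simp [hw, hw₀, c.fst_u, c.snd_u]
    linear_combination e1 + e2
  have hwv : ∀ x, w x v = f x * (Complex.I * (1 - g.leafBeltrami u v x)) := by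
    intro x
    have e1 := h1 x
    have e2 := h2 x
    simp only [leafDz, leafDzbar] at e1 e2
    simp [hw, hw₀, c.fst_v, c.snd_v]
    linear_combination Complex.I * e1 - Complex.I * e2 + fderiv ℝ β x v * Complex.I_sq
  set l : (Fin n → ℝ) → ℝ := fun x => Complex.normSq (f x) * 4 /
    (g.inner x u u + g.inner x v v + 2 * √(g.inner x u u * g.inner x v v - g.inner x u v ^ 2))
    with hl
  have hl0 : ∀ x, 0 < l x := fun x => div_pos (mul_pos (Complex.normSq_pos.2 (hf0 x)) four_pos)
    (add_add_sqrt_pos (hE x) (hG x))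
  have huu : ∀ x, (w x u).re * (w x u).re + (w x u).im * (w x u).im = l x * g.inner x u u := by
    intro x
    rw [← Complex.normSq_apply, hwu, Complex.normSq_mul, TorusMetric.leafBeltrami,
      normSq_one_add_beltramiCoeff (hE x) (hG x) (hD x), hl]
    ring
  have hvv : ∀ x, (w x v).re * (w x v).re + (w x v).im * (w x v).im = l x * g.inner x v v := by
    intro x
    rw [← Complex.normSq_apply, hwv, Complex.normSq_mul, Complex.normSq_mul,
      TorusMetric.leafBeltrami, normSq_one_sub_beltramiCoeff (hE x) (hG x) (hD x), hl]
    simp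
    ring
  have huv' : ∀ x, (w x u).re * (w x v).re + (w x u).im * (w x v).im = l x * g.inner x u v := by
    intro x
    have hS := (add_add_sqrt_pos (F := g.inner x u v) (hE x) (hG x)).ne'
    simp only [hwu, hwv, hl, TorusMetric.leafBeltrami, beltramiCoeff, Complex.normSq_apply,
      Complex.mul_re, Complex.mul_im, Complex.add_re, Complex.add_im, Complex.sub_re,
      Complex.sub_im, Complex.one_re, Complex.one_im, Complex.I_re, Complex.I_im]
    ring
  have hconf : ∀ (x : Fin n → ℝ) (s t s' t' : ℝ), ((w x) (s • u + t • v)).re * ((w x) (s' • u + t' • v)).re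
      + ((w x) (s • u + t • v)).im * ((w x) (s' • u + t' • v)).im
        = l x * g.inner x (s • u + t • v) (s' • u + t' • v) := by
    intro x s t s' t'
    rw [TorusMetric.inner_smul_add_smul]
    simp only [map_add, map_smul, Complex.add_re, Complex.add_im, Complex.smul_re,
      Complex.smul_im, smul_eq_mul]
    linear_combination s * s' * huu x + (s * t' + t * s') * huv' x + t * t' * hvv x
  have hnd : ∀ x, c.Nondegenerate (w x) := by
    intro x s t hst
    have e := hconf x s t s t
    rw [map_add, map_smul, map_smul, hst] at e
    by_contra hne
    have hX : s • u + t • v ≠ 0 := fun h0 => hne (LinearIndependent.pair_iff.1 huv _ _ h0)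
    have := mul_pos (hl0 x) (g.inner_self_pos x hX)
    simp at e
    rcases e with e | e
    · exact (hl0 x).ne' e
    · exact (g.inner_self_pos x hX).ne' e
  have hper : TorusPeriodic w := by
    intro x m
    simp only [hw]
    rw [hβ.2.fderiv x m]
  have hwc : ContDiff ℝ ω w := contDiff_const.add (hβ.1.fderiv_right le_top)
  have hsymm : ∀ x X Y, fderiv ℝ w x X Y = fderiv ℝ w x Y X := by
    intro x X Y
    have e : fderiv ℝ w x = fderiv ℝ (fderiv ℝ β) x := by
      simp only [hw]
      rw [fderiv_const_add]
    rw [e]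
    exact ((hβ.1.of_le le_top : ContDiff ℝ 2 β).contDiffAt (x := x)).isSymmSndFDerivAt (by simp) X Y
  refine ⟨c.metric w hper hnd, c.isOfClass_metric hwc,
    c.isEuclidean_metric (hwc.of_le le_top) hsymm,
    c.hasTotallyGeodesicLeaves_metric (hwc.of_le le_top) hsymm, fun x => ⟨l x, hl0 x, ?_⟩⟩
  intro X hX Y hY
  rw [c.mem_span_iff] at hX hY
  rw [c.inner_metric, LeafCoframe.leafInner, hX, zero_dotProduct, add_zero,
    c.eq_of_proj_eq_zero hX, c.eq_of_proj_eq_zero hY]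
  exact hconf _ _ _ _ _

end

noncomputable section

/-! ### Linear differential equations and parallel sections of flat connections -/

section LinearODE

variable {F : Type*} [NormedAddCommGroup F] [NormedSpace ℝ F] [CompleteSpace F]

/-- A linear differential equation with continuous coefficients has a solution on `[0, 1]`. -/
theorem exists_solution_linearODE {B : ℝ → F →L[ℝ] F} (hB : Continuous B) (y₀ : F) :
    ∃ y : ℝ → F, y 0 = y₀ ∧ ∀ t ∈ Set.Icc (0 : ℝ) 1, HasDerivAt y (B t (y t)) t := by
  obtain ⟨K₀, hK₀⟩ := isCompact_Icc.exists_bound_of_continuousOn (s := Set.Icc (0 : ℝ) 1)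
    hB.continuousOn
  set K := max K₀ 1 with hKdef
  have hK1 : 1 ≤ K := le_max_right _ _
  have hK : ∀ t ∈ Set.Icc (0 : ℝ) 1, ‖B t‖ ≤ K := fun t ht => (hK₀ t ht).trans (le_max_left _ _)
  -- The unknown is rescaled by exp(-L t); with L twice the bound on B, the Picard map contracts by
  -- 1/2 on all of [0, 1].
  set L := 2 * K with hL
  have hL0 : 0 < L := by linarith
  let ext : C(Set.Icc (0 : ℝ) 1, F) → ℝ → F := fun z => z ∘ Set.projIcc 0 1 zero_le_one
  have hext : ∀ z, Continuous (ext z) := fun z => z.continuous.comp continuous_projIcc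
  let r : C(Set.Icc (0 : ℝ) 1, F) → ℝ → F := fun z s => Real.exp (L * s) • B s (ext z s)
  have hr : ∀ z, Continuous (r z) := fun z =>
    (Real.continuous_exp.comp (continuous_const.mul continuous_id)).smul (hB.clm_apply (hext z))
  let p : C(Set.Icc (0 : ℝ) 1, F) → ℝ → F := fun z t => y₀ + ∫ s in (0 : ℝ)..t, r z s
  have hp : ∀ z t, HasDerivAt (p z) (r z t) t := fun z t =>
    ((hr z).integral_hasStrictDerivAt 0 t).hasDerivAt.const_add y₀
  let S : C(Set.Icc (0 : ℝ) 1, F) → C(Set.Icc (0 : ℝ) 1, F) := fun z =>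
    ⟨fun t => Real.exp (-(L * t)) • p z t, by
      have : Continuous (p z) := continuous_iff_continuousAt.2 fun t => (hp z t).continuousAt
      fun_prop⟩
  have hS : ContractingWith (1 / 2) S := by
    refine ⟨by norm_num, LipschitzWith.of_dist_le_mul fun z z' => ?_⟩
    rw [ContinuousMap.dist_le (by positivity)]
    intro t
    have h1 : S z t - S z' t = Real.exp (-(L * t)) • ∫ s in (0 : ℝ)..t, (r z s - r z' s) := by
      rw [intervalIntegral.integral_sub ((hr z).intervalIntegrable _ _)
        ((hr z').intervalIntegrable _ _)]
      simp only [S, p, ContinuousMap.coe_mk, ← smul_sub]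
      congr 1
      abel
    have h2 : ∀ s ∈ Set.Ioc (0 : ℝ) t, ‖r z s - r z' s‖ ≤ K * dist z z' * Real.exp (L * s) := by
      intro s hs
      have hs' : s ∈ Set.Icc (0 : ℝ) 1 := ⟨hs.1.le, hs.2.trans t.2.2⟩
      simp only [r, ← smul_sub, ← map_sub, norm_smul, Real.norm_eq_abs, Real.abs_exp]
      rw [mul_comm]
      gcongr
      refine ((B s).le_opNorm _).trans ?_
      gcongr
      · exact hK s hs'
      · rw [← dist_eq_norm]
        exact ContinuousMap.dist_apply_le_dist _
    have h3 : ‖∫ s in (0 : ℝ)..t, (r z s - r z' s)‖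
        ≤ ∫ s in (0 : ℝ)..t, K * dist z z' * Real.exp (L * s) :=
      intervalIntegral.norm_integral_le_of_norm_le t.2.1
        (Eventually.of_forall h2) (Continuous.intervalIntegrable (by fun_prop) _ _)
    have h4 : ∫ s in (0 : ℝ)..t, K * dist z z' * Real.exp (L * s)
        = K * dist z z' * ((Real.exp (L * t) - 1) / L) := by
      rw [intervalIntegral.integral_const_mul, intervalIntegral.integral_comp_mul_left _ hL0.ne',
        integral_exp, mul_zero, Real.exp_zero, smul_eq_mul, inv_mul_eq_div]
    rw [dist_eq_norm, h1, norm_smul, Real.norm_eq_abs, Real.abs_exp]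
    refine (mul_le_mul_of_nonneg_left (h3.trans h4.le) (Real.exp_pos _).le).trans ?_
    have h5 : Real.exp (-(L * t)) * (K * dist z z' * ((Real.exp (L * t) - 1) / L))
        = (1 - Real.exp (-(L * t))) * (1 / 2 * dist z z') := by
      have : Real.exp (-(L * t)) * Real.exp (L * t) = 1 := by
        rw [← Real.exp_add]
        simp
      have hK0 : K ≠ 0 := by linarith
      rw [hL] at this ⊢
      field_simp
      linear_combination (dist z z') * this
    rw [h5]
    have h6 := (Real.exp_pos (-(L * t))).le
    have : 0 ≤ 1 / 2 * dist z z' := by positivity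
    simp only [NNReal.coe_div, NNReal.coe_one, NNReal.coe_ofNat]
    nlinarith
  set z := hS.fixedPoint with hz
  have hfix : S z = z := hS.fixedPoint_isFixedPt
  refine ⟨p z, by simp [p], fun t ht => ?_⟩
  have h1 : ext z t = Real.exp (-(L * t)) • p z t := by
    have := congrArg (fun f => f ⟨t, ht⟩) hfix
    simp only [S, ContinuousMap.coe_mk] at this
    simp only [ext, Function.comp_apply, Set.projIcc_of_mem zero_le_one ht]
    exact this.symm
  have h2 : r z t = B t (p z t) := by
    simp only [r, h1, map_smul, smul_smul]
    rw [← Real.exp_add]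
    simp
  rw [← h2]
  exact hp z t

end LinearODE

section UniformDifferentiability

variable {E F : Type*} [NormedAddCommGroup E] [NormedSpace ℝ E] [ProperSpace E]
  [NormedAddCommGroup F] [NormedSpace ℝ F]

lemma ContDiff.exists_forall_norm_sub_sub_le {f : E → F} (hf : ContDiff ℝ 1 f) (R : ℝ) {η : ℝ}
    (hη : 0 < η) : ∃ δ > 0, ∀ x h : E, ‖x‖ ≤ R → ‖h‖ < δ →
      ‖f (x + h) - f x‖ ≤ η ∧ ‖f (x + h) - f x - fderiv ℝ f x h‖ ≤ η * ‖h‖ := by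
  have hc := isCompact_closedBall (0 : E) (R + 1)
  have h1 := hc.uniformContinuousOn_of_continuous hf.continuous.continuousOn
  have h2 := hc.uniformContinuousOn_of_continuous (hf.continuous_fderiv one_ne_zero).continuousOn
  obtain ⟨δ₁, hδ₁, H1⟩ := Metric.uniformContinuousOn_iff.1 h1 η hη
  obtain ⟨δ₂, hδ₂, H2⟩ := Metric.uniformContinuousOn_iff.1 h2 η hη
  refine ⟨min 1 (min δ₁ δ₂), by positivity, fun x h hx hh => ?_⟩
  have hx' : x ∈ Metric.closedBall (0 : E) (R + 1) := by
    rw [mem_closedBall_zero_iff]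
    linarith
  have hmem : ∀ y ∈ Metric.ball x (min 1 (min δ₁ δ₂)), y ∈ Metric.closedBall (0 : E) (R + 1) := by
    intro y hy
    rw [Metric.mem_ball, dist_eq_norm] at hy
    rw [mem_closedBall_zero_iff]
    have e1 := norm_add_le x (y - x)
    rw [add_sub_cancel] at e1
    have := hy.trans_le (min_le_left _ _)
    linarith
  have hxh : x + h ∈ Metric.ball x (min 1 (min δ₁ δ₂)) := by
    simpa [Metric.mem_ball, dist_eq_norm] using hh
  constructor
  · rw [← dist_eq_norm]
    refine (H1 _ (hmem _ hxh) _ hx' ?_).le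
    exact (Metric.mem_ball.1 hxh).trans_le ((min_le_right _ _).trans (min_le_left _ _))
  · have := (convex_ball x (min 1 (min δ₁ δ₂))).norm_image_sub_le_of_norm_fderiv_le' (𝕜 := ℝ)
      (f := f) (φ := fderiv ℝ f x) (C := η) (fun y _ => hf.differentiable one_ne_zero y)
      (fun y hy => by
        rw [← dist_eq_norm]
        refine (H2 _ (hmem _ hy) _ hx' ?_).le
        exact (Metric.mem_ball.1 hy).trans_le ((min_le_right _ _).trans (min_le_right _ _)))
      (Metric.mem_ball_self (by positivity)) hxh
    simpa using this

end UniformDifferentiability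

section Frobenius

variable {E F : Type*} [NormedAddCommGroup E] [NormedSpace ℝ E] [ProperSpace E]
  [NormedAddCommGroup F] [NormedSpace ℝ F] [CompleteSpace F]

/-- A flat linear connection on a vector space has a parallel section with any initial value. -/
theorem exists_parallel_section {A : E → E →L[ℝ] F →L[ℝ] F} (hA : ContDiff ℝ 1 A)
    (hflat : ∀ x a b y, fderiv ℝ A x a b y + A x b (A x a y)
      = fderiv ℝ A x b a y + A x a (A x b y)) (y₀ : F) :
    ∃ Y : E → F, Y 0 = y₀ ∧ ∀ x, HasFDerivAt Y ((A x).flip (Y x)) x := by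
  have hcont : ∀ x : E, Continuous fun t : ℝ => A (t • x) x := fun x =>
    (hA.continuous.comp (continuous_id.smul continuous_const)).clm_apply continuous_const
  -- Parallel transport along the ray t ↦ t x; the section is its value at t = 1, and flatness is
  -- needed only for its differentiability.
  choose y hy0 hy using fun x => exists_solution_linearODE (hcont x) y₀
  refine ⟨fun x => y x 1, ?_, fun x => ?_⟩
  · have h := norm_image_sub_le_of_norm_deriv_le_segment_01' (f := y 0) (f' := fun _ => 0) (C := 0)
      (fun t ht => by simpa using (hy 0 t ht).hasDerivWithinAt) (by simp)
    rw [hy0] at h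
    simpa [sub_eq_zero] using h
  obtain ⟨M₀, hM₀⟩ := (isCompact_closedBall (0 : E) (‖x‖ + 1)).exists_bound_of_continuousOn
    (f := A) hA.continuous.continuousOn
  obtain ⟨N₀, hN₀⟩ := isCompact_Icc.exists_bound_of_continuousOn (s := Set.Icc (0 : ℝ) 1)
    (f := y x) fun t ht => (hy x t ht).continuousAt.continuousWithinAt
  set M := max M₀ 1 with hM
  set N := max N₀ 1 with hN
  have hM1 : 1 ≤ M := le_max_right _ _
  have hN1 : 1 ≤ N := le_max_right _ _
  have hMA : ∀ z, ‖z‖ ≤ ‖x‖ + 1 → ‖A z‖ ≤ M := fun z hz =>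
    (hM₀ z (mem_closedBall_zero_iff.2 hz)).trans (le_max_left _ _)
  have hNy : ∀ t ∈ Set.Icc (0 : ℝ) 1, ‖y x t‖ ≤ N := fun t ht => (hN₀ t ht).trans (le_max_left _ _)
  set K := M * (‖x‖ + 1) with hK
  have hK1 : 1 ≤ K := by nlinarith [norm_nonneg x]
  set C := N * (‖x‖ + 1 + ‖x‖ * M + M ^ 2) with hC
  have hC0 : 0 < C := by positivity
  rw [hasFDerivAt_iff_isLittleO_nhds_zero, Asymptotics.isLittleO_iff]
  intro ε hε
  set η := ε / (C * Real.exp K) with hη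
  have hη0 : 0 < η := by positivity
  obtain ⟨δ, hδ, H⟩ := hA.exists_forall_norm_sub_sub_le ‖x‖ hη0
  have hball : Metric.ball (0 : E) (min (min δ η) 1) ∈ nhds (0 : E) :=
    Metric.ball_mem_nhds _ (by positivity)
  filter_upwards [hball] with h hh
  rw [mem_ball_zero_iff, lt_min_iff, lt_min_iff] at hh
  obtain ⟨⟨hhδ, hhη⟩, hh1⟩ := hh
  -- The error of the expected first order variation of the transport: if the section is parallel,
  -- moving from t x to t (x + h) changes it by t A(t x) h y to first order.
  set d : ℝ → F := fun t => y (x + h) t - (y x t + t • A (t • x) h (y x t)) with hd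
  set d' : ℝ → F := fun t => A (t • (x + h)) (x + h) (y (x + h) t) - (A (t • x) x (y x t)
    + (t • (fderiv ℝ A (t • x) x h (y x t) + A (t • x) h (A (t • x) x (y x t)))
      + A (t • x) h (y x t))) with hd'
  have hderiv : ∀ t ∈ Set.Icc (0 : ℝ) 1, HasDerivAt d (d' t) t := by
    intro t ht
    have e1 : HasDerivAt (fun s : ℝ => A (s • x)) (fderiv ℝ A (t • x) x) t := by
      have e2 : HasDerivAt (fun s : ℝ => s • x) x t := by
        simpa using (hasDerivAt_id t).smul_const x
      exact ((hA.differentiable one_ne_zero (t • x)).hasFDerivAt).comp_hasDerivAt t e2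
    have e3 : HasDerivAt (fun s : ℝ => A (s • x) h) (fderiv ℝ A (t • x) x h) t := by
      simpa using e1.clm_apply (hasDerivAt_const t h)
    have e4 := e3.clm_apply (hy x t ht)
    have e5 : HasDerivAt (fun s : ℝ => s • A (s • x) h (y x s)) (t • (fderiv ℝ A (t • x) x h (y x t)
        + A (t • x) h (A (t • x) x (y x t))) + (1 : ℝ) • A (t • x) h (y x t)) t :=
      (hasDerivAt_id t).smul e4
    rw [one_smul] at e5
    exact (hy (x + h) t ht).sub ((hy x t ht).add e5)
  have hbound : ∀ t ∈ Set.Icc (0 : ℝ) 1, ‖d' t‖ ≤ K * ‖d t‖ + η * ‖h‖ * C := by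
    intro t ht
    have hnx : ‖t • x‖ ≤ ‖x‖ := by
      rw [norm_smul, Real.norm_eq_abs, abs_of_nonneg ht.1]
      exact mul_le_of_le_one_left (norm_nonneg _) ht.2
    have hnh : ‖t • h‖ ≤ ‖h‖ := by
      rw [norm_smul, Real.norm_eq_abs, abs_of_nonneg ht.1]
      exact mul_le_of_le_one_left (norm_nonneg _) ht.2
    obtain ⟨h1, h2⟩ := H (t • x) (t • h) hnx (hnh.trans_lt hhδ)
    rw [← smul_add, map_smul] at h2
    rw [← smul_add] at h1
    set A₀ := A (t • x) with hA₀
    set A₁ := A (t • (x + h)) with hA₁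
    set D := fderiv ℝ A (t • x) with hD
    have hA₀M : ‖A₀‖ ≤ M := hMA _ (by linarith)
    have hA₁M : ‖A₁‖ ≤ M := hMA _ (by
      rw [smul_add]
      exact (norm_add_le _ _).trans (by linarith))
    set w := y x t with hw
    have hwN : ‖w‖ ≤ N := hNy t ht
    -- Flatness exchanges the directions x and h in the derivative of A, so that D h x matches the
    -- first order change of A. What remains besides the linear term in d is O(η‖h‖), and Gronwall
    -- makes d(1) = o(‖h‖).
    have hdec : d' t = A₁ (x + h) (d t) + ((A₁ - A₀ - t • D h) x w + (A₁ - A₀) h w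
        + t • (A₁ - A₀) x (A₀ h w) + t • A₁ h (A₀ h w)) := by
      have hf := hflat (t • x) x h w
      rw [← hA₀, ← hD] at hf
      simp only [hd, hd', ← hA₀, ← hA₁, ← hD, ← hw]
      rw [hf]
      simp only [map_add, map_sub, map_smul, _root_.add_apply, _root_.sub_apply,
        _root_.smul_apply, smul_sub, smul_add]
      abel
    have b0 : ∀ (P : E →L[ℝ] F →L[ℝ] F) (a : E) (z : F) (p q r : ℝ), ‖P‖ ≤ p → ‖a‖ ≤ q → ‖z‖ ≤ r →
        ‖P a z‖ ≤ p * q * r := by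
      intro P a z p q r hp hq hr
      have hp0 := (norm_nonneg P).trans hp
      have hq0 := (norm_nonneg a).trans hq
      refine (P.le_opNorm₂ a z).trans ?_
      gcongr
    have b1 : ‖A₁ (x + h) (d t)‖ ≤ M * (‖x‖ + 1) * ‖d t‖ :=
      b0 _ _ _ _ _ _ hA₁M ((norm_add_le _ _).trans (by linarith)) le_rfl
    have b2 : ‖(A₁ - A₀ - t • D h) x w‖ ≤ (η * ‖h‖) * ‖x‖ * N :=
      b0 _ _ _ _ _ _ (h2.trans (by gcongr)) le_rfl hwN
    have b3 : ‖(A₁ - A₀) h w‖ ≤ η * ‖h‖ * N := b0 _ _ _ _ _ _ h1 le_rfl hwN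
    have b4 : ‖A₀ h w‖ ≤ M * ‖h‖ * N := b0 _ _ _ _ _ _ hA₀M le_rfl hwN
    have bt : ∀ z : F, ‖t • z‖ ≤ ‖z‖ := by
      intro z
      rw [norm_smul, Real.norm_eq_abs, abs_of_nonneg ht.1]
      exact mul_le_of_le_one_left (norm_nonneg _) ht.2
    have b5 : ‖t • (A₁ - A₀) x (A₀ h w)‖ ≤ η * ‖x‖ * (M * ‖h‖ * N) :=
      (bt _).trans (b0 _ _ _ _ _ _ h1 le_rfl b4)
    have b6 : ‖t • A₁ h (A₀ h w)‖ ≤ M * η * (M * ‖h‖ * N) :=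
      (bt _).trans (b0 _ _ _ _ _ _ hA₁M hhη.le b4)
    rw [hdec]
    refine (norm_add_le _ _).trans (add_le_add b1 ?_)
    refine (norm_add_le _ _).trans ((add_le_add ((norm_add_le _ _).trans
      (add_le_add ((norm_add_le _ _).trans (add_le_add b2 b3)) b5)) b6).trans (le_of_eq ?_))
    rw [hC]
    ring
  have hgr := norm_le_gronwallBound_of_norm_deriv_right_le (f := d) (f' := d') (δ := 0) (K := K)
    (ε := η * ‖h‖ * C) (a := 0) (b := 1)
    (fun t ht => (hderiv t ht).continuousAt.continuousWithinAt)
    (fun t ht => (hderiv t ⟨ht.1, ht.2.le⟩).hasDerivWithinAt)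
    (by simp [hd, hy0]) (fun t ht => hbound t ⟨ht.1, ht.2.le⟩) 1 (by simp)
  have hd1 : d 1 = y (x + h) 1 - y x 1 - (A x).flip (y x 1) h := by
    simp only [hd, one_smul, ContinuousLinearMap.flip_apply]
    abel
  rw [← hd1]
  refine hgr.trans ?_
  rw [gronwallBound_of_K_ne_0 (by linarith : K ≠ 0)]
  simp only [zero_mul, zero_add, sub_zero, mul_one]
  have e1 : η * ‖h‖ * C / K * (Real.exp K - 1) ≤ η * ‖h‖ * C * Real.exp K := by
    have h1 : 0 ≤ η * ‖h‖ * C := by positivity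
    have h2 : η * ‖h‖ * C / K ≤ η * ‖h‖ * C := div_le_self h1 hK1
    have h3 : 0 ≤ Real.exp K - 1 := by linarith [Real.add_one_le_exp K]
    exact mul_le_mul h2 (by linarith) h3 h1
  refine e1.trans (le_of_eq ?_)
  rw [hη]
  field_simp

end Frobenius

end

noncomputable section

/-! ### Uniqueness of parallel objects and parallel frames -/

section Uniqueness

variable {E F : Type*} [NormedAddCommGroup E] [NormedSpace ℝ E]
  [NormedAddCommGroup F] [NormedSpace ℝ F]

lemma eq_zero_of_norm_fderiv_le {Y : E → F} {Y' : E → E →L[ℝ] F} {C : E → ℝ} (hC : Continuous C)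
    (hY : ∀ x, HasFDerivAt Y (Y' x) x) (hle : ∀ x, ‖Y' x‖ ≤ C x * ‖Y x‖) (h0 : Y 0 = 0) (x : E) :
    Y x = 0 := by
  obtain ⟨K, hK⟩ := isCompact_Icc.exists_bound_of_continuousOn (s := Set.Icc (0 : ℝ) 1)
    (f := fun t : ℝ => C (t • x))
    (hC.comp (continuous_id.smul continuous_const)).continuousOn
  have hd : ∀ t : ℝ, HasDerivAt (fun s : ℝ => Y (s • x)) (Y' (t • x) x) t := by
    intro t
    have e : HasDerivAt (fun s : ℝ => s • x) x t := by
      simpa using (hasDerivAt_id t).smul_const x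
    exact (hY (t • x)).comp_hasDerivAt t e
  have h := eq_zero_of_abs_deriv_le_mul_abs_self_of_eq_zero_right
    (f := fun s : ℝ => Y (s • x)) (f' := fun t => Y' (t • x) x) (K := K * ‖x‖) (a := 0) (b := 1)
    (fun t _ => (hd t).continuousAt.continuousWithinAt) (fun t _ => (hd t).hasDerivWithinAt)
    (by simpa using h0) (fun t ht => by
      refine ((Y' (t • x)).le_opNorm x).trans ?_
      have h1 := hle (t • x)
      have h2 : C (t • x) ≤ K := (le_abs_self _).trans (hK t ⟨ht.1, ht.2.le⟩)
      have h3 := norm_nonneg (Y (t • x))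
      calc ‖Y' (t • x)‖ * ‖x‖ ≤ (C (t • x) * ‖Y (t • x)‖) * ‖x‖ := by gcongr
        _ ≤ (K * ‖Y (t • x)‖) * ‖x‖ := by gcongr
        _ = _ := by ring) 1 (by simp)
  simpa using h

end Uniqueness

section ParallelFrame

variable {E : Type*} [NormedAddCommGroup E] [NormedSpace ℝ E]

/-- Both sides are parallel for the translation invariant Γ and agree at x = 0. So J(c) is the
holonomy of the translation by c. -/
lemma parallel_frame_add {Γ : E → E →L[ℝ] E →L[ℝ] E} (hΓ : Continuous Γ) {J : E → E →L[ℝ] E}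
    (h0 : J 0 = ContinuousLinearMap.id ℝ E)
    (hJ : ∀ x, HasFDerivAt J (((ContinuousLinearMap.compL ℝ E E E) (J x)).comp (Γ x)) x) {c : E}
    (hc : ∀ x, Γ (x + c) = Γ x) (x : E) : J (x + c) = (J c).comp (J x) := by
  set L := ContinuousLinearMap.compL ℝ E E E with hL
  have h1 : ∀ x, HasFDerivAt (fun y => J (y + c) - L (J c) (J y))
      ((L (J (x + c) - L (J c) (J x))).comp (Γ x)) x := by
    intro x
    have e1 : HasFDerivAt (fun y => J (y + c)) ((L (J (x + c))).comp (Γ x)) x := by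
      have := hJ (x + c)
      rw [hc] at this
      exact (hasFDerivAt_comp_add_right c).2 this
    have e2 : HasFDerivAt (fun y => L (J c) (J y)) ((L (J c)).comp ((L (J x)).comp (Γ x))) x :=
      (L (J c)).hasFDerivAt.comp x (hJ x)
    refine (e1.sub e2).congr_fderiv ?_
    ext a z
    simp [hL]
  have hn : Continuous fun x => ‖Γ x‖ :=
    Continuous.norm (E := E →L[ℝ] E →L[ℝ] E) hΓ
  have h2 := eq_zero_of_norm_fderiv_le hn h1 (fun x => by
    refine (ContinuousLinearMap.opNorm_comp_le _ _).trans ?_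
    rw [mul_comm]
    gcongr
    refine (L.le_opNorm _).trans ?_
    exact mul_le_of_le_one_left (norm_nonneg _) (ContinuousLinearMap.norm_compL_le ℝ E E E))
    (by simp [h0, hL]) x
  exact sub_eq_zero.1 h2

set_option maxSynthPendingDepth 5 in
/-- A flat linear connection on the tangent bundle of a vector space has a parallel frame. -/
theorem exists_parallel_frame [ProperSpace E] [CompleteSpace E] {Γ : E → E →L[ℝ] E →L[ℝ] E}
    (hΓ : ContDiff ℝ 1 Γ)
    (hflat : ∀ x a b z, fderiv ℝ Γ x a b z + Γ x a (Γ x b z)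
      = fderiv ℝ Γ x b a z + Γ x b (Γ x a z)) :
    ∃ J : E → E →L[ℝ] E, J 0 = ContinuousLinearMap.id ℝ E ∧
      ∀ x, HasFDerivAt J (((ContinuousLinearMap.compL ℝ E E E) (J x)).comp (Γ x)) x := by
  -- The connection acts on endomorphisms Y by Y ∘ Γ(x, a). Composition on the right reverses the
  -- order, which accounts for the order of the products in the flatness hypothesis.
  set L := (ContinuousLinearMap.compL ℝ E E E).flip with hL
  set A : E → E →L[ℝ] (E →L[ℝ] E) →L[ℝ] (E →L[ℝ] E) := fun x => L.comp (Γ x) with hA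
  have hA1 : ContDiff ℝ 1 A := contDiff_const.clm_comp hΓ
  have hA2 : ∀ x a b Y, fderiv ℝ A x a b Y = Y.comp (fderiv ℝ Γ x a b) := by
    intro x a b Y
    have e1 := (hasFDerivAt_const L x).clm_comp (hΓ.differentiable one_ne_zero x).hasFDerivAt
    have e2 : fderiv ℝ A x = _ := e1.fderiv
    rw [e2]
    simp [hL]
  obtain ⟨J, hJ0, hJ⟩ := exists_parallel_section hA1 (fun x a b Y => by
    rw [hA2, hA2]
    ext1 Z
    simp only [hA, hL, ContinuousLinearMap.comp_apply, ContinuousLinearMap.flip_apply,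
      ContinuousLinearMap.compL_apply, _root_.add_apply]
    rw [← map_add, ← map_add, hflat]) (ContinuousLinearMap.id ℝ _)
  exact ⟨J, hJ0, hJ⟩

end ParallelFrame

lemma TorusPeriodic.exists_forall_le {n : ℕ} {f : (Fin n → ℝ) → ℝ} (hf : TorusPeriodic f)
    (hc : Continuous f) : ∃ x, ∀ y, f y ≤ f x := by
  obtain ⟨x, -, hx⟩ := (isCompact_closedBall (0 : Fin n → ℝ) (2 * Real.pi)).exists_isMaxOn
    (Metric.nonempty_closedBall.2 (by positivity)) hc.continuousOn
  refine ⟨x, fun y => ?_⟩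
  obtain ⟨z, hz, m, rfl⟩ := exists_mem_ball_of_torusPeriodic y
  have := hx hz
  simpa only [Set.mem_ofPred_eq, hf y m] using this

lemma deriv_deriv_nonpos_of_isLocalMax {f f' : ℝ → ℝ} {f'' t : ℝ} (h : IsLocalMax f t)
    (hf : ∀ s, HasDerivAt f (f' s) s) (hf' : HasDerivAt f' f'' t) : f'' ≤ 0 := by
  by_contra! hpos
  have e1 : deriv f = f' := funext fun s => (hf s).deriv
  have h0 : f' t = 0 := h.hasDerivAt_eq_zero (hf t)
  have hmin : IsLocalMin f t := isLocalMin_of_deriv_deriv_pos (by rwa [e1, hf'.deriv])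
    (by rw [e1, h0]) (hf t).continuousAt
  have hconst : f =ᶠ[nhds t] fun _ => f t := by
    filter_upwards [h, hmin] with s h1 h2
    exact le_antisymm h1 h2
  have e2 : f' =ᶠ[nhds t] fun _ => 0 := by
    have := hconst.deriv
    rw [e1] at this
    simpa using this
  have e3 := e2.deriv_eq
  rw [hf'.deriv] at e3
  simp at e3
  exact hpos.ne' e3

lemma hasFDerivAt_bilin_apply {E F G H : Type*} [NormedAddCommGroup E] [NormedSpace ℝ E]
    [NormedAddCommGroup F] [NormedSpace ℝ F] [NormedAddCommGroup G] [NormedSpace ℝ G]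
    [NormedAddCommGroup H] [NormedSpace ℝ H] (B : F →L[ℝ] G →L[ℝ] H) {p : E → F} {q : E → G}
    {p' : E →L[ℝ] F} {q' : E →L[ℝ] G} {x : E} (hp : HasFDerivAt p p' x) (hq : HasFDerivAt q q' x) :
    HasFDerivAt (fun y => B (p y) (q y)) ((B (p x)).comp q' + (B.flip (q x)).comp p') x := by
  refine (B.hasFDerivAt_of_bilinear hp hq).congr_fderiv ?_
  ext a
  simp

/-! ### Developments of flat metrics and triviality of the holonomy -/

namespace TorusMetric

variable {n : ℕ} {g : TorusMetric n}

lemma fderiv_inner_eq (hg : g.IsOfClass 1) (x a X Y : Fin n → ℝ) :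
    fderiv ℝ (fun y => g.inner y X Y) x a
      = g.inner x (g.christoffelCLM x a X) Y + g.inner x X (g.christoffelCLM x a Y) := by
  have e : ∀ X Y, (fun y => g.inner y X Y) = fun y => g.inner y Y X := fun X Y =>
    funext fun y => g.inner_comm y X Y
  rw [g.inner_comm x _ Y, inner_christoffelCLM hg, inner_christoffelCLM hg, e Y X]
  ring

lemma christoffelCLM_add (g : TorusMetric n) (x : Fin n → ℝ) (m : Fin n → ℤ) :
    g.christoffelCLM (x + fun j => 2 * Real.pi * (m j : ℝ)) = g.christoffelCLM x := by
  have hp : ∀ i j, TorusPeriodic fun x => g.mat x i j := fun i j x m => by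
    simp only [g.periodic]
  ext X Y k
  simp only [christoffelCLM_apply, covDerivConst, christoffel, partialDeriv, g.periodic,
    (hp _ _).fderiv x m]

/-- A parallel frame of a flat metric, as a field of linear maps. -/
structure IsDevelopment (g : TorusMetric n) (J : (Fin n → ℝ) → (Fin n → ℝ) →L[ℝ] (Fin n → ℝ)) :
    Prop where
  zero : J 0 = ContinuousLinearMap.id ℝ _
  hasFDerivAt : ∀ x, HasFDerivAt J
    (((ContinuousLinearMap.compL ℝ (Fin n → ℝ) (Fin n → ℝ) (Fin n → ℝ)) (J x)).comp
      (g.christoffelCLM x)) x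

theorem exists_isDevelopment (hg : g.IsOfClass 2) (he : g.IsEuclidean) :
    ∃ J, g.IsDevelopment J := by
  obtain ⟨J, hJ0, hJ⟩ := exists_parallel_frame (contDiff_christoffelCLM hg) fun x a b Z => by
    have h := (isEuclidean_iff hg).1 he x a b Z
    simp only [curvatureCLM] at h
    rw [← sub_eq_zero, ← h]
    abel
  exact ⟨J, hJ0, hJ⟩

namespace IsDevelopment

variable {J : (Fin n → ℝ) → (Fin n → ℝ) →L[ℝ] (Fin n → ℝ)}

lemma differentiable (hJ : g.IsDevelopment J) : Differentiable ℝ J :=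
  fun x => (hJ.hasFDerivAt x).differentiableAt

lemma continuous (hJ : g.IsDevelopment J) : Continuous J := hJ.differentiable.continuous

lemma fderiv_apply (hJ : g.IsDevelopment J) (x a X : Fin n → ℝ) :
    fderiv ℝ J x a X = J x (g.christoffelCLM x a X) := by
  rw [(hJ.hasFDerivAt x).fderiv]
  rfl

lemma fderiv_symm (hJ : g.IsDevelopment J) (x a b : Fin n → ℝ) :
    fderiv ℝ J x a b = fderiv ℝ J x b a := by
  rw [hJ.fderiv_apply, hJ.fderiv_apply, christoffelCLM_comm]

lemma contDiff (hJ : g.IsDevelopment J) (hg : g.IsOfClass 2) : ContDiff ℝ 2 J := by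
  have hΓ := contDiff_christoffelCLM hg
  have e : fderiv ℝ J = fun x => ((ContinuousLinearMap.compL ℝ (Fin n → ℝ) (Fin n → ℝ)
      (Fin n → ℝ)) (J x)).comp (g.christoffelCLM x) := funext fun x => (hJ.hasFDerivAt x).fderiv
  have h1 : ContDiff ℝ 1 J := by
    rw [contDiff_one_iff_fderiv]
    refine ⟨hJ.differentiable, ?_⟩
    rw [e]
    exact ((ContinuousLinearMap.continuous _).comp hJ.continuous).clm_comp hΓ.continuous
  have h2 : ContDiff ℝ (1 + 1) J := by
    rw [contDiff_succ_iff_fderiv]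
    refine ⟨hJ.differentiable, by simp, ?_⟩
    rw [e]
    exact ((ContinuousLinearMap.contDiff _).comp h1).clm_comp hΓ
  simpa [one_add_one_eq_two] using h2

/-- Both g and the pullback by J of its value at 0 are parallel and they agree at 0; the difference
satisfies a linear differential inequality and so vanishes. -/
lemma inner_eq (hJ : g.IsDevelopment J) (hg : g.IsOfClass 2) (x X Y : Fin n → ℝ) :
    g.inner x X Y = g.inner 0 (J x X) (J x Y) := by
  have hg1 : g.IsOfClass 1 := fun i j => (hg i j).of_le one_le_two
  set T : (Fin n → ℝ) → (Fin n → ℝ) →L[ℝ] (Fin n → ℝ) →L[ℝ] ℝ := fun x =>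
    g.innerCLM x - (g.innerCLM 0).bilinearComp (J x) (J x) with hT
  have hTa : ∀ x X Y, T x X Y = g.inner x X Y - g.inner 0 (J x X) (J x Y) := by
    intro x X Y
    simp [hT]
  have hd : ∀ x a X Y, HasFDerivAt (fun y => T y X Y) (fderiv ℝ (fun y => T y X Y) x) x ∧
      fderiv ℝ (fun y => T y X Y) x a
        = T x (g.christoffelCLM x a X) Y + T x X (g.christoffelCLM x a Y) := by
    intro x a X Y
    have e1 : ∀ X, HasFDerivAt (fun y => J y X) ((fderiv ℝ J x).flip X) x := by
      intro X
      have := (hJ.differentiable x).hasFDerivAt.clm_apply (hasFDerivAt_const X x)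
      simpa using this
    have e2 := hasFDerivAt_bilin_apply (g.innerCLM 0) (e1 X) (e1 Y)
    have e3 := ((contDiff_inner hg1 X Y).differentiable one_ne_zero x).hasFDerivAt.sub e2
    have e4 : (fun y => T y X Y) = (fun x => g.inner x X Y) - fun y => (g.innerCLM 0) (J y X) (J y Y) :=
      funext fun y => by simp [hT]
    rw [e4, e3.fderiv]
    refine ⟨e3, ?_⟩
    rw [_root_.sub_apply, fderiv_inner_eq hg1]
    simp only [_root_.add_apply, ContinuousLinearMap.comp_apply, ContinuousLinearMap.flip_apply,
      hJ.fderiv_apply, hTa, innerCLM_apply]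
    ring
  have hTd : Differentiable ℝ T := fun x => by
    have : ContDiff ℝ 1 T := by
      refine contDiff_clm_apply₂_iff.2 fun X Y => ?_
      have hJ1 : ContDiff ℝ 1 J := (hJ.contDiff hg).of_le one_le_two
      simp only [hTa]
      refine (contDiff_inner hg1 X Y).sub ?_
      simp only [← innerCLM_apply]
      exact (contDiff_const.clm_apply (hJ1.clm_apply contDiff_const)).clm_apply
        (hJ1.clm_apply contDiff_const)
    exact this.differentiable one_ne_zero x
  have hΓ := contDiff_christoffelCLM hg
  have hn : Continuous fun x => 2 * ‖g.christoffelCLM x‖ :=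
    continuous_const.mul
      (Continuous.norm (E := (Fin n → ℝ) →L[ℝ] (Fin n → ℝ) →L[ℝ] (Fin n → ℝ)) hΓ.continuous)
  have h0 := eq_zero_of_norm_fderiv_le (Y := T) (Y' := fderiv ℝ T) hn (fun x => (hTd x).hasFDerivAt)
    (fun x => by
      refine ContinuousLinearMap.opNorm_le_bound _ (by positivity) fun a =>
        ContinuousLinearMap.opNorm_le_bound _ (by positivity) fun X =>
        ContinuousLinearMap.opNorm_le_bound _ (by positivity) fun Y => ?_
      rw [← fderiv_clm_apply₂_const (hTd x), (hd x a X Y).2]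
      have b1 : ‖T x (g.christoffelCLM x a X) Y‖
          ≤ ‖T x‖ * (‖g.christoffelCLM x‖ * ‖a‖ * ‖X‖) * ‖Y‖ :=
        ((T x).le_opNorm₂ _ _).trans (by
          gcongr
          exact (g.christoffelCLM x).le_opNorm₂ a X)
      have b2 : ‖T x X (g.christoffelCLM x a Y)‖
          ≤ ‖T x‖ * ‖X‖ * (‖g.christoffelCLM x‖ * ‖a‖ * ‖Y‖) :=
        ((T x).le_opNorm₂ _ _).trans (by
          gcongr
          exact (g.christoffelCLM x).le_opNorm₂ a Y)
      refine (norm_add_le _ _).trans ((add_le_add b1 b2).trans (le_of_eq ?_))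
      ring) (by
      ext X Y
      simp [hTa, hJ.zero]) x
  have := hTa x X Y
  rw [h0] at this
  exact (sub_eq_zero.1 this.symm)

lemma injective (hJ : g.IsDevelopment J) (hg : g.IsOfClass 2) (x : Fin n → ℝ)
    {X : Fin n → ℝ} (h : J x X = 0) : X = 0 := by
  by_contra hX
  have h1 := g.inner_self_pos x hX
  rw [hJ.inner_eq hg, h, ← innerCLM_apply, map_zero] at h1
  exact lt_irrefl _ h1

lemma surjective (hJ : g.IsDevelopment J) (hg : g.IsOfClass 2) (x : Fin n → ℝ) :
    Function.Surjective (J x) := by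
  have h : Function.Injective (J x : (Fin n → ℝ) →ₗ[ℝ] (Fin n → ℝ)) := by
    rw [injective_iff_map_eq_zero]
    exact fun X hX => hJ.injective hg x hX
  exact LinearMap.injective_iff_surjective.1 h

lemma apply_add (hJ : g.IsDevelopment J) (hg : g.IsOfClass 2) (x : Fin n → ℝ) (m : Fin n → ℤ) :
    J (x + fun j => 2 * Real.pi * (m j : ℝ)) = (J fun j => 2 * Real.pi * (m j : ℝ)).comp (J x) :=
  parallel_frame_add (contDiff_christoffelCLM hg).continuous hJ.zero hJ.hasFDerivAt
    (fun x => g.christoffelCLM_add x m) x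

lemma inner_zero_apply (hJ : g.IsDevelopment J) (hg : g.IsOfClass 2) (m : Fin n → ℤ)
    (X Y : Fin n → ℝ) : g.inner 0 (J (fun j => 2 * Real.pi * (m j : ℝ)) X)
      (J (fun j => 2 * Real.pi * (m j : ℝ)) Y) = g.inner 0 X Y := by
  rw [← hJ.inner_eq hg]
  have := g.periodic 0 m
  rw [zero_add] at this
  simp only [inner, this]

/-- The holonomy of a flat metric on the torus is trivial. -/
theorem torusPeriodic (hJ : g.IsDevelopment J) (hg : g.IsOfClass 2) : TorusPeriodic J := by
  -- The developing map: J is closed because the Levi-Civita connection is torsion free.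
  obtain ⟨Φ, hΦ⟩ := Convex.exists_forall_hasFDerivAt_of_fderiv_symmetric convex_univ isOpen_univ
    hJ.differentiable.differentiableOn fun x _ a b => hJ.fderiv_symm x a b
  replace hΦ : ∀ x, HasFDerivAt Φ (J x) x := fun x => hΦ x (Set.mem_univ x)
  intro x₀ m
  set c : Fin n → ℝ := fun j => 2 * Real.pi * (m j : ℝ) with hc
  set R := J c with hR
  -- The displacement of the deck translation by c, seen in the Euclidean space; its derivative is
  -- (R - 1) J.
  set Ψ : (Fin n → ℝ) → (Fin n → ℝ) := fun x => Φ (x + c) - Φ x with hΨ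
  set D : (Fin n → ℝ) → (Fin n → ℝ) →L[ℝ] (Fin n → ℝ) := fun x => R.comp (J x) - J x with hD
  have hΨd : ∀ x, HasFDerivAt Ψ (D x) x := by
    intro x
    have e1 := (hasFDerivAt_comp_add_right c).2 (hΦ (x + c))
    rw [hJ.apply_add hg] at e1
    exact e1.sub (hΦ x)
  have hDd : ∀ x X, ∃ A : (Fin n → ℝ) →L[ℝ] (Fin n → ℝ), HasFDerivAt (fun y => D y X) A x ∧
      ∀ a, A a = D x (g.christoffelCLM x a X) := by
    intro x X
    have e1 : HasFDerivAt (fun y => J y X) ((fderiv ℝ J x).flip X) x := by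
      have := (hJ.differentiable x).hasFDerivAt.clm_apply (hasFDerivAt_const X x)
      simpa using this
    refine ⟨_, (R.hasFDerivAt.comp x e1).sub e1, fun a => ?_⟩
    simp [hD, hJ.fderiv_apply]
  -- Translations commute, and under c' the developing map changes by the isometry J(c') up to a
  -- constant; so Ψ(x + c') = J(c') Ψ(x).
  have hper : TorusPeriodic fun x => g.inner 0 (Ψ x) (Ψ x) := by
    intro x m'
    set c' : Fin n → ℝ := fun j => 2 * Real.pi * (m' j : ℝ) with hc'
    have e1 : ∀ x, HasFDerivAt (fun x => Φ (x + c') - J c' (Φ x))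
        (0 : (Fin n → ℝ) →L[ℝ] (Fin n → ℝ)) x := by
      intro x
      have e1 := (hasFDerivAt_comp_add_right c').2 (hΦ (x + c'))
      rw [hJ.apply_add hg] at e1
      have e2 := e1.sub ((J c').hasFDerivAt.comp x (hΦ x))
      rwa [sub_self] at e2
    have e2 := is_const_of_fderiv_eq_zero (fun x => (e1 x).differentiableAt)
      (fun x => (e1 x).fderiv) (x + c) x
    have e3 : Ψ (x + c') = J c' (Ψ x) := by
      simp only [hΨ, map_sub]
      rw [add_right_comm]
      rw [sub_eq_sub_iff_sub_eq_sub] at e2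
      exact e2
    simp only
    rw [e3, hJ.inner_zero_apply hg]
  set b := g.innerCLM 0 with hb
  have hcont : Continuous fun x => g.inner 0 (Ψ x) (Ψ x) := by
    have h1 : Continuous Ψ := continuous_iff_continuousAt.2 fun x => (hΨd x).continuousAt
    simp only [← innerCLM_apply]
    exact (b.continuous.comp h1).clm_apply h1
  obtain ⟨x, hx⟩ := hper.exists_forall_le hcont
  have hline : ∀ (a : Fin n → ℝ) (t : ℝ), HasDerivAt (fun s : ℝ => x + s • a) a t := by
    intro a t
    simpa using ((hasDerivAt_id t).smul_const a).const_add x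
  have h1 : ∀ (a : Fin n → ℝ) (t : ℝ), HasDerivAt (fun s : ℝ => b (Ψ (x + s • a)) (Ψ (x + s • a)))
      (2 * b (Ψ (x + t • a)) (D (x + t • a) a)) t := by
    intro a t
    have e := (hasFDerivAt_bilin_apply b (hΨd (x + t • a)) (hΨd (x + t • a))).comp_hasDerivAt t
      (hline a t)
    refine e.congr_deriv ?_
    simp only [_root_.add_apply, ContinuousLinearMap.comp_apply, ContinuousLinearMap.flip_apply]
    rw [hb, innerCLM_apply, innerCLM_apply, g.inner_comm 0 (D _ _)]
    ring
  have hmax : ∀ a : Fin n → ℝ,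
      IsLocalMax (fun s : ℝ => b (Ψ (x + s • a)) (Ψ (x + s • a))) 0 := by
    intro a
    refine Eventually.of_forall fun s => ?_
    simp only [hb, innerCLM_apply, zero_smul, add_zero]
    exact hx _
  have h2 : ∀ a : Fin n → ℝ, b (Ψ x) (D x a) = 0 := by
    intro a
    have := (hmax a).hasDerivAt_eq_zero (h1 a 0)
    simpa using this
  -- At the maximum, half the second derivative along a is ⟨Ψ, D(Γ(a, a))⟩ + |D a|². The first term
  -- vanishes by criticality in the direction Γ(a, a), so |D a|² ≤ 0.
  have h3 : ∀ a : Fin n → ℝ, D x a = 0 := by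
    intro a
    obtain ⟨A, hA, hA'⟩ := hDd x a
    have e1 : HasDerivAt (fun s : ℝ => 2 * b (Ψ (x + s • a)) (D (x + s • a) a))
        (2 * (b (Ψ x) (A a) + b (D x a) (D x a))) 0 := by
      have e0 := hline a 0
      have e2 := hasFDerivAt_bilin_apply b (hΨd x) hA
      rw [show x = x + (0 : ℝ) • a by simp] at e2
      have e3 := (e2.comp_hasDerivAt (0 : ℝ) e0).const_mul 2
      refine e3.congr_deriv ?_
      simp
    have e2 := deriv_deriv_nonpos_of_isLocalMax (hmax a) (h1 a) e1
    rw [hA', h2, zero_add] at e2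
    by_contra hne
    have := g.inner_self_pos 0 hne
    rw [hb, innerCLM_apply] at e2
    linarith
  have h4 : ∀ z, R z = z := by
    intro z
    obtain ⟨a, rfl⟩ := hJ.surjective hg x z
    exact sub_eq_zero.1 (h3 a)
  rw [hJ.apply_add hg]
  ext1 z
  exact h4 _

end IsDevelopment

end TorusMetric

end

noncomputable section

/-! ### The null Lagrangian and rigidity of conformal frames along the leaves -/

section ConformalPair

variable {V : Type*} [NormedAddCommGroup V] [NormedSpace ℝ V]

/-- The infinitesimal conformal structure of a pair of orthogonal vectors of the same length: the
null Lagrangian of the derivatives controls the derivatives. -/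
lemma nullLagrangian_conformalPair {B : V →L[ℝ] V →L[ℝ] ℝ} (hB : ∀ x y, B x y = B y x) {k a b : ℝ}
    (hk : 0 < k) (ha : 0 < a) {α γ αu αv γu γv : V} (h1 : B α α = k) (h2 : B γ γ = k)
    (h3 : B α γ = 0) (hαu : ∃ s t : ℝ, αu = s • α + t • γ) (hαv : ∃ s t : ℝ, αv = s • α + t • γ)
    (hγu : ∃ s t : ℝ, γu = s • α + t • γ) (hγv : ∃ s t : ℝ, γv = s • α + t • γ)
    (hu1 : B αu α = B γu γ) (hv1 : B αv α = B γv γ) (hu2 : B αu γ + B α γu = 0)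
    (hv2 : B αv γ + B α γv = 0) (hc : a • αv - b • αu = γu) :
    0 ≤ B αv γu - B αu γv ∧
      (B αv γu - B αu γv = 0 → αu = 0 ∧ αv = 0 ∧ γu = 0 ∧ γv = 0) := by
  obtain ⟨p, q, rfl⟩ := hαu
  obtain ⟨r, s, rfl⟩ := hαv
  obtain ⟨p', q', rfl⟩ := hγu
  obtain ⟨r', s', rfl⟩ := hγv
  have h3' : B γ α = 0 := by rw [hB, h3]
  have hc1 := congrArg (fun z => B z α) hc
  have hc2 := congrArg (fun z => B z γ) hc
  simp only [map_add, map_sub, map_smul, _root_.add_apply, _root_.sub_apply, _root_.smul_apply,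
    smul_eq_mul, h1, h2, h3, h3'] at hu1 hv1 hu2 hv2 hc1 hc2 ⊢
  have e1 : p = q' := mul_right_cancel₀ hk.ne' (by linarith)
  have e2 : r = s' := mul_right_cancel₀ hk.ne' (by linarith)
  have e3 : p' = -q := mul_right_cancel₀ hk.ne' (by linarith)
  have e4 : r' = -s := mul_right_cancel₀ hk.ne' (by linarith)
  have e5 : a * r - b * p = p' := mul_right_cancel₀ hk.ne' (by linarith)
  have e6 : a * s - b * q = q' := mul_right_cancel₀ hk.ne' (by linarith)
  subst e1 e2 e3 e4
  -- Conformality makes the derivatives of the pair complex multiples p + iq and r + is of it, and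
  -- the null Lagrangian is 2k (sp - rq). The relation `hc` links the two multiples and makes this
  -- expression positive definite in (p, q).
  have key : a * (s * p - r * q) = p ^ 2 + q ^ 2 := by
    linear_combination p * e6 - q * e5
  have hN : ∀ N, N = 2 * k * (s * p - r * q) → 0 ≤ N ∧
      (N = 0 → p = 0 ∧ q = 0) := by
    rintro N rfl
    constructor
    · have : 0 ≤ s * p - r * q := by
        by_contra! hneg
        nlinarith [sq_nonneg p, sq_nonneg q]
      positivity
    · intro h0
      have h4 : s * p - r * q = 0 := by
        rcases mul_eq_zero.1 h0 with h | h
        · linarith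
        · exact h
      rw [h4, mul_zero] at key
      constructor <;> nlinarith [sq_nonneg p, sq_nonneg q]
  obtain ⟨hN1, hN2⟩ := hN _ rfl
  constructor
  · refine hN1.trans_eq ?_
    ring
  · intro h0
    obtain ⟨rfl, rfl⟩ := hN2 (by rw [← h0]; ring)
    have hr : r = 0 := by
      have : a * r = 0 := by linarith
      exact (mul_eq_zero.1 this).resolve_left ha.ne'
    have hs : s = 0 := by
      have : a * s = 0 := by linarith
      exact (mul_eq_zero.1 this).resolve_left ha.ne'
    subst hr hs
    simp

end ConformalPair

namespace LeafCoframe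

variable {n : ℕ} {u v : Fin n → ℝ} (c : LeafCoframe u v)

/-- The complex form `((1 + a) σ + b τ) + i τ` along the leaves. -/
def stretchForm (a b : (Fin n → ℝ) → ℝ) (x : Fin n → ℝ) : (Fin n → ℝ) →L[ℝ] ℂ :=
  c.fst.smulRight ((1 + a x : ℝ) : ℂ) + c.snd.smulRight (⟨b x, 1⟩ : ℂ)

variable {a b : (Fin n → ℝ) → ℝ}

lemma stretchForm_re (x X : Fin n → ℝ) :
    (c.stretchForm a b x X).re = (1 + a x) * c.fst X + b x * c.snd X := by
  simp [stretchForm]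
  ring

lemma stretchForm_im (x X : Fin n → ℝ) : (c.stretchForm a b x X).im = c.snd X := by
  simp [stretchForm]

lemma torusPeriodic_stretchForm (ha : TorusPeriodic a) (hb : TorusPeriodic b) :
    TorusPeriodic (c.stretchForm a b) := by
  intro x m
  simp only [stretchForm, ha x m, hb x m]

lemma nondegenerate_stretchForm (ha : ∀ x, 0 < 1 + a x) (x : Fin n → ℝ) :
    c.Nondegenerate (c.stretchForm a b x) := by
  intro s t h
  have h1 := congrArg Complex.im h
  have h2 := congrArg Complex.re h
  simp only [Complex.add_im, Complex.smul_im, Complex.add_re, Complex.smul_re, stretchForm_re,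
    stretchForm_im, c.fst_u, c.fst_v, c.snd_u, c.snd_v, smul_eq_mul, Complex.zero_im,
    Complex.zero_re] at h1 h2
  have ht : t = 0 := by linarith
  subst ht
  have : s * (1 + a x) = 0 := by linarith
  exact ⟨(mul_eq_zero.1 this).resolve_right (ha x).ne', rfl⟩

lemma contDiff_stretchForm {r : WithTop ℕ∞} (ha : ContDiff ℝ r a) (hb : ContDiff ℝ r b) :
    ContDiff ℝ r (c.stretchForm a b) := by
  rw [contDiff_clm_apply_iff]
  intro X
  have h : ContDiff ℝ r fun x => ((1 + a x) * c.fst X + b x * c.snd X, c.snd X) :=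
    (((contDiff_const.add ha).mul contDiff_const).add (hb.mul contDiff_const)).prodMk contDiff_const
  have e : (fun x => c.stretchForm a b x X) = fun x => Complex.equivRealProdCLM.symm
      ((1 + a x) * c.fst X + b x * c.snd X, c.snd X) := by
    funext x
    refine Complex.ext ?_ ?_
    · rw [stretchForm_re]
      simp
    · rw [stretchForm_im]
      simp
  rw [e]
  exact Complex.equivRealProdCLM.symm.contDiff.comp h

/-- A Euclidean uniformization of the metric given by a leafwise closed real stretching has a
periodic parallel frame, and the image in it of the orthonormal frame of the leaves is constant
along the leaves. -/
theorem exists_leafwise_constant_frame (ha : ContDiff ℝ 2 a) (hb : ContDiff ℝ 2 b)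
    (hap : TorusPeriodic a) (hbp : TorusPeriodic b) (ha0 : ∀ x, 0 < 1 + a x)
    (hab : ∀ x, fderiv ℝ a x v = fderiv ℝ b x u) {h : TorusMetric n} (hh : h.IsOfClass 2)
    (hu : h.IsEuclideanUniformization (c.metric (c.stretchForm a b)
      (c.torusPeriodic_stretchForm hap hbp) (c.nondegenerate_stretchForm ha0))
      (Submodule.span ℝ {u, v})) :
    ∃ (J : (Fin n → ℝ) → (Fin n → ℝ) →L[ℝ] (Fin n → ℝ)) (α γ : (Fin n → ℝ) → (Fin n → ℝ)),
      h.IsDevelopment J ∧ TorusPeriodic α ∧ TorusPeriodic γ ∧ ContDiff ℝ 2 α ∧ ContDiff ℝ 2 γ ∧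
      (∀ x, J x u = (1 + a x) • α x) ∧ (∀ x, J x v = γ x + b x • α x) ∧
      (∀ x, h.inner 0 (α x) (α x) = h.inner 0 (γ x) (γ x)) ∧
      ∀ x, fderiv ℝ α x u = 0 ∧ fderiv ℝ α x v = 0 ∧ fderiv ℝ γ x u = 0 ∧ fderiv ℝ γ x v = 0 := by
  obtain ⟨hE, hT, hC⟩ := hu
  obtain ⟨J, hJ⟩ := TorusMetric.exists_isDevelopment hh hE
  have hJp := hJ.torusPeriodic hh
  have hJ2 := hJ.contDiff hh
  set B := h.innerCLM 0 with hB
  have hBs : ∀ X Y, B X Y = B Y X := fun X Y => by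
    rw [hB, TorusMetric.innerCLM_apply, TorusMetric.innerCLM_apply, h.inner_comm]
  -- The form takes the values 1 + a and b + i on u and v, so u / (1 + a) and v - b u / (1 + a) are
  -- orthonormal; α and γ are their images under J.
  set α : (Fin n → ℝ) → (Fin n → ℝ) := fun x => (1 + a x)⁻¹ • J x u with hα
  set γ : (Fin n → ℝ) → (Fin n → ℝ) := fun x => J x v - b x • α x with hγ
  have hα2 : ContDiff ℝ 2 α := ((contDiff_const.add ha).inv fun x => (ha0 x).ne').smul
    (hJ2.clm_apply contDiff_const)
  have hγ2 : ContDiff ℝ 2 γ := (hJ2.clm_apply contDiff_const).sub (hb.smul hα2)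
  have hαp : TorusPeriodic α := fun x m => by simp only [hα, hap x m, hJp x m]
  have hγp : TorusPeriodic γ := fun x m => by simp only [hγ, hbp x m, hJp x m, hαp x m]
  have hJu : ∀ x, J x u = (1 + a x) • α x := fun x => by
    simp only [hα, smul_smul, mul_inv_cancel₀ (ha0 x).ne', one_smul]
  have hJv : ∀ x, J x v = γ x + b x • α x := fun x => by simp [hγ]
  have hαd : ∀ x, HasFDerivAt α (fderiv ℝ α x) x := fun x =>
    (hα2.differentiable two_ne_zero x).hasFDerivAt
  have hγd : ∀ x, HasFDerivAt γ (fderiv ℝ γ x) x := fun x =>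
    (hγ2.differentiable two_ne_zero x).hasFDerivAt
  have had : ∀ x, HasFDerivAt a (fderiv ℝ a x) x := fun x =>
    (ha.differentiable two_ne_zero x).hasFDerivAt
  have hbd : ∀ x, HasFDerivAt b (fderiv ℝ b x) x := fun x =>
    (hb.differentiable two_ne_zero x).hasFDerivAt
  have hdu : ∀ x X, J x (h.christoffelCLM x X u)
      = (1 + a x) • fderiv ℝ α x X + fderiv ℝ a x X • α x := by
    intro x X
    have e : HasFDerivAt (fun y => (1 + a y) • α y) _ x := ((had x).const_add 1).smul (hαd x)
    rw [← hJ.fderiv_apply, ← fderiv_clm_apply_const (hJ.differentiable x),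
      show (fun y => J y u) = fun y => (1 + a y) • α y from funext hJu, e.fderiv]
    rfl
  have hdv : ∀ x X, J x (h.christoffelCLM x X v)
      = fderiv ℝ γ x X + (b x • fderiv ℝ α x X + fderiv ℝ b x X • α x) := by
    intro x X
    have e : HasFDerivAt (fun y => γ y + b y • α y) _ x := (hγd x).add ((hbd x).smul (hαd x))
    rw [← hJ.fderiv_apply, ← fderiv_clm_apply_const (hJ.differentiable x),
      show (fun y => J y v) = fun y => γ y + b y • α y from funext hJv, e.fderiv]
    rfl
  have huP : u ∈ Submodule.span ℝ {u, v} := Submodule.subset_span (by simp)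
  have hvP : v ∈ Submodule.span ℝ {u, v} := Submodule.subset_span (by simp)
  have hspan : ∀ x X, X ∈ Submodule.span ℝ {u, v} → ∃ s t : ℝ, J x X = s • α x + t • γ x := by
    intro x X hX
    obtain ⟨s, t, rfl⟩ := Submodule.mem_span_pair.1 hX
    refine ⟨s * (1 + a x) + t * b x, t, ?_⟩
    rw [map_add, map_smul, map_smul, hJu, hJv]
    module
  have hΓ : ∀ x, ∀ X ∈ Submodule.span ℝ {u, v}, ∀ Y ∈ Submodule.span ℝ {u, v},
      h.christoffelCLM x X Y ∈ Submodule.span ℝ {u, v} := by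
    intro x X hX Y hY
    rw [TorusMetric.christoffelCLM_apply]
    exact hT x X hX Y hY
  -- Totally geodesic leaves: the image of the leaf plane under J, spanned by α and γ, does not turn
  -- along the leaves.
  have hαs : ∀ x, ∀ X ∈ Submodule.span ℝ {u, v}, ∃ s t : ℝ,
      fderiv ℝ α x X = s • α x + t • γ x := by
    intro x X hX
    obtain ⟨s, t, hst⟩ := hspan x _ (hΓ x X hX u huP)
    rw [hdu] at hst
    refine ⟨(1 + a x)⁻¹ * (s - fderiv ℝ a x X), (1 + a x)⁻¹ * t, ?_⟩
    have e : (1 + a x) • fderiv ℝ α x X = (s - fderiv ℝ a x X) • α x + t • γ x := by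
      rw [sub_smul, sub_add_eq_add_sub, ← hst, add_sub_cancel_right]
    rw [mul_smul, mul_smul, ← smul_add, ← e, smul_smul, inv_mul_cancel₀ (ha0 x).ne', one_smul]
  have hγs : ∀ x, ∀ X ∈ Submodule.span ℝ {u, v}, ∃ s t : ℝ,
      fderiv ℝ γ x X = s • α x + t • γ x := by
    intro x X hX
    obtain ⟨s, t, hst⟩ := hspan x _ (hΓ x X hX v hvP)
    obtain ⟨p, q, hpq⟩ := hαs x X hX
    rw [hdv, ← eq_sub_iff_add_eq] at hst
    refine ⟨s - b x * p - fderiv ℝ b x X, t - b x * q, ?_⟩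
    rw [hst, hpq]
    module
  -- Closedness of J says ∂_v(J u) = ∂_u(J v); the terms with derivatives of a and b cancel by the
  -- closedness of the stretching.
  have hclosed : ∀ x, (1 + a x) • fderiv ℝ α x v - b x • fderiv ℝ α x u = fderiv ℝ γ x u := by
    intro x
    have e := hdu x v
    rw [h.christoffelCLM_comm, hdv, hab] at e
    rw [sub_eq_iff_eq_add]
    have := add_right_cancel ((add_assoc _ _ _).trans e)
    exact this.symm
  have hBα : ∀ x, 0 < B (α x) (α x) ∧ B (γ x) (γ x) = B (α x) (α x) ∧ B (α x) (γ x) = 0 := by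
    intro x
    obtain ⟨k, hk, hk'⟩ := hC x
    have e1 := hk' u huP u huP
    have e2 := hk' u huP v hvP
    have e3 := hk' v hvP v hvP
    have e0 := (ha0 x).ne'
    simp only [c.inner_metric, leafInner, c.stretchForm_re, c.stretchForm_im, c.fst_u, c.fst_v,
      c.snd_u, c.snd_v, c.proj_u, c.proj_v, hJ.inner_eq hh x, hJu, hJv,
      ← TorusMetric.innerCLM_apply, zero_dotProduct, ← hB] at e1 e2 e3
    simp only [map_add, map_smul, _root_.add_apply, _root_.smul_apply, smul_eq_mul,
      hBs (γ x) (α x)] at e1 e2 e3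
    have f1 : B (α x) (α x) = k := by
      have : ((1 + a x) * (1 + a x)) * (B (α x) (α x) - k) = 0 := by linarith
      have := (mul_eq_zero.1 this).resolve_left (mul_ne_zero e0 e0)
      linarith
    rw [f1] at e2 e3 ⊢
    have f2 : B (α x) (γ x) = 0 := by
      have : (1 + a x) * B (α x) (γ x) = 0 := by linarith
      exact (mul_eq_zero.1 this).resolve_left e0
    rw [f2] at e3 ⊢
    exact ⟨hk, by linarith, rfl⟩
  have hbil : ∀ {p q : (Fin n → ℝ) → (Fin n → ℝ)} {x} (_ : DifferentiableAt ℝ p x)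
      (_ : DifferentiableAt ℝ q x) (X : Fin n → ℝ), fderiv ℝ (fun y => B (p y) (q y)) x X
        = B (p x) (fderiv ℝ q x X) + B (fderiv ℝ p x X) (q x) := by
    intro p q x hp hq X
    rw [(hasFDerivAt_bilin_apply B hp.hasFDerivAt hq.hasFDerivAt).fderiv]
    rfl
  have hr1 : ∀ x X, B (fderiv ℝ α x X) (α x) = B (fderiv ℝ γ x X) (γ x) := by
    intro x X
    have e1 := hbil (hαd x).differentiableAt (hαd x).differentiableAt X
    have e2 := hbil (hγd x).differentiableAt (hγd x).differentiableAt X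
    rw [show (fun y => B (γ y) (γ y)) = fun y => B (α y) (α y) from funext fun y => (hBα y).2.1,
      e1, hBs (α x), hBs (γ x)] at e2
    linarith
  have hr2 : ∀ x X, B (fderiv ℝ α x X) (γ x) + B (α x) (fderiv ℝ γ x X) = 0 := by
    intro x X
    have e1 := hbil (hαd x).differentiableAt (hγd x).differentiableAt X
    rw [show (fun y => B (α y) (γ y)) = fun y => 0 from funext fun y => (hBα y).2.2] at e1
    rw [fderiv_fun_const] at e1
    simp at e1
    linarith
  have hpair := fun x => nullLagrangian_conformalPair hBs (hBα x).1 (ha0 x) rfl (hBα x).2.1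
    (hBα x).2.2 (hαs x u huP) (hαs x v hvP) (hγs x u huP) (hγs x v hvP) (hr1 x u) (hr1 x v)
    (hr2 x u) (hr2 x v) (hclosed x)
  set N : (Fin n → ℝ) → ℝ := fun x =>
    B (fderiv ℝ α x v) (fderiv ℝ γ x u) - B (fderiv ℝ α x u) (fderiv ℝ γ x v) with hN
  have hα1 : ContDiff ℝ 1 (fderiv ℝ α) := hα2.fderiv_right (by norm_num)
  have hγ1 : ContDiff ℝ 1 (fderiv ℝ γ) := hγ2.fderiv_right (by norm_num)
  have hq : ∀ X, ContDiff ℝ 1 (fun x => B (α x) (fderiv ℝ γ x X)) := fun X =>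
    (contDiff_const.clm_apply (hα2.of_le one_le_two)).clm_apply (hγ1.clm_apply contDiff_const)
  have hqp : ∀ X, TorusPeriodic fun x => B (α x) (fderiv ℝ γ x X) := fun X x m => by
    simp only [hαp x m, hγp.fderiv x m]
  -- The second derivatives of γ cancel, so N is a divergence and its mean is zero; being
  -- nonnegative and continuous, it vanishes.
  have hNd : N = fun x => fderiv ℝ (fun x => B (α x) (fderiv ℝ γ x u)) x v
      - fderiv ℝ (fun x => B (α x) (fderiv ℝ γ x v)) x u := by
    funext x
    have hd : ∀ X, DifferentiableAt ℝ (fun y => fderiv ℝ γ y X) x := fun X =>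
      (hγ1.differentiable one_ne_zero x).clm_apply (differentiableAt_const X)
    rw [hbil (hαd x).differentiableAt (hd u), hbil (hαd x).differentiableAt (hd v),
      fderiv_clm_apply_const (hγ1.differentiable one_ne_zero x),
      fderiv_clm_apply_const (hγ1.differentiable one_ne_zero x),
      (hγ2.contDiffAt (x := x)).isSymmSndFDerivAt (by simp) u v]
    simp only [hN]
    ring
  have hNc : Continuous N := by
    have := hα1.continuous
    have := hγ1.continuous
    simp only [hN]
    fun_prop
  have hNp : TorusPeriodic N := fun x m => by
    simp only [hN, hαp.fderiv x m, hγp.fderiv x m]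
  have hmean : torusMean N = 0 := by
    rw [hNd, torusMean_sub ((hqp u).fderiv_apply v)
      (((hq u).continuous_fderiv one_ne_zero).clm_apply continuous_const)
      ((hqp v).fderiv_apply u)
      (((hq v).continuous_fderiv one_ne_zero).clm_apply continuous_const),
      torusMean_fderiv (hqp u) (hq u), torusMean_fderiv (hqp v) (hq v), sub_zero]
  have hN0 := hNp.eq_zero_of_torusMean_eq_zero hNc (fun x => (hpair x).1) hmean
  exact ⟨J, α, γ, hJ, hαp, hγp, hα2, hγ2, hJu, hJv, fun x => by
    have := (hBα x).2.1
    rw [hB, TorusMetric.innerCLM_apply, TorusMetric.innerCLM_apply] at this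
    exact this.symm, fun x => (hpair x).2 (hN0 x)⟩

end LeafCoframe

end

noncomputable section

variable {n : ℕ} {u v : Fin n → ℝ}

/-! ### Fourier coefficients of closed periodic frames -/

section Coordinates

/-- The Fourier coefficients of a component of a vector field. -/
def coordCoeff (p : (Fin n → ℝ) → (Fin n → ℝ)) (i : Fin n) : (Fin n → ℤ) → ℂ :=
  torusCoeff fun x => ((p x i : ℝ) : ℂ)

variable {p : (Fin n → ℝ) → (Fin n → ℝ)}

lemma TorusPeriodic.coord (hp : TorusPeriodic p) (i : Fin n) :
    TorusPeriodic fun x => ((p x i : ℝ) : ℂ) := fun x m => by simp only [hp x m]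

lemma ContDiff.coord {r : WithTop ℕ∞} (hp : ContDiff ℝ r p) (i : Fin n) :
    ContDiff ℝ r fun x => ((p x i : ℝ) : ℂ) :=
  Complex.ofRealCLM.contDiff.comp (contDiff_pi.1 hp i)

lemma coordCoeff_fderiv (hp : TorusPeriodic p) (hc : ContDiff ℝ 1 p) (i : Fin n) (X : Fin n → ℝ)
    (m : Fin n → ℤ) : coordCoeff (fun x => fderiv ℝ p x X) i m
      = Complex.I * intPairing m X * coordCoeff p i m := by
  have h := torusCoeff_fderiv (hp.coord i) (hc.coord i) X m
  rw [coordCoeff, coordCoeff, ← h]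
  congr 1
  funext x
  have h1 : HasFDerivAt (fun y => p y i) _ x :=
    hasFDerivAt_pi'.1 (hc.differentiable one_ne_zero x).hasFDerivAt i
  have h2 : HasFDerivAt (fun y => ((p y i : ℝ) : ℂ)) _ x := Complex.ofRealCLM.hasFDerivAt.comp x h1
  rw [h2.fderiv]
  rfl

lemma TorusPeriodic.eq_torusCoeff_zero {f : (Fin n → ℝ) → ℂ} (hf : TorusPeriodic f)
    (hc : Continuous f) (h : ∀ m, m ≠ 0 → torusCoeff f m = 0) (x : Fin n → ℝ) :
    f x = torusCoeff f 0 := by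
  have hs : Summable (torusCoeff f) :=
    summable_of_ne_finset_zero (s := {0}) fun m hm => h m (by simpa using hm)
  have h1 := congrFun (hf.torusSeries_torusCoeff hc hs) x
  rw [← h1, torusSeries, tsum_eq_single 0 fun m hm => by rw [h m hm, zero_mul]]
  simp [torusChar, intPairing]

lemma TorusPeriodic.eq_of_coordCoeff_eq_zero (hp : TorusPeriodic p) (hc : Continuous p)
    (h : ∀ i m, m ≠ 0 → coordCoeff p i m = 0) (x y : Fin n → ℝ) : p x = p y := by
  funext i
  have hc' : Continuous fun x => ((p x i : ℝ) : ℂ) :=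
    Complex.continuous_ofReal.comp ((continuous_apply i).comp hc)
  have h1 := (hp.coord i).eq_torusCoeff_zero hc' (h i)
  have h2 := (h1 x).trans (h1 y).symm
  exact_mod_cast h2

lemma coordCoeff_eq_zero_of_fderiv_eq_zero (hp : TorusPeriodic p) (hc : ContDiff ℝ 1 p)
    {X : Fin n → ℝ} (h : ∀ x, fderiv ℝ p x X = 0) {m : Fin n → ℤ} (hm : intPairing m X ≠ 0)
    (i : Fin n) : coordCoeff p i m = 0 := by
  have h1 := coordCoeff_fderiv hp hc i X m
  have h2 : coordCoeff (fun x => fderiv ℝ p x X) i m = 0 := by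
    simp [coordCoeff, h, torusCoeff, torusMean]
  rw [h2] at h1
  have h3 : Complex.I * (intPairing m X : ℂ) ≠ 0 :=
    mul_ne_zero Complex.I_ne_zero (by exact_mod_cast hm)
  exact (mul_eq_zero.1 h1.symm).resolve_left h3

lemma intPairing_single (m : Fin n → ℤ) (k : Fin n) : intPairing m (Pi.single k 1) = m k := by
  simp [intPairing, Pi.single_apply]

variable {J : (Fin n → ℝ) → (Fin n → ℝ) →L[ℝ] (Fin n → ℝ)}

/-- Closedness ∂_X(J Y) = ∂_Y(J X) on coefficients. Where (m, X) ≠ 0, it recovers the coefficient of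
J in every direction from the one along X. -/
lemma intPairing_mul_coordCoeff (hJp : TorusPeriodic J) (hJ : ContDiff ℝ 1 J)
    (hs : ∀ x a b, fderiv ℝ J x a b = fderiv ℝ J x b a) (X Y : Fin n → ℝ) (i : Fin n)
    (m : Fin n → ℤ) : intPairing m X * coordCoeff (fun x => J x Y) i m
      = intPairing m Y * coordCoeff (fun x => J x X) i m := by
  have hp : ∀ X, TorusPeriodic fun x => J x X := fun X x m => by simp only [hJp x m]
  have hc : ∀ X, ContDiff ℝ 1 fun x => J x X := fun X => hJ.clm_apply contDiff_const
  have h1 := coordCoeff_fderiv (hp Y) (hc Y) i X m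
  have h2 := coordCoeff_fderiv (hp X) (hc X) i Y m
  have h3 : (fun x => fderiv ℝ (fun x => J x Y) x X) = fun x => fderiv ℝ (fun x => J x X) x Y := by
    funext x
    rw [fderiv_clm_apply_const (hJ.differentiable one_ne_zero x),
      fderiv_clm_apply_const (hJ.differentiable one_ne_zero x), hs]
  rw [h3, h2] at h1
  refine mul_left_cancel₀ Complex.I_ne_zero ?_
  linear_combination -h1

/-- A closed periodic field of linear maps is constant on a vector along which it is constant. -/
lemma eq_of_fderiv_apply_eq_zero (hJp : TorusPeriodic J) (hJ : ContDiff ℝ 1 J)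
    (hs : ∀ x a b, fderiv ℝ J x a b = fderiv ℝ J x b a) {X : Fin n → ℝ}
    (h : ∀ x, fderiv ℝ (fun y => J y X) x X = 0) (x y : Fin n → ℝ) : J x X = J y X := by
  have hp : TorusPeriodic fun x => J x X := fun x m => by simp only [hJp x m]
  have hc : ContDiff ℝ 1 fun x => J x X := hJ.clm_apply contDiff_const
  refine hp.eq_of_coordCoeff_eq_zero hc.continuous (fun i m hm => ?_) x y
  -- If m annihilates X, constancy along X says nothing about this coefficient; closedness against a
  -- basis vector with m_k ≠ 0 kills it instead.
  by_cases hX : intPairing m X = 0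
  · obtain ⟨k, hk⟩ := Function.ne_iff.1 hm
    have e := intPairing_mul_coordCoeff hJp hJ hs (Pi.single k 1) X i m
    rw [hX, intPairing_single] at e
    simp only [Complex.ofReal_zero, zero_mul, mul_eq_zero, Complex.ofReal_intCast,
      Int.cast_eq_zero] at e
    exact e.resolve_left hk
  · exact coordCoeff_eq_zero_of_fderiv_eq_zero hp hc h hX i

end Coordinates

/-! ### Metrics without a Euclidean uniformization -/

namespace LeafCoframe

/-- For a foliation with a resonance, stretching by a function which is constant on the leaves but
not on the torus gives a metric without a Euclidean uniformization. -/
theorem exists_not_uniformizable_of_resonant (c : LeafCoframe u v) {m : Fin n → ℤ} (hm : m ≠ 0)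
    (hmu : intPairing m u = 0) (hmv : intPairing m v = 0) :
    ∃ g : TorusMetric n, g.IsAnalytic ∧ ∀ h : TorusMetric n, h.IsOfClass 2 →
      ¬ h.IsEuclideanUniformization g (Submodule.span ℝ {u, v}) := by
  -- The function cos (m, x) / 2 is constant on the leaves, and the factor 1/2 keeps 1 + a positive.
  set a : (Fin n → ℝ) → ℝ := fun x => (torusChar m x).re / 2 with ha
  set b : (Fin n → ℝ) → ℝ := fun _ => 0 with hb
  have hac : ∀ r, ContDiff ℝ r a := fun r =>
    (Complex.reCLM.contDiff.comp (contDiff_torusChar m)).div_const 2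
  have hbc : ∀ r, ContDiff ℝ r b := fun r => contDiff_const
  have hap : TorusPeriodic a := fun x k => by simp only [ha, torusPeriodic_torusChar m x k]
  have hbp : TorusPeriodic b := fun x k => rfl
  have ha0 : ∀ x, 0 < 1 + a x := by
    intro x
    have h1 := (Complex.abs_re_le_norm (torusChar m x)).trans_eq (norm_torusChar m x)
    have := (abs_le.1 h1).1
    simp only [ha]
    linarith
  have had : ∀ x X, intPairing m X = 0 → fderiv ℝ a x X = 0 := by
    intro x X hX
    have h1 : HasFDerivAt a _ x :=
      (((Complex.reCLM.hasFDerivAt (x := torusChar m x)).comp x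
        (hasFDerivAt_torusChar m x)).mul_const (2⁻¹ : ℝ))
    rw [h1.fderiv]
    simp [intPairingCLM_apply, hX]
  refine ⟨c.metric (c.stretchForm a b) (c.torusPeriodic_stretchForm hap hbp)
    (c.nondegenerate_stretchForm ha0), c.isOfClass_metric (c.contDiff_stretchForm (hac _) (hbc _)),
    fun h hh hu => ?_⟩
  obtain ⟨J, α, γ, hJ, -, -, hα, hγ, hJu, hJv, heq, hconst⟩ := c.exists_leafwise_constant_frame
    (hac 2) (hbc 2) hap hbp ha0 (fun x => by rw [had x v hmv]; simp [hb]) hh hu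
  have hJp := hJ.torusPeriodic hh
  have hJ1 : ContDiff ℝ 1 J := (hJ.contDiff hh).of_le one_le_two
  have hcu : ∀ x, J x u = J 0 u := fun x => by
    refine eq_of_fderiv_apply_eq_zero hJp hJ1 hJ.fderiv_symm (fun x => ?_) x 0
    have h1 : HasFDerivAt (fun y => (1 + a y) • α y) _ x :=
      (((hac 1).differentiable one_ne_zero x).hasFDerivAt.const_add 1).smul
        (hα.differentiable two_ne_zero x).hasFDerivAt
    rw [show (fun y => J y u) = fun y => (1 + a y) • α y from funext hJu, h1.fderiv]
    simp [had x u hmu, (hconst x).1]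
  have hcv : ∀ x, J x v = J 0 v := fun x => by
    refine eq_of_fderiv_apply_eq_zero hJp hJ1 hJ.fderiv_symm (fun x => ?_) x 0
    rw [show (fun y => J y v) = γ from funext fun y => by simp [hJv, hb]]
    exact (hconst x).2.2.2
  have hv0 : v ≠ 0 := by
    rintro rfl
    have := c.snd_v
    simp at this
  have hpos : 0 < h.inner 0 (J 0 v) (J 0 v) :=
    h.inner_self_pos 0 fun h0 => hv0 (hJ.injective hh 0 h0)
  -- As α and γ have equal length, the constants |J u| and |J v| have ratio 1 + a(x), which is not
  -- constant: (m, x) = 0 and (m, x) = π give different values.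
  have hinner : ∀ x, h.inner 0 (J 0 u) (J 0 u) = (1 + a x) ^ 2 * h.inner 0 (J 0 v) (J 0 v) := by
    intro x
    have e1 : γ x = J 0 v := by rw [← hcv x, hJv, hb, zero_smul, add_zero]
    rw [← hcu x, hJu, ← e1, ← heq, ← TorusMetric.innerCLM_apply, ← TorusMetric.innerCLM_apply]
    simp only [map_smul, _root_.smul_apply, smul_eq_mul]
    ring
  set s : ℝ := ∑ j, (m j : ℝ) * m j with hs
  have hs0 : s ≠ 0 := by
    intro h0
    refine hm (funext fun j => ?_)
    have := (Finset.sum_eq_zero_iff_of_nonneg (fun j _ => mul_self_nonneg (m j : ℝ))).1 h0 j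
      (Finset.mem_univ j)
    simpa using this
  set x : Fin n → ℝ := fun j => Real.pi / s * m j with hx
  have hxm : intPairing m x = Real.pi := by
    have : intPairing m x = Real.pi / s * s := by
      rw [hs, Finset.mul_sum]
      exact Finset.sum_congr rfl fun j _ => by rw [hx]; ring
    rw [this, div_mul_cancel₀ _ hs0]
  have h1 : a x = -1 / 2 := by
    simp [ha, torusChar, hxm]
  have h2 : a 0 = 1 / 2 := by
    simp [ha, torusChar, intPairing]
  have e1 := hinner x
  have e2 := hinner 0
  rw [h1] at e1
  rw [h2] at e2
  norm_num at e1 e2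
  linarith

/-- For a foliation which is too well approximated by resonances, but has none, there is a leafwise
closed stretching which is not the derivative of a function. -/
theorem exists_not_uniformizable_of_liouville (c : LeafCoframe u v)
    (hres : ∀ m : Fin n → ℤ, m ≠ 0 → intPairing m u ≠ 0 ∨ intPairing m v ≠ 0) {ρ : ℝ} (hρ : 0 < ρ)
    (hinf : {m : Fin n → ℤ | m ≠ 0 ∧
      |intPairing m u| + |intPairing m v| ≤ Real.exp (-ρ * l1Size m)}.Infinite) :
    ∃ g : TorusMetric n, g.IsAnalytic ∧ ∀ h : TorusMetric n, h.IsOfClass 2 →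
      ¬ h.IsEuclideanUniformization g (Submodule.span ℝ {u, v}) := by
  classical
  set S := {m : Fin n → ℤ | m ≠ 0 ∧
    |intPairing m u| + |intPairing m v| ≤ Real.exp (-ρ * l1Size m)} with hS
  have hSneg : ∀ m, -m ∈ S ↔ m ∈ S := by
    intro m
    have : l1Size (-m) = l1Size m := by simp [l1Size]
    simp [hS, this, intPairing_neg_left]
  have hsum := summable_exp_neg_mul_l1Size (n := n) hρ
  set M := ∑' m : Fin n → ℤ, Real.exp (-ρ * l1Size m) with hM
  have hM0 : 0 ≤ M := tsum_nonneg fun m => (Real.exp_pos _).le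
  -- Keeps |a| at most 1/2, so that the stretching is nondegenerate.
  set ε : ℝ := 1 / (2 * (M + 1)) with hε
  have hε0 : 0 < ε := by positivity
  -- The coefficients of the derivative along X of the formal series of ε exp(i(m, x)) over m in S.
  -- They decay exponentially for X = u and X = v, where the divisors are small, but not in every
  -- direction.
  let A : (Fin n → ℝ) → (Fin n → ℤ) → ℂ := fun X m =>
    if m ∈ S then Complex.I * ε * intPairing m X else 0
  have hAle : ∀ X, (X = u ∨ X = v) → ∀ m, ‖A X m‖ ≤ ε * Real.exp (-ρ * l1Size m) := by
    intro X hX m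
    simp only [A]
    split_ifs with hm
    · rw [norm_mul, norm_mul, Complex.norm_I, one_mul, Complex.norm_real, Complex.norm_real,
        Real.norm_of_nonneg hε0.le, Real.norm_eq_abs]
      gcongr
      refine le_trans ?_ hm.2
      rcases hX with rfl | rfl
      · exact le_add_of_nonneg_right (abs_nonneg _)
      · exact le_add_of_nonneg_left (abs_nonneg _)
    · rw [norm_zero]
      positivity
  have hdec : ∀ X, (X = u ∨ X = v) → HasExpDecay (A X) := fun X hX => ⟨ρ, hρ, ε, hAle X hX⟩
  have hF : ∀ X, (X = u ∨ X = v) → AnalyticPeriodic (torusSeries (A X)) := fun X hX =>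
    analyticPeriodic_torusSeries (hdec X hX)
  have hreal : ∀ X x, ((torusSeries (A X) x).re : ℂ) = torusSeries (A X) x := by
    intro X x
    rw [← Complex.conj_eq_iff_re, torusSeries, Complex.conj_tsum, ← (Equiv.neg _).tsum_eq]
    congr 1
    funext m
    have h1 : A X (-m) = (starRingEnd ℂ) (A X m) := by
      simp only [A, hSneg]
      split_ifs
      · simp [intPairing_neg_left]
      · simp
    have h2 : torusChar (-m) x = (starRingEnd ℂ) (torusChar m x) := by
      rw [torusChar, torusChar, ← Complex.exp_conj, intPairing_neg_left]
      simp
    simp only [Equiv.neg_apply, h1, h2, map_mul, Complex.conj_conj]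
  have hcoef : ∀ X, (X = u ∨ X = v) → torusCoeff (torusSeries (A X)) = A X := fun X hX =>
    torusCoeff_torusSeries (hdec X hX).summable
  set a : (Fin n → ℝ) → ℝ := fun x => (torusSeries (A u) x).re with ha
  set b : (Fin n → ℝ) → ℝ := fun x => (torusSeries (A v) x).re with hb
  have hac : ContDiff ℝ ω a := Complex.reCLM.contDiff.comp (hF u (.inl rfl)).1
  have hbc : ContDiff ℝ ω b := Complex.reCLM.contDiff.comp (hF v (.inr rfl)).1
  have hap : TorusPeriodic a := fun x k => by simp only [ha, (hF u (.inl rfl)).2 x k]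
  have hbp : TorusPeriodic b := fun x k => by simp only [hb, (hF v (.inr rfl)).2 x k]
  have ha0 : ∀ x, 0 < 1 + a x := by
    intro x
    have h1 : ‖torusSeries (A u) x‖ ≤ ε * M := by
      refine tsum_of_norm_bounded ((hsum.hasSum).mul_left ε) fun m => ?_
      rw [norm_mul, norm_torusChar, mul_one]
      exact hAle u (.inl rfl) m
    have h2 : ε * M ≤ 1 / 2 := by
      rw [hε, div_mul_eq_mul_div, div_le_div_iff₀ (by positivity) two_pos]
      linarith
    have h3 := (abs_le.1 ((Complex.abs_re_le_norm (torusSeries (A u) x)).trans (h1.trans h2))).1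
    simp only [ha]
    linarith
  have hab : ∀ x, fderiv ℝ a x v = fderiv ℝ b x u := by
    have h1 : (fun x => fderiv ℝ (torusSeries (A u)) x v) = fun x => fderiv ℝ (torusSeries (A v)) x u := by
      refine ((hF u (.inl rfl)).fderiv_apply v).ext_torusCoeff ((hF v (.inr rfl)).fderiv_apply u) ?_
      funext m
      rw [(hF u (.inl rfl)).torusCoeff_fderiv, (hF v (.inr rfl)).torusCoeff_fderiv,
        hcoef u (.inl rfl), hcoef v (.inr rfl)]
      simp only [A]
      split_ifs
      · ring
      · ring
    have h2 : ∀ X, (X = u ∨ X = v) → ∀ x Y, fderiv ℝ (fun x => (torusSeries (A X) x).re) x Y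
        = (fderiv ℝ (torusSeries (A X)) x Y).re := by
      intro X hX x Y
      have e : HasFDerivAt (fun x => (torusSeries (A X) x).re) _ x :=
        Complex.reCLM.hasFDerivAt.comp x
          ((hF X hX).1.differentiable (by simp) x).hasFDerivAt
      rw [e.fderiv]
      rfl
    intro x
    rw [ha, hb, h2 u (.inl rfl), h2 v (.inr rfl), congrFun h1 x]
  refine ⟨c.metric (c.stretchForm a b) (c.torusPeriodic_stretchForm hap hbp)
    (c.nondegenerate_stretchForm ha0), c.isOfClass_metric (c.contDiff_stretchForm hac hbc),
    fun h hh hu => ?_⟩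
  obtain ⟨J, α, γ, hJ, hαp, hγp, hα, hγ, hJu, hJv, -, hconst⟩ := c.exists_leafwise_constant_frame
    (hac.of_le le_top) (hbc.of_le le_top) hap hbp ha0 hab hh hu
  have hJp := hJ.torusPeriodic hh
  have hJ1 : ContDiff ℝ 1 J := (hJ.contDiff hh).of_le one_le_two
  -- Without resonances, a function that is constant along the leaves is constant on the torus.
  have hcα : ∀ i m, m ≠ 0 → coordCoeff α i m = 0 := by
    intro i m hm
    rcases hres m hm with h1 | h1
    · exact coordCoeff_eq_zero_of_fderiv_eq_zero hαp (hα.of_le one_le_two)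
        (fun x => (hconst x).1) h1 i
    · exact coordCoeff_eq_zero_of_fderiv_eq_zero hαp (hα.of_le one_le_two)
        (fun x => (hconst x).2.1) h1 i
  have hcγ : ∀ i m, m ≠ 0 → coordCoeff γ i m = 0 := by
    intro i m hm
    rcases hres m hm with h1 | h1
    · exact coordCoeff_eq_zero_of_fderiv_eq_zero hγp (hγ.of_le one_le_two)
        (fun x => (hconst x).2.2.1) h1 i
    · exact coordCoeff_eq_zero_of_fderiv_eq_zero hγp (hγ.of_le one_le_two)
        (fun x => (hconst x).2.2.2) h1 i
  have hα0 : ∀ x, α x = α 0 := fun x => hαp.eq_of_coordCoeff_eq_zero hα.continuous hcα x 0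
  have hne : α 0 ≠ 0 := by
    intro h0
    have hu0 : u ≠ 0 := by
      rintro rfl
      have := c.fst_u
      simp at this
    refine hu0 (hJ.injective hh 0 ?_)
    rw [hJu, h0, smul_zero]
  obtain ⟨i, hi⟩ := Function.ne_iff.1 hne
  have hi' : α 0 i ≠ 0 := hi
  have hcJ : ∀ X, (X = u ∨ X = v) → ∀ m ∈ S,
      coordCoeff (fun x => J x X) i m = Complex.I * ε * intPairing m X * α 0 i := by
    intro X hX m hm
    obtain ⟨w, hw⟩ : ∃ w : Fin n → ℝ, ∀ x, J x X = w + (torusSeries (A X) x).re • α 0 := by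
      rcases hX with rfl | rfl
      · refine ⟨α 0, fun x => ?_⟩
        rw [hJu, hα0 x, add_smul, one_smul]
      · refine ⟨γ 0, fun x => ?_⟩
        rw [hJv, hα0 x, hγp.eq_of_coordCoeff_eq_zero hγ.continuous hcγ x 0]
    have e : (fun x => ((J x X i : ℝ) : ℂ))
        = fun x => (w i : ℂ) + (α 0 i : ℂ) * torusSeries (A X) x := by
      funext x
      rw [hw, ← hreal X x]
      simp
      ring
    have hconst0 : torusCoeff (fun _ : Fin n → ℝ => (w i : ℂ)) m = 0 := by
      have e1 := AnalyticPeriodic.torusCoeff_const_mul (f := fun _ : Fin n → ℝ => (1 : ℂ)) (w i : ℂ) m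
      simp only [mul_one] at e1
      have e2 := torusMean_torusChar (-m)
      rw [if_neg (neg_ne_zero.2 hm.1)] at e2
      rw [e1, torusCoeff]
      simp only [one_mul]
      rw [e2, mul_zero]
    rw [coordCoeff, e, AnalyticPeriodic.torusCoeff_add (AnalyticPeriodic.const _)
      ((AnalyticPeriodic.const _).mul (hF X hX)), AnalyticPeriodic.torusCoeff_const_mul, hconst0,
      hcoef X hX]
    simp only [A, if_pos hm]
    ring
  -- Closedness transfers the coefficients along u or v, whichever pairs nontrivially with m, to the
  -- coordinate directions; the small divisor cancels.
  have hcoord : ∀ m ∈ S, ∀ k, coordCoeff (fun x => J x (Pi.single k 1)) i m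
      = Complex.I * ε * m k * α 0 i := by
    intro m hm k
    have e : ∀ X, (X = u ∨ X = v) → intPairing m X ≠ 0 →
        coordCoeff (fun x => J x (Pi.single k 1)) i m = Complex.I * ε * m k * α 0 i := by
      intro X hX h0
      have e1 := intPairing_mul_coordCoeff hJp hJ1 hJ.fderiv_symm X (Pi.single k 1) i m
      rw [hcJ X hX m hm, intPairing_single] at e1
      have h0' : (intPairing m X : ℂ) ≠ 0 := by exact_mod_cast h0
      refine mul_left_cancel₀ h0' (e1.trans ?_)
      push_cast
      ring
    rcases hres m hm.1 with h1 | h1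
    · exact e u (.inl rfl) h1
    · exact e v (.inr rfl) h1
  have hsq : Summable fun m => ∑ k, ‖coordCoeff (fun x => J x (Pi.single k 1)) i m‖ ^ 2 := by
    refine summable_sum fun k _ => ?_
    have hp : TorusPeriodic fun x => J x (Pi.single k 1) := fun x m => by simp only [hJp x m]
    have hc : ContDiff ℝ 1 fun x => J x (Pi.single k 1) := hJ1.clm_apply contDiff_const
    exact ((hp.coord i).hasSum_sq_torusCoeff (hc.coord i).continuous).summable
  -- For each m in S some |m_k| ≥ 1, so the k-th coefficient has at least this square; infinitely
  -- many such m contradict Parseval.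
  have hδ : 0 < (ε * |α 0 i|) ^ 2 := by positivity
  have hfin := hsq.tendsto_cofinite_zero.eventually (gt_mem_nhds hδ)
  obtain ⟨m, hmS, hm⟩ := (hinf.sdiff (eventually_cofinite.1 hfin)).nonempty
  simp only [Set.mem_ofPred_eq, not_not] at hm
  obtain ⟨k, hk⟩ := Function.ne_iff.1 hmS.1
  have h1 : (ε * |α 0 i|) ^ 2 ≤ ‖coordCoeff (fun x => J x (Pi.single k 1)) i m‖ ^ 2 := by
    rw [hcoord m hmS k]
    simp only [norm_mul, Complex.norm_I, one_mul, Complex.norm_real, Real.norm_eq_abs,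
      abs_of_pos hε0, Complex.norm_intCast]
    have : (1 : ℝ) ≤ |(m k : ℝ)| := by exact_mod_cast Int.one_le_abs hk
    gcongr
    exact le_mul_of_one_le_right hε0.le this
  have h2 := Finset.single_le_sum (f := fun k => ‖coordCoeff (fun x => J x (Pi.single k 1)) i m‖ ^ 2)
    (fun k _ => sq_nonneg _) (Finset.mem_univ k)
  linarith

end LeafCoframe

/-- A resonance is treated apart because then functions constant on the leaves need not be constant,
and the coefficients of J at a resonant m are not determined by those along u and v. -/
theorem exists_not_uniformizable (huv : LinearIndependent ℝ ![u, v])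
    (h : ¬ IsWeaklyDiophantine u v) :
    ∃ g : TorusMetric n, g.IsAnalytic ∧ ∀ h : TorusMetric n, h.IsOfClass 2 →
      ¬ h.IsEuclideanUniformization g (Submodule.span ℝ {u, v}) := by
  obtain ⟨c⟩ := LeafCoframe.nonempty_of_linearIndependent huv
  have hn : 0 < n := by
    by_contra! hn
    obtain rfl : n = 0 := by lia
    exact huv.ne_zero 0 (Subsingleton.elim _ _)
  by_cases hres : ∃ m : Fin n → ℤ, m ≠ 0 ∧ intPairing m u = 0 ∧ intPairing m v = 0
  · obtain ⟨m, hm, hmu, hmv⟩ := hres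
    exact c.exists_not_uniformizable_of_resonant hm hmu hmv
  · push Not at hres
    obtain ⟨ρ, hρ, hinf⟩ := exists_infinite_of_not_isWeaklyDiophantine hn h
    exact c.exists_not_uniformizable_of_liouville
      (fun m hm => or_iff_not_imp_left.2 fun h1 => hres m hm (not_not.1 h1)) hρ hinf

end

theorem theorem3 (n : ℕ) (u v : Fin n → ℝ) (huv : LinearIndependent ℝ ![u, v]) :
    (IsWeaklyDiophantine u v →
      ∀ g : TorusMetric n, g.IsAnalytic →
        ∃ h : TorusMetric n, h.IsAnalytic ∧
          h.IsEuclideanUniformization g (Submodule.span ℝ {u, v})) ∧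
    (¬ IsWeaklyDiophantine u v →
      ∃ g : TorusMetric n, g.IsAnalytic ∧
        ∀ h : TorusMetric n, h.IsOfClass 2 →
          ¬ h.IsEuclideanUniformization g (Submodule.span ℝ {u, v})) :=
  ⟨fun h _ hg => h.exists_isEuclideanUniformization huv hg, exists_not_uniformizable huv⟩
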